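/- Setting. Work on $n$ qubits, with Hilbert space $(\mathbb C^2)^{\otimes n}$. Let $|\psi_0\rangle=|0\rangle$ and $|\psi_j\rangle=\frac1{\sqrt3}|0\rangle+e^{2\pi i(j-1)/3}\sqrt{\tfrac23}\,|1\rangle$ for $j=1,2,3$. Put $F_\alpha=\frac12|\psi_\alpha\rangle\langle\psi_\alpha|$ and $D_\alpha=3|\psi_\alpha\rangle\langle\psi_\alpha|-\mathbb 1$, and for $\underline\alpha\in\{0,1,2,3\}^n$ put $F_{\underline\alpha}=\bigotimes_iF_{\alpha_i}$ and $D_{\underline\alpha}=\bigotimes_iD_{\alpha_i}$. For a probability distribution $\mu$ on $\{0,1,2,3\}^n$ let $X(\mu)=\sum_{\underline\alpha}\mu(\underline\alpha)D_{\underline\alpha}$. For a set $I$ of qubits, $X_I$ denotes the partial trace of $X$ over all qubits outside $I$. A $k$-local quasi-quantum (qq) state is a Hermitian operator $X$ with $\mathrm{Tr}\,X=1$, $\mathrm{Tr}(F_{\underline\alpha}X)\ge0$ for all $\underline\alpha$, and $X_I\succeq0$ for all $I$ with $|I|=k$. For $H=\sum_ih_i$, where each $h_i=\hat h_i\otimes\mathbb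 1$ with $\hat h_i$ a Hermitian operator on $k$ of the qubits, let $L_H=\sum_i\|h_i\|$ (operator norm), and let $\epsilon_0^{qq}(H)$ be the minimum of $\mathrm{Tr}(HX)$ over all $k$-local qq states $X$ (the minimum exists). The inputs of the problem $k$-$\mathsf{qqLH}(H,a,b)$ are the number $n$ in unary, the list of the terms $h_i$ (the $k$ qubits acted on, and the entries of $\hat h_i$, which are Gaussian rationals in binary), and rationals $a<b$ in binary. In the YES case $\epsilon_0^{qq}(H)\le a$; in the NO case $\epsilon_0^{qq}(H)\ge b$. Theorem. For every $k\ge1$, every real $c>0$ and every $C\in\mathbb N$, the promise problem $k$-$\mathsf{qqLH}(H,a,b)$, restricted to inputs with $b-a\ge c\,L_H\,2^{-Cn}$, is in $\mathrm{NP}$: there is a verifier, running on a Turing machine in time polynomial in the length of input and witness, for which every YES input has an accepted witness of length polynomial in the length of the input, while for a NO input no witness is accepted. Moreover, for every $D\in\mathbb N$ there is such a verifier with the following properties. A distribution with rational probabilities is written as a bit string by listing strings $\underline\alpha\in\{0,1,2,3\}^n$ with natural-number weights (of positive total weight), the probability of $\underline\alpha$ being its share of the total weight. 1. For every YES input there are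 a qq ground state $X_0$ of $H$ (a $k$-local qq state with $\mathrm{Tr}(HX_0)=\epsilon_0^{qq}(H)$) and a distribution $\mu$ with $|\mathrm{supp}\,\mu|\le\binom nk4^k+1$ such that $\|X(\mu)_I-(X_0)_I\|\le2^{-Dn}$ (operator norm) for all $I$ with $|I|=k$, and such that some description of $\mu$, of length polynomial in the length of the input, is an accepted witness. 2. For every input, including those outside the promise: if a list of weighted strings is accepted, then its total weight is positive, and the distribution $\mu$ that it describes satisfies $X(\mu)_I+2^{-Dn}\mathbb 1\succeq0$ for all $I$ with $|I|=k$, and $\mathrm{Tr}(H\,X(\mu))\le a+2^{-Dn}L_H$. 3. For every input, including those outside the promise: every description of a distribution $\mu$ such that $X(\mu)_I\succeq0$ for all $I$ with $|I|=k$ and $\mathrm{Tr}(H\,X(\mu))\le a$ is accepted. -/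

import Mathlib

namespace QuasiQuantum

open scoped ComplexOrder Matrix

/-! ### Operators on `n` qubits -/

/-- Linear operators on `(ℂ²)^{⊗ n}`, as matrices in the computational basis
`Fin n → Fin 2` (the basis vector of `x` is `|x 0⟩ ⊗ ⋯ ⊗ |x (n-1)⟩`). -/
abbrev QubitOp (n : ℕ) : Type := Matrix (Fin n → Fin 2) (Fin n → Fin 2) ℂ

/-- The tensor product `A 0 ⊗ A 1 ⊗ ⋯ ⊗ A (n-1)` of single-qubit operators. -/
def tensorOp {n : ℕ} (A : Fin n → Matrix (Fin 2) (Fin 2) ℂ) : QubitOp n :=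
  Matrix.of fun x y => ∏ i, A i (x i) (y i)

/-- The assignment which is `x` on the qubits of `I` and `z` on all the other qubits. -/
def glue {n : ℕ} (I : Finset (Fin n)) (x : I → Fin 2) (z : {i : Fin n // i ∉ I} → Fin 2) :
    Fin n → Fin 2 :=
  fun i => if h : i ∈ I then x ⟨i, h⟩ else z ⟨i, h⟩

/-- The marginal `X_I = Tr_{∖ I} X`: all qubits outside `I` are traced out. -/
def marginal {n : ℕ} (I : Finset (Fin n)) (X : QubitOp n) :
    Matrix (I → Fin 2) (I → Fin 2) ℂ :=
  Matrix.of fun x y => ∑ z : {i : Fin n // i ∉ I} → Fin 2, X (glue I x z) (glue I y z)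

/-- The operator norm with respect to the Euclidean norm on `ℂ^ι`. -/
noncomputable def opNorm {ι : Type} [Fintype ι] [DecidableEq ι] (A : Matrix ι ι ℂ) : ℝ :=
  ‖Matrix.toEuclideanCLM (n := ι) (𝕜 := ℂ) A‖

/-! ### The SIC-POVM and its dual basis -/

/-- The four unit vectors `|ψ_α⟩` (a tetrahedron on the Bloch sphere). -/
noncomputable def sicVector : Fin 4 → Fin 2 → ℂ :=
  ![![1, 0],
    ![((1 / √3 : ℝ) : ℂ), ((√(2 / 3) : ℝ) : ℂ)],
    ![((1 / √3 : ℝ) : ℂ), Complex.exp (2 * Real.pi / 3 * Complex.I) * ((√(2 / 3) : ℝ) : ℂ)],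
    ![((1 / √3 : ℝ) : ℂ), Complex.exp (4 * Real.pi / 3 * Complex.I) * ((√(2 / 3) : ℝ) : ℂ)]]

/-- The rank-one projection `|ψ_α⟩⟨ψ_α|`. -/
noncomputable def sicProj (α : Fin 4) : Matrix (Fin 2) (Fin 2) ℂ :=
  Matrix.vecMulVec (sicVector α) (star (sicVector α))

/-- The POVM element `F_α = |ψ_α⟩⟨ψ_α| / 2`. -/
noncomputable def sicF (α : Fin 4) : Matrix (Fin 2) (Fin 2) ℂ := (1 / 2 : ℂ) • sicProj α

/-- The dual basis element `D_α = 3 |ψ_α⟩⟨ψ_α| - 1`. -/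
noncomputable def sicD (α : Fin 4) : Matrix (Fin 2) (Fin 2) ℂ := (3 : ℂ) • sicProj α - 1

/-- `F_α = F_{α_1} ⊗ ⋯ ⊗ F_{α_n}`. -/
noncomputable def multiF {n : ℕ} (α : Fin n → Fin 4) : QubitOp n := tensorOp fun i => sicF (α i)

/-- `D_α = D_{α_1} ⊗ ⋯ ⊗ D_{α_n}`. -/
noncomputable def multiD {n : ℕ} (α : Fin n → Fin 4) : QubitOp n := tensorOp fun i => sicD (α i)

/-- `X(μ) = ∑_α μ(α) D_α`. -/
noncomputable def opOfDist {n : ℕ} (μ : (Fin n → Fin 4) → ℝ) : QubitOp n :=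
  ∑ α, ((μ α : ℝ) : ℂ) • multiD α

/-! ### `k`-local quasi-quantum states -/

/-- `X` is a `k`-local quasi-quantum state on `n` qubits. -/
structure IsQQState {n : ℕ} (k : ℕ) (X : QubitOp n) : Prop where
  trace_eq_one : X.trace = 1
  isHermitian : X.IsHermitian
  global_pos : ∀ α : Fin n → Fin 4, 0 ≤ (multiF α * X).trace
  local_pos : ∀ I : Finset (Fin n), I.card = k → (marginal I X).PosSemidef

/-- All `k`-local marginals of `X` are positive semidefinite up to an additive error `ε`:
`X_I + ε 1 ⪰ 0` whenever `|I| = k`. -/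
def LocallyPositiveUpTo {n : ℕ} (k : ℕ) (ε : ℝ) (X : QubitOp n) : Prop :=
  ∀ I : Finset (Fin n), I.card = k → (marginal I X + (ε : ℂ) • 1).PosSemidef

/-! ### Local Hamiltonians -/

/-- A Hermitian operator `h = ĥ ⊗ 1_rest` on `n` qubits, where `ĥ` is an operator on `k` chosen
(distinct) qubits; its entries `re + i im` are Gaussian rationals. -/
structure LocalTerm (n k : ℕ) where
  /-- the qubits on which the term acts -/
  sites : Fin k ↪ Fin n
  /-- the real parts of the entries of `ĥ` -/
  re : Matrix (Fin k → Fin 2) (Fin k → Fin 2) ℚ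
  /-- the imaginary parts of the entries of `ĥ` -/
  im : Matrix (Fin k → Fin 2) (Fin k → Fin 2) ℚ
  re_symm : reᵀ = re
  im_antisymm : imᵀ = -im

/-- The operator `ĥ` on `k` qubits. -/
noncomputable def LocalTerm.localOp {n k : ℕ} (h : LocalTerm n k) : QubitOp k :=
  Matrix.of fun x y => (h.re x y : ℂ) + (h.im x y : ℂ) * Complex.I

open Classical in
/-- The operator `ĥ ⊗ 1_rest` on `n` qubits. -/
noncomputable def LocalTerm.op {n k : ℕ} (h : LocalTerm n k) : QubitOp n :=
  Matrix.of fun x y =>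
    if ∀ i, i ∉ Set.range h.sites → x i = y i then
      h.localOp (fun j => x (h.sites j)) (fun j => y (h.sites j))
    else 0

/-- An input of the quasi-quantum `k`-local Hamiltonian problem: a `k`-local Hamiltonian
`H = ∑ h_i` on `n` qubits and two thresholds `a`, `b`. -/
structure Instance (k : ℕ) where
  /-- the number of qubits -/
  n : ℕ
  /-- the local terms of the Hamiltonian -/
  terms : List (LocalTerm n k)
  /-- the lower threshold -/
  a : ℚ
  /-- the upper threshold -/
  b : ℚ

namespace Instance

variable {k : ℕ} (x : Instance k)

/-- The Hamiltonian `H = ∑ h_i`. -/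
noncomputable def hamiltonian : QubitOp x.n := (x.terms.map fun h => h.op).sum

/-- The approximation scale `L_H = ∑ ‖h_i‖`. -/
noncomputable def scale : ℝ := (x.terms.map fun h => opNorm h.op).sum

/-- The energy `Tr(H X)` (a real number for Hermitian `X`). -/
noncomputable def energy (X : QubitOp x.n) : ℝ := (x.hamiltonian * X).trace.re

/-- The quasi-quantum ground energy, the minimum of `Tr(H X)` over `k`-local quasi-quantum
states; see `isLeast_qqGroundEnergy`. -/
noncomputable def qqGroundEnergy : ℝ := sInf (x.energy '' {X | IsQQState k X})

/-- `X` is a quasi-quantum ground state of `H`. -/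
def IsQQGroundState (X : QubitOp x.n) : Prop := IsQQState k X ∧ x.energy X = x.qqGroundEnergy

end Instance

/-! ### Encodings as strings -/

open Computability (Γ' encodeNat)

/-- A natural number in binary, followed by a comma. -/
def encNat (m : ℕ) : List Γ' := (encodeNat m).map Γ'.bit ++ [Γ'.comma]

/-- A natural number in unary, followed by a comma. -/
def encUnary (m : ℕ) : List Γ' := List.replicate m (Γ'.bit true) ++ [Γ'.comma]

/-- A rational number: sign, numerator and denominator in binary. -/
def encRat (q : ℚ) : List Γ' :=
  Γ'.bit (decide (q < 0)) :: (encNat q.num.natAbs ++ encNat q.den)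

/-- A local term: its `k` qubits in unary, then its `2^k × 2^k` entries row by row. -/
def encTerm {n k : ℕ} (h : LocalTerm n k) : List Γ' :=
  (List.finRange k).flatMap (fun j => encUnary (h.sites j)) ++
  (List.finRange (2 ^ k)).flatMap fun r => (List.finRange (2 ^ k)).flatMap fun c =>
    encRat (h.re (finFunctionFinEquiv.symm r) (finFunctionFinEquiv.symm c)) ++
    encRat (h.im (finFunctionFinEquiv.symm r) (finFunctionFinEquiv.symm c))

/-- An instance: `n` in unary, the list of its terms, `a` and `b`. -/
def encInstance {k : ℕ} (x : Instance k) : List Γ' :=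
  encUnary x.n ++ x.terms.flatMap (fun h => Γ'.bra :: encTerm h) ++ [Γ'.ket] ++
    encRat x.a ++ encRat x.b

/-- A description of a distribution on `{0,1,2,3}ⁿ` as a list of strings, each with a natural
number as its weight. -/
abbrev DistDesc (n : ℕ) : Type := List ((Fin n → Fin 4) × ℕ)

namespace DistDesc

variable {n : ℕ} (W : DistDesc n)

/-- The sum of all weights; it has to be positive for `W` to describe a distribution. -/
def total : ℕ := (W.map Prod.snd).sum

/-- The distribution described by `W`: the probability of `α` is its share of the total weight. -/
noncomputable def dist (α : Fin n → Fin 4) : ℝ :=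
  ((((W.filter fun e => e.1 = α).map Prod.snd).sum : ℕ) : ℝ) / (W.total : ℝ)

/-- A description as a bit string. An item of the list is `1`, followed by two bits per letter of
the string, followed by the binary digits of the weight, each preceded by `1`, and then `0`;
a final `0` ends the list. -/
def encode : List Bool :=
  W.flatMap (fun e => true ::
      ((List.finRange n).flatMap (fun i => [(e.1 i).val.testBit 0, (e.1 i).val.testBit 1]) ++
        (encodeNat e.2).flatMap (fun d => [true, d]) ++ [false])) ++ [false]

end DistDesc

/-! ### Promise problems and NP -/

/-- A promise problem: YES inputs and NO inputs. -/
structure PromiseProblem (α : Type) where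
  /-- the YES inputs -/
  yes : Set α
  /-- the NO inputs -/
  no : Set α

/-- An input together with a witness, written as one string over the disjoint union of the two
alphabets. -/
def encPair {α Γ : Type} (enc : α → List Γ) (xw : α × List Bool) : List (Γ ⊕ Bool) :=
  (enc xw.1).map Sum.inl ++ xw.2.map Sum.inr

/-- `V` is an NP verifier for the promise problem `P`, with witnesses of length at most `p` of the
input length: `V` is computed by a Turing machine in polynomial time, every YES input has an
accepted witness, and no witness is accepted for a NO input. -/
structure IsNPVerifier {α Γ : Type} (enc : α → List Γ) (P : PromiseProblem α)
    (V : α × List Bool → Bool) (p : Polynomial ℕ) : Prop where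
  polyTime : Nonempty (Turing.TM2ComputableInPolyTime (encPair enc) Computability.encodeBool V)
  complete : ∀ x ∈ P.yes, ∃ w : List Bool, w.length ≤ p.eval (enc x).length ∧ V (x, w) = true
  sound : ∀ x ∈ P.no, ∀ w : List Bool, V (x, w) = false

/-- The promise problem `P`, with inputs encoded by `enc`, is in NP. -/
def InNP {α Γ : Type} (enc : α → List Γ) (P : PromiseProblem α) : Prop :=
  ∃ (V : α × List Bool → Bool) (p : Polynomial ℕ), IsNPVerifier enc P V p

/-! ### The quasi-quantum local Hamiltonian problem -/

/-- The thresholds satisfy `a < b` and have the promise gap `b - a ≥ c · L_H · 2^{-C n}`. -/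
def HasGap {k : ℕ} (c : ℝ) (C : ℕ) (x : Instance k) : Prop :=
  x.a < x.b ∧ c * x.scale / 2 ^ (C * x.n) ≤ (x.b : ℝ) - (x.a : ℝ)

/-- `k-qqLH(H, a, b)` with promise gap `b - a ≥ c · L_H · 2^{-C n}`. -/
def qqLH (k : ℕ) (c : ℝ) (C : ℕ) : PromiseProblem (Instance k) where
  yes := {x | HasGap c C x ∧ x.qqGroundEnergy ≤ x.a}
  no := {x | HasGap c C x ∧ x.b ≤ x.qqGroundEnergy}

/-! ### The quasi-quantum ground energy is a minimum -/

theorem sicF_apply (α : Fin 4) (i j : Fin 2) :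
    sicF α i j = 1 / 2 * (sicVector α i * star (sicVector α j)) := rfl

theorem exists_sicVector_eq : ∃ s t ω : ℂ, s * s = 1 / 3 ∧ t * t = 2 / 3 ∧ star s = s ∧
    star t = t ∧ ω ^ 2 + ω + 1 = 0 ∧ star ω = ω ^ 2 ∧
    sicVector = ![![1, 0], ![s, t], ![s, ω * t], ![s, ω ^ 2 * t]] := by
  have hp : IsPrimitiveRoot (Complex.exp (2 * Real.pi * Complex.I / (3 : ℕ))) 3 :=
    Complex.isPrimitiveRoot_exp 3 (by norm_num)
  have e1 : Complex.exp (2 * Real.pi / 3 * Complex.I) =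
      Complex.exp (2 * Real.pi * Complex.I / (3 : ℕ)) := by congr 1; push_cast; ring
  have e2 : Complex.exp (4 * Real.pi / 3 * Complex.I) =
      Complex.exp (2 * Real.pi / 3 * Complex.I) ^ 2 := by
    rw [← Complex.exp_nat_mul]; congr 1; push_cast; ring
  rw [← e1] at hp
  refine ⟨_, _, _, ?_, ?_, Complex.conj_ofReal _, Complex.conj_ofReal _, ?_, ?_,
    by rw [← e2]; rfl⟩
  · rw [← Complex.ofReal_mul, div_mul_div_comm, Real.mul_self_sqrt (by norm_num)]
    norm_num
  · rw [← Complex.ofReal_mul, Real.mul_self_sqrt (by norm_num)]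
    norm_num
  · have h := hp.geom_sum_eq_zero (by norm_num)
    simp only [Finset.sum_range_succ, Finset.sum_range_zero, pow_zero, pow_one] at h
    linear_combination h
  · have h3 := hp.pow_eq_one
    have h0 : Complex.exp (2 * Real.pi / 3 * Complex.I) ≠ 0 := Complex.exp_ne_zero _
    have hs : star (Complex.exp (2 * Real.pi / 3 * Complex.I)) *
        Complex.exp (2 * Real.pi / 3 * Complex.I) = 1 := by
      rw [Complex.star_def, ← Complex.exp_conj, ← Complex.exp_add]
      simp [Complex.conj_ofNat]
    apply mul_right_cancel₀ h0
    rw [hs, ← h3]; ring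

/-- The POVM elements sum up to the identity, and every matrix unit is a linear combination of
them. -/
theorem sicF_sum_and_span : (∑ α, sicF α = 1) ∧
    ∃ G : Fin 2 → Fin 2 → Fin 4 → ℂ, ∀ a b i j : Fin 2,
      ∑ α, G a b α * sicF α i j = if i = a ∧ j = b then 1 else 0 := by
  obtain ⟨s, t, ω, hs, ht, cs, ct, h1, h2, hv⟩ := exists_sicVector_eq
  have hω3 : ω ^ 3 = 1 := by linear_combination (ω - 1) * h1
  have hω4 : ω ^ 4 = ω := by linear_combination ω * hω3
  have hst : s * t ≠ 0 := by
    intro h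
    have : (s * s) * (t * t) = 0 := by linear_combination (s * t) * h
    rw [hs, ht] at this
    norm_num at this
  have hω2 : star (ω ^ 2) = ω := by rw [star_pow, h2, ← pow_mul, hω4]
  have c1 : star (ω * t) = ω ^ 2 * t := by rw [star_mul', h2, ct]
  have c2 : star (ω ^ 2 * t) = ω * t := by rw [star_mul', hω2, ct]
  have key : ∀ (g : Fin 4 → ℂ) (i j : Fin 2), ∑ α, g α * sicF α i j =
      !![g 0 / 2 + (g 1 + g 2 + g 3) / 6, s * t / 2 * (g 1 + ω ^ 2 * g 2 + ω * g 3);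
        s * t / 2 * (g 1 + ω * g 2 + ω ^ 2 * g 3), (g 1 + g 2 + g 3) / 3] i j := by
    intro g i j
    simp only [Fin.sum_univ_four, sicF_apply, hv]
    fin_cases i <;> fin_cases j <;>
      simp [c1, c2, cs, ct, -star_mul', -star_pow, -RCLike.star_def]
    · linear_combination (g 1 + g 2 + g 3) / 2 * hs
    · ring
    · ring
    · linear_combination (g 1 + g 2 * ω ^ 3 + g 3 * ω ^ 3) / 2 * ht + (g 2 + g 3) / 3 * hω3
  constructor
  · ext i j
    have h := key (fun _ => 1) i j
    simp only [one_mul] at h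
    rw [Matrix.sum_apply, h]
    fin_cases i <;> fin_cases j <;> simp
    · norm_num
    · right; linear_combination h1
    · right; linear_combination h1
    · norm_num
  · obtain ⟨r, hr⟩ : ∃ r : ℂ, s * t / 2 * r * 3 = 1 :=
      ⟨2 / (3 * (s * t)), by field_simp; exact div_self hst⟩
    refine ⟨![![![2, 0, 0, 0], ![0, r, r * ω, r * ω ^ 2]],
      ![![0, r, r * ω ^ 2, r * ω], ![-1, 1, 1, 1]]], ?_⟩
    intro a b i j
    rw [key]
    fin_cases a <;> fin_cases b <;> fin_cases i <;> fin_cases j <;> simp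
    all_goals first
      | linear_combination r * h1
      | linear_combination hr + s * t * r * hω3
      | (right; linear_combination r * h1 + r * hω4)
      | (right; linear_combination h1)
      | norm_num

theorem tensorOp_mul_trace_sum {n : ℕ} (X : QubitOp n) (A : Fin n → Matrix (Fin 2) (Fin 2) ℂ) :
    (tensorOp A * X).trace = ∑ x, ∑ y, (∏ i, A i (x i) (y i)) * X y x := rfl

/-- An operator is determined by the numbers `Tr(F_α X)`. -/
theorem eq_zero_of_trace_multiF {n : ℕ} (X : QubitOp n)
    (h : ∀ α : Fin n → Fin 4, (multiF α * X).trace = 0) : X = 0 := by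
  obtain ⟨-, G, hG⟩ := sicF_sum_and_span
  ext y x
  have h1 : ∑ α : Fin n → Fin 4, (∏ i, G (x i) (y i) (α i)) * (multiF α * X).trace = X y x := by
    simp only [multiF, tensorOp_mul_trace_sum, Finset.mul_sum]
    rw [Finset.sum_comm]
    have : ∀ x' : Fin n → Fin 2, (∑ α : Fin n → Fin 4, ∑ y' : Fin n → Fin 2,
        (∏ i, G (x i) (y i) (α i)) * ((∏ i, sicF (α i) (x' i) (y' i)) * X y' x')) =
        ∑ y' : Fin n → Fin 2, if x' = x ∧ y' = y then X y' x' else 0 := by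
      intro x'
      rw [Finset.sum_comm]
      refine Finset.sum_congr rfl fun y' _ => ?_
      have e : ∀ α : Fin n → Fin 4,
          (∏ i, G (x i) (y i) (α i)) * ((∏ i, sicF (α i) (x' i) (y' i)) * X y' x') =
          (∏ i, G (x i) (y i) (α i) * sicF (α i) (x' i) (y' i)) * X y' x' := by
        intro α; rw [Finset.prod_mul_distrib]; ring
      simp only [e]
      rw [← Finset.sum_mul, ← Fintype.prod_sum
        (fun i a => G (x i) (y i) a * sicF a (x' i) (y' i))]
      simp only [hG]
      by_cases hc : x' = x ∧ y' = y
      · rw [if_pos hc, hc.1, hc.2]; simp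
      · rw [if_neg hc]
        have : ∃ i, ¬ (x' i = x i ∧ y' i = y i) := by
          by_contra! hall
          exact hc ⟨funext fun i => (hall i).1, funext fun i => (hall i).2⟩
        obtain ⟨i, hi⟩ := this
        rw [Finset.prod_eq_zero (Finset.mem_univ i) (by rw [if_neg hi]), zero_mul]
    simp only [this]
    rw [Finset.sum_eq_single x, Finset.sum_eq_single y]
    · simp
    · intro b _ hb; rw [if_neg (by tauto)]
    · simp
    · intro b _ hb; exact Finset.sum_eq_zero fun c _ => by rw [if_neg (by tauto)]
    · simp
  rw [← h1]
  simp [h]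

theorem sum_multiF (n : ℕ) : ∑ α : Fin n → Fin 4, multiF α = (1 : QubitOp n) := by
  ext x y
  simp only [Matrix.sum_apply, multiF, tensorOp, Matrix.of_apply]
  rw [← Fintype.prod_sum (fun i a => sicF a (x i) (y i))]
  have : ∀ i, ∑ a, sicF a (x i) (y i) = (1 : Matrix (Fin 2) (Fin 2) ℂ) (x i) (y i) := by
    intro i; rw [← sicF_sum_and_span.1, Matrix.sum_apply]
  simp only [this, Matrix.one_apply]
  by_cases h : x = y
  · subst h; simp
  · rw [if_neg h]
    obtain ⟨i, hi⟩ := Function.ne_iff.mp h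
    exact Finset.prod_eq_zero (Finset.mem_univ i) (if_neg hi)

theorem trace_multiF_nonneg {n : ℕ} (α : Fin n → Fin 4) : 0 ≤ (multiF α).trace := by
  refine Finset.sum_nonneg fun x _ => ?_
  show 0 ≤ ∏ i, sicF (α i) (x i) (x i)
  refine Finset.prod_nonneg fun i _ => ?_
  rw [sicF_apply]
  exact mul_nonneg (by norm_num [Complex.le_def]) (mul_star_self_nonneg _)

/-- The maximally mixed state. -/
theorem isQQState_maximallyMixed (n k : ℕ) :
    IsQQState k (((2 : ℂ) ^ n)⁻¹ • (1 : QubitOp n)) := by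
  have hpos : (0 : ℂ) ≤ ((2 : ℂ) ^ n)⁻¹ := by
    have : (0 : ℂ) ≤ (((2 : ℝ) ^ n)⁻¹ : ℝ) := by
      rw [Complex.zero_le_real]; positivity
    simpa using this
  refine ⟨?_, ?_, ?_, ?_⟩
  · simp [Matrix.trace_smul]
  · exact (Matrix.PosSemidef.one.smul hpos).isHermitian
  · intro α
    rw [Matrix.mul_smul, Matrix.mul_one, Matrix.trace_smul, smul_eq_mul]
    exact mul_nonneg hpos (trace_multiF_nonneg α)
  · intro I _
    have : marginal I (((2 : ℂ) ^ n)⁻¹ • (1 : QubitOp n)) =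
        ((∑ _z : {i : Fin n // i ∉ I} → Fin 2, ((2 : ℂ) ^ n)⁻¹)) • 1 := by
      ext x y
      simp only [marginal, Matrix.of_apply, Matrix.smul_apply, Matrix.one_apply, smul_eq_mul]
      rw [Finset.sum_mul]
      refine Finset.sum_congr rfl fun z _ => ?_
      have hiff : glue I x z = glue I y z ↔ x = y := by
        constructor
        · intro h; funext i
          have := congrFun h i.1
          simpa [glue, i.2] using this
        · rintro rfl; rfl
      simp only [hiff]
    rw [this]
    exact Matrix.PosSemidef.one.smul (Finset.sum_nonneg fun _ _ => hpos)

theorem isCompact_qqStates (n k : ℕ) : IsCompact {X : QubitOp n | IsQQState k X} := by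
  let T : QubitOp n →ₗ[ℂ] ((Fin n → Fin 4) → ℂ) :=
    { toFun := fun X α => (multiF α * X).trace
      map_add' := fun X Y => by funext α; simp [Matrix.mul_add]
      map_smul' := fun r X => by funext α; simp }
  have hT : Function.Injective T := by
    rw [injective_iff_map_eq_zero]
    intro X hX
    exact eq_zero_of_trace_multiF X fun α => congrFun hX α
  have hemb := LinearMap.isClosedEmbedding_of_injective (f := T) (LinearMap.ker_eq_bot.mpr hT)
  have hK : IsCompact (T ⁻¹' (Set.univ.pi fun _ => Metric.closedBall (0 : ℂ) 1)) :=
    hemb.isCompact_preimage (isCompact_univ_pi fun _ => isCompact_closedBall _ _)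
  refine hK.of_isClosed_subset ?_ ?_
  · have : {X : QubitOp n | IsQQState k X} =
        {X | X.trace = 1} ∩ {X | Xᴴ = X} ∩ (⋂ α, {X | 0 ≤ (multiF α * X).trace}) ∩
        ⋂ I : Finset (Fin n), ⋂ _ : I.card = k, {X | (marginal I X).PosSemidef} := by
      ext X
      simp only [Set.mem_ofPred_eq, Set.mem_inter_iff, Set.mem_iInter]
      exact ⟨fun h => ⟨⟨⟨h.1, h.2⟩, h.3⟩, h.4⟩, fun h => ⟨h.1.1.1, h.1.1.2, h.1.2, h.2⟩⟩
    rw [this]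
    refine ((IsClosed.inter ?_ ?_).inter ?_).inter ?_
    · exact isClosed_eq (by fun_prop) continuous_const
    · exact isClosed_eq (by fun_prop) continuous_id
    · refine isClosed_iInter fun α => ?_
      exact isClosed_le continuous_const (by fun_prop)
    · refine isClosed_iInter fun I => isClosed_iInter fun _ => ?_
      have hc : Continuous fun X : QubitOp n => marginal I X := by
        refine continuous_matrix fun x y => ?_
        simp only [marginal, Matrix.of_apply]
        fun_prop
      have : {X : QubitOp n | (marginal I X).PosSemidef} =
          {X | (marginal I X)ᴴ = marginal I X} ∩
            ⋂ v : (I → Fin 2) → ℂ, {X | 0 ≤ star v ⬝ᵥ (marginal I X *ᵥ v)} := by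
        ext X
        simp only [Set.mem_ofPred_eq, Set.mem_inter_iff, Set.mem_iInter]
        rw [Matrix.posSemidef_iff_dotProduct_mulVec]
        rfl
      rw [this]
      refine IsClosed.inter (isClosed_eq hc.matrix_conjTranspose hc) (isClosed_iInter fun v => ?_)
      refine isClosed_le continuous_const ?_
      exact continuous_const.dotProduct (hc.matrix_mulVec continuous_const)
  · intro X hX
    have hsum : ∑ α, (multiF α * X).trace = 1 := by
      rw [← Matrix.trace_sum, ← Finset.sum_mul, sum_multiF, one_mul, hX.trace_eq_one]
    simp only [Set.mem_preimage, Set.mem_pi, Set.mem_univ, forall_true_left]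
    intro α
    have hα := hX.global_pos α
    have hle : (multiF α * X).trace ≤ 1 := by
      rw [← hsum]
      exact Finset.single_le_sum (f := fun α => (multiF α * X).trace)
        (fun β _ => hX.global_pos β) (Finset.mem_univ α)
    rw [mem_closedBall_zero_iff]
    show ‖(multiF α * X).trace‖ ≤ 1
    have h1 := CStarAlgebra.norm_le_norm_of_nonneg_of_le hα hle
    simpa using h1

theorem isLeast_qqGroundEnergy {k : ℕ} (x : Instance k) :
    IsLeast (x.energy '' {X | IsQQState k X}) x.qqGroundEnergy := by
  have hc : Continuous x.energy := by
    unfold Instance.energy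
    fun_prop
  exact ((isCompact_qqStates x.n k).image hc).isLeast_sInf
    ⟨_, _, isQQState_maximallyMixed x.n k, rfl⟩

end QuasiQuantum

/-! ### Compiling structured stack programs to Turing machines -/

namespace StackProg

open Turing Function

/-! The operators `D_α` are dual to the `F_α`: `Tr(F_β D_α) = δ_{βα}`. This holds because the four
vectors form a regular tetrahedron. Since the `F_α` also determine an operator, every `X` is `∑
Tr(F_α X) D_α`. A quasi-quantum state is therefore the same thing as a probability distribution `μ`
on `{0,1,2,3}ⁿ` whose operator has positive `k`-local marginals (`IsQQState.exists_eq_opOfDist`).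

Completeness. Each `D` has trace one, so the `k`-local marginals of `X(μ)` and its energy depend
only on the marginals of `μ` on `k` letters. These live in a space of dimension `binom(n,k) 4^k`,
and Carathéodory's theorem replaces the distribution of a ground state by one with the same
marginals and at most `binom(n,k) 4^k + 1` strings (`exists_sparse_sameMarginals`). Rounding the
probabilities down to multiples of a sufficiently small `1/N` and renormalizing
(`exists_nat_weights`) changes `μ` by an exponentially small amount in `ℓ¹`, hence also its
marginals and its energy. The resulting list of weighted strings is the witness.

Soundness. With `ε = 2^(-E(n+1))` the verifier tests `X(μ)_I + ε ⪰ 0` for all `I`, and that the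
energy is at most `a + ε S / (2·4^k)`. Here `S` is the sum of the absolute values of all real and
imaginary parts of entries. It is a computable substitute for `L_H`, because `S ≤ 2·4^k L_H`. Mixing
an accepted `X(μ)` with a fraction `2^k ε` of the maximally mixed state gives a genuine
quasi-quantum state (`isQQState_mix`) of energy at most `a + O(ε S)`. For large `E` this is below
`b`, so a NO input accepts nothing (`Accepts.lt`).

Exactness. The entries of the `D_α` have real and imaginary parts in `½ ℤ[√2, √3]`, so the tests can
be carried out without numerical error. Sign tests in this ring reduce to integers by squaring
(`quadRep`). As `k` is constant, positivity of a `2^k × 2^k` matrix is decided by the signs of the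
coefficients of a characteristic polynomial (`posSemidef_iff_coeff_charpoly`). The acceptance
condition is thus exactly the one stated above (`verify_encode_iff`), which gives the two claims
about inputs outside the promise.

Polynomial time. A small language of stack programs is compiled to `FinTM2` with a step count
(`Exec.machine_steps`). On top of it, data are binary trees written in preorder on one stack. The
tree transformations that run in polynomial time with polynomially large output (`PT`) are closed
under composition, pairing, branching, and folds with polynomially bounded intermediate states.
Binary arithmetic, exact real arithmetic, the parsers and the tests are built from these closure
properties. -/

/-- Structured programs that act on finitely many stacks; the stack `k` has the alphabet `Γ k`. -/
inductive Cmd {K : Type} (Γ : K → Type) : Type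
  /-- do nothing -/
  | skip : Cmd Γ
  /-- push a symbol -/
  | push (k : K) (a : Γ k) : Cmd Γ
  /-- pop a stack and branch on the result -/
  | pop (k : K) (p : Option (Γ k) → Cmd Γ) : Cmd Γ
  /-- pop a stack repeatedly, until it is empty, and run a program for each popped symbol -/
  | loop (k : K) (p : Γ k → Cmd Γ) : Cmd Γ
  /-- run one program after the other -/
  | seq (p q : Cmd Γ) : Cmd Γ

variable {K : Type} {Γ : K → Type}

/-- `Exec p s s' t`: started with the stacks `s`, the program `p` stops with the stacks `s'` after
exactly `t` steps. -/
inductive Exec [DecidableEq K] : Cmd Γ → (∀ k, List (Γ k)) → (∀ k, List (Γ k)) → ℕ → Prop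
  | skip (s) : Exec .skip s s 1
  | push (s k a) : Exec (.push k a) s (update s k (a :: s k)) 1
  | pop {s k p s' t} : Exec (p (s k).head?) (update s k (s k).tail) s' t →
      Exec (.pop k p) s s' (t + 1)
  | loop_nil {s k p} : s k = [] → Exec (.loop k p) s s 1
  -- The loop resumes with whatever the body has left on stack `k`. A body that pushes onto `k`
  -- turns it into a while loop, and both the reading of trees and the folds rely on this.
  | loop_cons {s k p a l s' s'' t t'} : s k = a :: l → Exec (p a) (update s k l) s' t →
      Exec (.loop k p) s' s'' t' → Exec (.loop k p) s s'' (t' + t + 1)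
  | seq {p q s s' s'' t t'} : Exec p s s' t → Exec q s' s'' t' → Exec (.seq p q) s s'' (t' + t)

namespace Cmd

/-- The program points of a program. -/
def Lab : Cmd Γ → Type
  | skip => Unit
  | push _ _ => Unit
  | pop k p => Option (Σ a : Option (Γ k), Lab (p a))
  | loop k p => Option (Σ a : Γ k, Lab (p a))
  | seq p q => Lab p ⊕ Lab q

/-- The program point at which the execution of a program starts. -/
def entry : (p : Cmd Γ) → Lab p
  | skip => ()
  | push _ _ => ()
  | pop _ _ => none
  | loop _ _ => none
  | seq p _ => Sum.inl (entry p)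

noncomputable instance fintypeLab [∀ k, Fintype (Γ k)] : (p : Cmd Γ) → Fintype (Lab p)
  | skip => inferInstanceAs (Fintype Unit)
  | push _ _ => inferInstanceAs (Fintype Unit)
  | pop k p =>
    haveI := fun a => fintypeLab (p a)
    inferInstanceAs (Fintype (Option (Σ a : Option (Γ k), Lab (p a))))
  | loop k p =>
    haveI := fun a => fintypeLab (p a)
    inferInstanceAs (Fintype (Option (Σ a : Γ k, Lab (p a))))
  | seq p q =>
    haveI := fintypeLab p
    haveI := fintypeLab q
    inferInstanceAs (Fintype (Lab p ⊕ Lab q))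

/-- The symbol of the stack `k` that is held in the internal memory, if any. -/
def held [DecidableEq K] (k : K) : Option (Σ k, Γ k) → Option (Γ k)
  | none => none
  | some ⟨k', a⟩ => if h : k' = k then some (h ▸ a) else none

theorem held_map [DecidableEq K] (k : K) (o : Option (Γ k)) :
    held k (o.map (Sigma.mk k)) = o := by
  cases o <;> simp [held]

/-- The statement of the stack machine at each program point, for a program whose program points
are embedded into the labels `Λ` by `e` and which continues at the label `x`. -/
def code [DecidableEq K] {Λ : Type} :
    (p : Cmd Γ) → (Lab p → Λ) → Λ → Lab p → TM2.Stmt Γ Λ (Option (Σ k, Γ k))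
  | skip, _, x, _ => .goto fun _ => x
  | push k a, _, x, _ => .push k (fun _ => a) (.goto fun _ => x)
  | pop k _, e, _, none => .pop k (fun _ o => o.map (Sigma.mk k))
      (.goto fun v => e (some ⟨held k v, entry _⟩))
  | pop _ p, e, x, some ⟨a, l⟩ => code (p a) (fun l => e (some ⟨a, l⟩)) x l
  | loop k _, e, x, none => .pop k (fun _ o => o.map (Sigma.mk k))
      (.goto fun v => (held k v).elim x fun a => e (some ⟨a, entry _⟩))
  | loop _ p, e, _, some ⟨a, l⟩ => code (p a) (fun l => e (some ⟨a, l⟩)) (e none) l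
  | seq p q, e, _, .inl l => code p (fun l => e (.inl l)) (e (.inr (entry q))) l
  | seq _ q, e, x, .inr l => code q (fun l => e (.inr l)) x l

end Cmd

open Cmd

theorem iterate_bind_add {σ : Type*} {f : σ → Option σ} {a b : σ} {c : Option σ} {m n : ℕ}
    (h : (flip bind f)^[m] (some a) = some b) (h' : (flip bind f)^[n] (some b) = c) :
    (flip bind f)^[n + m] (some a) = c := by
  rw [Function.iterate_add_apply, h, h']

/-- Induction on the run. The embedding `e` and the exit label `x` are arbitrary, so that the code
of a subprogram is again of the assumed form. The internal memory matters only between a `pop` and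
the jump that directly follows it; hence any `v` is allowed at the start and nothing is claimed
about `v'`. -/
theorem Exec.machine_steps [DecidableEq K] {Λ : Type} {M : Λ → TM2.Stmt Γ Λ (Option (Σ k, Γ k))}
    {p : Cmd Γ} {s s' : ∀ k, List (Γ k)} {t : ℕ} (h : Exec p s s' t) :
    ∀ {e : Lab p → Λ} {x : Λ}, (∀ l, M (e l) = code p e x l) → ∀ v, ∃ v',
      (flip bind (TM2.step M))^[t] (some ⟨some (e (entry p)), v, s⟩) =
        some ⟨some x, v', s'⟩ := by
  induction h with
  | skip s =>
    intro e x hM v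
    exact ⟨v, by simp [flip, TM2.step, hM, code]⟩
  | push s k a =>
    intro e x hM v
    exact ⟨v, by simp [flip, TM2.step, hM, code]⟩
  | @pop s k p s' t _ ih =>
    intro e x hM v
    obtain ⟨v', hv'⟩ := ih (e := fun l => e (some ⟨_, l⟩)) (x := x)
      (fun l => hM (some ⟨_, l⟩)) ((s k).head?.map (Sigma.mk k))
    refine ⟨v', iterate_bind_add (m := 1) ?_ hv'⟩
    have h0 := hM none
    -- The type of the entry label depends on the popped symbol, so `held_map` cannot be used as a
    -- rewrite inside the label. The equality is transported by substitution instead.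
    have he : ∀ o, o = (s k).head? →
        e (some ⟨o, entry (p o)⟩) = e (some ⟨(s k).head?, entry (p (s k).head?)⟩) := by
      rintro _ rfl; rfl
    simp only [entry, code] at h0 ⊢
    simp [flip, TM2.step, h0, he _ (held_map k (s k).head?)]
  | @loop_nil s k p hs =>
    intro e x hM v
    refine ⟨none, ?_⟩
    have h0 := hM none
    have hu : update s k [] = s := by rw [← hs, update_eq_self]
    simp only [entry, code] at h0 ⊢
    simp [flip, TM2.step, h0, hs, held, hu]
  | @loop_cons s k p a l s' s'' t t' hs _ _ ih ih' =>
    intro e x hM v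
    obtain ⟨v', hv'⟩ := ih (e := fun l => e (some ⟨_, l⟩)) (x := e none)
      (fun l => hM (some ⟨_, l⟩)) (some (Sigma.mk k a))
    obtain ⟨v'', hv''⟩ := ih' hM v'
    refine ⟨v'', iterate_bind_add (m := 1) ?_ (iterate_bind_add hv' hv'')⟩
    have h0 := hM none
    simp only [entry, code] at h0 ⊢
    simp [flip, TM2.step, h0, hs, held]
  | @seq p q s s' s'' t t' _ _ ih ih' =>
    intro e x hM v
    obtain ⟨v', hv'⟩ := ih (e := fun l => e (.inl l)) (fun l => hM (.inl l)) v
    obtain ⟨v'', hv''⟩ := ih' (e := fun l => e (.inr l)) (fun l => hM (.inr l)) v'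
    exact ⟨v'', iterate_bind_add hv' hv''⟩

/-- The stack machine that runs the program `p`. -/
noncomputable def machine [DecidableEq K] [Fintype K] [∀ k, Fintype (Γ k)] (p : Cmd Γ)
    (k₀ k₁ : K) : FinTM2 where
  K := K
  k₀ := k₀
  k₁ := k₁
  Γ := Γ
  Λ := Option (Lab p)
  main := some (entry p)
  σ := Option (Σ k, Γ k)
  initialState := none
  m
    -- `haltList` requires the internal memory to be back in its initial state. This reset is the
    -- one step by which the machine exceeds the program.
    | none => .load (fun _ => none) .halt
    | some l => code p some none l

/-- The stacks that are all empty, except that `k₀` holds `l`. -/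
def onlyStack [DecidableEq K] (k₀ : K) (l : List (Γ k₀)) (k : K) : List (Γ k) :=
  if h : k = k₀ then Eq.mpr (congrArg (fun k => List (Γ k)) h) l else []

/-- The left side is the form in which `initList` and `haltList` describe the stacks, up to
definitional unfolding. -/
theorem onlyStack_eq_update [DecidableEq K] (k₀ : K) (l : List (Γ k₀)) :
    onlyStack k₀ l = update (fun _ => []) k₀ l := by
  funext k
  by_cases h : k = k₀
  · subst h
    simp [onlyStack]
  · simp [onlyStack, h]

theorem tm2ComputableInPolyTime_of_exec [DecidableEq K] [Fintype K] [∀ k, Fintype (Γ k)]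
    (p : Cmd Γ) (k₀ k₁ : K) {α β : Type} (ea : α → List (Γ k₀)) (eb : β → List (Γ k₁)) (f : α → β)
    (P : Polynomial ℕ)
    (h : ∀ a, ∃ t ≤ P.eval (ea a).length,
      Exec p (update (fun _ => []) k₀ (ea a)) (update (fun _ => []) k₁ (eb (f a))) t) :
    Nonempty (TM2ComputableInPolyTime ea eb f) := by
  refine ⟨{ tm := machine p k₀ k₁, inputAlphabet := Equiv.refl _, outputAlphabet := Equiv.refl _,
            time := P + 1, outputsFun := fun a => ?_ }⟩
  choose t ht ht' using h
  refine { steps := 1 + t a, evals_in_steps := ?_, steps_le_m := ?_ }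
  · obtain ⟨v, hv⟩ := (ht' a).machine_steps (M := (machine p k₀ k₁).m) (e := some) (x := none)
      (fun l => rfl) none
    have hi : initList (machine p k₀ k₁) (List.map (Equiv.refl _).invFun (ea a)) =
        ⟨some (some (entry p)), none, update (fun _ => []) k₀ (ea a)⟩ :=
      congrArg (TM2.Cfg.mk (some (some (entry p))) none)
        ((congrArg (onlyStack k₀) (List.map_id (ea a))).trans (onlyStack_eq_update k₀ _))
    have ho : haltList (machine p k₀ k₁) (List.map (Equiv.refl _).invFun (eb (f a))) =
        ⟨none, none, update (fun _ => []) k₁ (eb (f a))⟩ :=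
      congrArg (TM2.Cfg.mk none none)
        ((congrArg (onlyStack k₁) (List.map_id (eb (f a)))).trans (onlyStack_eq_update k₁ _))
    refine (congrArg (fun c => (flip bind (machine p k₀ k₁).step)^[1 + t a] (some c)) hi).trans ?_
    refine (iterate_bind_add hv rfl).trans ?_
    exact (congrArg some ho).symm
  · rw [Polynomial.eval_add, Polynomial.eval_one, add_comm]
    exact Nat.add_le_add_right (ht a) 1

end StackProg

namespace StackProg

open Turing Function

/-! ### Programs on a stack of binary trees -/

/-- The stacks: input, output, a stack of binary trees, and three auxiliary stacks. -/
inductive Reg | inp | out | d | a | b | c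
  deriving DecidableEq

instance : Fintype Reg := ⟨{.inp, .out, .d, .a, .b, .c}, fun x => by cases x <;> decide⟩

/-- The input symbols. -/
abbrev Sym : Type := Computability.Γ' ⊕ Bool

/-- The alphabets of the stacks. -/
abbrev Alph (r : Reg) : Type :=
  match r with
  | .inp => Sym
  | .out => Bool
  | .d => Bool
  | .a => Bool
  | .b => Bool
  | .c => Bool

instance fintypeAlph : (r : Reg) → Fintype (Alph r)
  | .inp => inferInstanceAs (Fintype Sym)
  | .out => inferInstanceAs (Fintype Bool)
  | .d => inferInstanceAs (Fintype Bool)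
  | .a => inferInstanceAs (Fintype Bool)
  | .b => inferInstanceAs (Fintype Bool)
  | .c => inferInstanceAs (Fintype Bool)

/-- The contents of all stacks. -/
def st (i : List Sym) (o d a b c : List Bool) : ∀ k, List (Alph k)
  | .inp => i
  | .out => o
  | .d => d
  | .a => a
  | .b => b
  | .c => c

section st
variable (i : List Sym) (o d a b c : List Bool)

@[simp] theorem st_inp : st i o d a b c .inp = i := rfl
@[simp] theorem st_out : st i o d a b c .out = o := rfl
@[simp] theorem st_d : st i o d a b c .d = d := rfl
@[simp] theorem st_a : st i o d a b c .a = a := rfl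
@[simp] theorem st_b : st i o d a b c .b = b := rfl
@[simp] theorem st_c : st i o d a b c .c = c := rfl
@[simp] theorem update_st_inp (l) : update (st i o d a b c) .inp l = st l o d a b c := by
  funext k; cases k <;> rfl
@[simp] theorem update_st_out (l) : update (st i o d a b c) .out l = st i l d a b c := by
  funext k; cases k <;> rfl
@[simp] theorem update_st_d (l) : update (st i o d a b c) .d l = st i o l a b c := by
  funext k; cases k <;> rfl
@[simp] theorem update_st_a (l) : update (st i o d a b c) .a l = st i o d l b c := by
  funext k; cases k <;> rfl
@[simp] theorem update_st_b (l) : update (st i o d a b c) .b l = st i o d a l c := by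
  funext k; cases k <;> rfl
@[simp] theorem update_st_c (l) : update (st i o d a b c) .c l = st i o d a b l := by
  funext k; cases k <;> rfl

end st

/-- `Run p s s' n`: the program `p` leads from the stacks `s` to `s'` in at most `n` steps. -/
def Run (p : Cmd Alph) (s s' : ∀ k, List (Alph k)) (n : ℕ) : Prop := ∃ t ≤ n, Exec p s s' t

namespace Run

variable {p q : Cmd Alph} {s s' s'' : ∀ k, List (Alph k)} {m n : ℕ} {k : Reg}

theorem mono (h : Run p s s' m) (hmn : m ≤ n) : Run p s s' n :=
  let ⟨t, ht, h'⟩ := h; ⟨t, ht.trans hmn, h'⟩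

theorem of (h : Run p s s'' m) (hs : s'' = s') (hmn : m ≤ n) : Run p s s' n :=
  hs ▸ h.mono hmn

theorem skip (s) : Run .skip s s 1 := ⟨1, le_rfl, .skip s⟩

theorem push {x : Alph k} (h : update s k (x :: s k) = s') : Run (.push k x) s s' 1 :=
  ⟨1, le_rfl, h ▸ .push s k x⟩

theorem pop {f : Option (Alph k) → Cmd Alph} {o : Option (Alph k)} {s₁ : ∀ k, List (Alph k)}
    (ho : (s k).head? = o) (hs : update s k (s k).tail = s₁) (h : Run (f o) s₁ s' n) :
    Run (.pop k f) s s' (n + 1) := by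
  subst ho hs
  obtain ⟨t, ht, h⟩ := h
  exact ⟨t + 1, Nat.add_le_add_right ht 1, .pop h⟩

theorem loop_nil {f : Alph k → Cmd Alph} (h : s k = []) : Run (.loop k f) s s 1 :=
  ⟨1, le_rfl, .loop_nil h⟩

theorem loop_cons {f : Alph k → Cmd Alph} {x : Alph k} {l : List (Alph k)}
    {s₁ : ∀ k, List (Alph k)} (hx : s k = x :: l) (hs : update s k l = s₁)
    (h : Run (f x) s₁ s' m) (h' : Run (.loop k f) s' s'' n) :
    Run (.loop k f) s s'' (m + n + 1) := by
  subst hs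
  obtain ⟨t, ht, h⟩ := h
  obtain ⟨t', ht', h'⟩ := h'
  exact ⟨t' + t + 1, by omega, .loop_cons hx h h'⟩

theorem seq (h : Run p s s' m) (h' : Run q s' s'' n) : Run (.seq p q) s s'' (m + n) := by
  obtain ⟨t, ht, h⟩ := h
  obtain ⟨t', ht', h'⟩ := h'
  exact ⟨t' + t, by omega, .seq h h'⟩

end Run

/-- Binary trees. -/
inductive Dat | nil | cons (x y : Dat)

namespace Dat

/-- The preorder traversal of a tree. -/
def enc : Dat → List Bool
  | nil => [false]
  | cons x y => true :: (enc x ++ enc y)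

/-- The number of nodes and leaves. -/
def size : Dat → ℕ
  | nil => 1
  | cons x y => size x + size y + 1

theorem length_enc (t : Dat) : t.enc.length = t.size := by
  induction t with
  | nil => rfl
  | cons x y ihx ihy => simp [enc, size, ihx, ihy]

theorem one_le_size (t : Dat) : 1 ≤ t.size := by cases t <;> simp [size]

end Dat

open Dat

/-! #### Moving trees between the stacks -/

/-- One step of reading a tree: `w` stores the symbol that has been read; the stack `c` holds one
symbol for every subtree that is still to be read. -/
def scanBody (w : Bool → Cmd Alph) : Cmd Alph :=
  .pop .d fun
    | some true => .seq (w true) (.seq (.push .c true) (.push .c true))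
    | some false => w false
    | none => .skip

/-- Read a tree and store its symbols with `w`. -/
def scan (w : Bool → Cmd Alph) : Cmd Alph := .seq (.push .c true) (.loop .c fun _ => scanBody w)

/-- The preorder code is self-delimiting: on stack `c` a node replaces one pending subtree by two
and a leaf removes one, so the loop ends exactly where the tree ends. The run after the tree is a
hypothesis, so that the induction hypotheses for the two children can be chained. The family `S`
abstracts over the stack that receives the symbols. -/
theorem run_scan_loop {w : Bool → Cmd Alph}
    {S : List Bool → List Bool → List Bool → ∀ k, List (Alph k)}
    (hw : ∀ x d l c, Run (w x) (S d l c) (S d (x :: l) c) 1)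
    (hd : ∀ d l c, S d l c .d = d) (hc : ∀ d l c, S d l c .c = c)
    (ud : ∀ d l c d', update (S d l c) .d d' = S d' l c)
    (uc : ∀ d l c c', update (S d l c) .c c' = S d l c') (t : Dat) :
    ∀ {r l c s' n}, Run (.loop .c fun _ => scanBody w) (S r (t.enc.reverse ++ l) c) s' n →
      Run (.loop .c fun _ => scanBody w) (S (t.enc ++ r) l (true :: c)) s' (n + 5 * t.size) := by
  induction t with
  | nil =>
    intro r l c s' n h
    have h₁ : Run (scanBody w) (S (false :: r) l c) (S r (false :: l) c) 2 :=
      Run.pop (o := some false) (by rw [hd]; rfl) (by rw [hd, ud]; rfl) (hw false _ _ _)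
    refine (Run.loop_cons (hc _ _ _) (uc _ _ _ _) h₁ h).mono ?_
    simp only [Dat.size]; omega
  | cons x y ihx ihy =>
    intro r l c s' n h
    simp only [enc, List.cons_append, List.append_assoc, List.reverse_cons, List.reverse_append,
      List.nil_append] at h ⊢
    have h₁ : Run (scanBody w) (S (true :: (x.enc ++ (y.enc ++ r))) l c)
        (S (x.enc ++ (y.enc ++ r)) (true :: l) (true :: true :: c)) 4 :=
      Run.pop (o := some true) (s₁ := S (x.enc ++ (y.enc ++ r)) l c) (by rw [hd]; rfl)
        (by rw [hd, ud]; rfl)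
        (Run.seq (hw true _ _ _) (Run.seq (s' := S _ _ (true :: c))
        (Run.push (by rw [uc, hc])) (Run.push (by rw [uc, hc]))))
    refine (Run.loop_cons (hc _ _ _) (uc _ _ _ _) h₁ (ihx (ihy h))).mono ?_
    simp only [Dat.size]; omega

theorem run_scan {w : Bool → Cmd Alph}
    {S : List Bool → List Bool → List Bool → ∀ k, List (Alph k)}
    (hw : ∀ x d l c, Run (w x) (S d l c) (S d (x :: l) c) 1)
    (hd : ∀ d l c, S d l c .d = d) (hc : ∀ d l c, S d l c .c = c)
    (ud : ∀ d l c d', update (S d l c) .d d' = S d' l c)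
    (uc : ∀ d l c c', update (S d l c) .c c' = S d l c') (t : Dat) (r l : List Bool) :
    Run (scan w) (S (t.enc ++ r) l []) (S r (t.enc.reverse ++ l) []) (5 * t.size + 2) := by
  refine (Run.seq (Run.push (by rw [uc, hc])) (run_scan_loop hw hd hc ud uc t
    (Run.loop_nil (hc _ _ _)))).mono ?_
  omega

/-- Move a tree to the stack `a`, in reverse order. -/
def scanA : Cmd Alph := scan fun x => .push .a x

/-- Move a tree to the stack `b`, in reverse order. -/
def scanB : Cmd Alph := scan fun x => .push .b x

section
variable (i : List Sym) (o d a b c r : List Bool) (t : Dat)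

theorem run_scanA :
    Run scanA (st i o (t.enc ++ r) a b []) (st i o r (t.enc.reverse ++ a) b []) (5 * t.size + 2) :=
  run_scan (w := fun x => .push .a x) (S := fun d l c => st i o d l b c) (fun _ _ _ _ => Run.push (by simp)) (fun _ _ _ => rfl)
    (fun _ _ _ => rfl) (by simp) (by simp) t r a

theorem run_scanB :
    Run scanB (st i o (t.enc ++ r) a b []) (st i o r a (t.enc.reverse ++ b) []) (5 * t.size + 2) :=
  run_scan (w := fun x => .push .b x) (S := fun d l c => st i o d a l c) (fun _ _ _ _ => Run.push (by simp)) (fun _ _ _ => rfl)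
    (fun _ _ _ => rfl) (by simp) (by simp) t r b

theorem run_drainA : Run (.loop .a fun x => .push .d x) (st i o d a b c)
    (st i o (a.reverse ++ d) [] b c) (2 * a.length + 1) := by
  induction a generalizing d with
  | nil => exact Run.loop_nil rfl
  | cons x a ih =>
    refine Run.of (Run.loop_cons (k := .a) (x := x) (l := a) rfl (update_st_a ..)
      (Run.push (update_st_d ..)) (ih (x :: d))) (by simp) ?_
    simp only [List.length_cons]; omega

theorem run_drainB : Run (.loop .b fun x => .push .d x) (st i o d a b c)
    (st i o (b.reverse ++ d) a [] c) (2 * b.length + 1) := by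
  induction b generalizing d with
  | nil => exact Run.loop_nil rfl
  | cons x b ih =>
    refine Run.of (Run.loop_cons (k := .b) (x := x) (l := b) rfl (update_st_b ..)
      (Run.push (update_st_d ..)) (ih (x :: d))) (by simp) ?_
    simp only [List.length_cons]; omega

theorem run_clearA : Run (.loop .a fun _ => .skip) (st i o d a b c)
    (st i o d [] b c) (2 * a.length + 1) := by
  induction a with
  | nil => exact Run.loop_nil rfl
  | cons x a ih =>
    refine (Run.loop_cons (k := .a) (x := x) (l := a) rfl (update_st_a ..) (Run.skip _) ih).mono ?_
    simp only [List.length_cons]; omega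

theorem run_drainAB : Run (.loop .a fun x => .seq (.push .d x) (.push .b x)) (st i o d a b c)
    (st i o (a.reverse ++ d) [] (a.reverse ++ b) c) (3 * a.length + 1) := by
  induction a generalizing d b with
  | nil => exact Run.loop_nil rfl
  | cons x a ih =>
    refine Run.of (Run.loop_cons (k := .a) (x := x) (l := a) rfl (update_st_a ..)
      (Run.seq (Run.push (update_st_d ..)) (Run.push (update_st_b ..)))
      (ih (x :: d) (x :: b))) (by simp) ?_
    simp only [List.length_cons]; omega

theorem run_moveBA : Run (.loop .b fun x => .push .a x) (st i o d a b c)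
    (st i o d (b.reverse ++ a) [] c) (2 * b.length + 1) := by
  induction b generalizing a with
  | nil => exact Run.loop_nil rfl
  | cons x b ih =>
    refine Run.of (Run.loop_cons (k := .b) (x := x) (l := b) rfl (update_st_b ..)
      (Run.push (update_st_a ..)) (ih (x :: a))) (by simp) ?_
    simp only [List.length_cons]; omega

/-- Delete the top tree. -/
def discard : Cmd Alph := .seq scanA (.loop .a fun _ => .skip)

theorem run_discard : Run discard (st i o (t.enc ++ r) [] [] []) (st i o r [] [] [])
    (10 * t.size) := by
  refine ((run_scanA i o [] [] r t).seq (run_clearA i o _ _ _ _)).mono ?_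
  have := t.one_le_size
  simp [length_enc]; omega

/-- Delete the tree below the top tree. -/
def discardSecond : Cmd Alph :=
  .seq scanA (.seq scanB (.seq (.loop .a fun x => .push .d x) (.seq (.loop .b fun x => .push .a x)
    (.loop .a fun _ => .skip))))

theorem run_discardSecond (t' : Dat) : Run discardSecond (st i o (t.enc ++ (t'.enc ++ r)) [] [] [])
    (st i o (t.enc ++ r) [] [] []) (20 * t.size + 20 * t'.size) := by
  refine Run.of ((run_scanA i o [] [] _ t).seq ((run_scanB i o _ [] _ t').seq
    ((run_drainA i o _ _ _ _).seq ((run_moveBA i o _ _ _ _).seq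
      (run_clearA i o _ _ _ _))))) (by simp) ?_
  have := t.one_le_size
  have := t'.one_le_size
  simp [length_enc]; omega

/-- Interchange the two top trees. -/
def swap : Cmd Alph :=
  .seq scanA (.seq scanB (.seq (.loop .a fun x => .push .d x) (.loop .b fun x => .push .d x)))

theorem run_swap (t' : Dat) : Run swap (st i o (t.enc ++ (t'.enc ++ r)) [] [] [])
    (st i o (t'.enc ++ (t.enc ++ r)) [] [] []) (20 * t.size + 20 * t'.size) := by
  refine Run.of ((run_scanA i o [] [] _ t).seq ((run_scanB i o _ [] _ t').seq
    ((run_drainA i o _ _ _ _).seq (run_drainB i o _ _ _ _)))) (by simp) ?_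
  have := t.one_le_size
  have := t'.one_le_size
  simp [length_enc]; omega

/-- Duplicate the top tree. -/
def dup : Cmd Alph :=
  .seq scanA (.seq (.loop .a fun x => .seq (.push .d x) (.push .b x))
    (.seq (.loop .b fun x => .push .a x) (.loop .a fun x => .push .d x)))

theorem run_dup : Run dup (st i o (t.enc ++ r) [] [] [])
    (st i o (t.enc ++ (t.enc ++ r)) [] [] []) (20 * t.size) := by
  refine Run.of ((run_scanA i o [] [] _ t).seq ((run_drainAB i o _ _ _ _).seq
    ((run_moveBA i o _ _ _ _).seq (run_drainA i o _ _ _ _)))) (by simp) ?_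
  have := t.one_le_size
  simp [length_enc]; omega

end

theorem eval_mono (P : Polynomial ℕ) {m n : ℕ} (h : m ≤ n) : P.eval m ≤ P.eval n := by
  simp only [Polynomial.eval_eq_sum_range]
  exact Finset.sum_le_sum fun i _ => Nat.mul_le_mul_left _ (Nat.pow_le_pow_left h i)

/-! ### Polynomial-time transformations of trees -/

/-- `u i` can be transformed into `v i` in time polynomial in the size of `u i`. -/
def PT {ι : Type} (u v : ι → Dat) : Prop :=
  ∃ (p : Cmd Alph) (P : Polynomial ℕ), ∀ i,
    (∀ inp out r, Run p (st inp out ((u i).enc ++ r) [] [] [])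
      (st inp out ((v i).enc ++ r) [] [] []) (P.eval (u i).size)) ∧
    (v i).size ≤ P.eval (u i).size

namespace PT

variable {ι κ : Type} {u v w : ι → Dat}

theorem refl (u : ι → Dat) : PT u u :=
  ⟨.skip, .X + 1, fun i => ⟨fun _ _ _ => (Run.skip _).mono (by simp), by simp⟩⟩

theorem pull (h : PT u v) (e : κ → ι) : PT (fun j => u (e j)) fun j => v (e j) :=
  let ⟨p, P, h⟩ := h; ⟨p, P, fun j => h (e j)⟩

theorem comp (h : PT u v) (h' : PT v w) : PT u w := by
  obtain ⟨p, P, h⟩ := h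
  obtain ⟨q, Q, h'⟩ := h'
  refine ⟨.seq p q, P + Q.comp P, fun i => ⟨fun inp out r => ?_, ?_⟩⟩
  · refine (((h i).1 inp out r).seq ((h' i).1 inp out r)).mono ?_
    rw [Polynomial.eval_add, Polynomial.eval_comp]
    exact Nat.add_le_add_left (eval_mono Q (h i).2) _
  · rw [Polynomial.eval_add, Polynomial.eval_comp]
    exact ((h' i).2.trans (eval_mono Q (h i).2)).trans (Nat.le_add_left _ _)

theorem nil : PT u fun _ => .nil := by
  refine ⟨.seq discard (.push .d false), 10 * .X + 1, fun i => ⟨fun inp out r => ?_, ?_⟩⟩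
  · refine ((run_discard inp out r (u i)).seq (Run.push (by simp [enc]))).mono ?_
    simp
  · simp [Dat.size]

/-- The second component is computed first, on a copy of the argument. After a swap the first
component is computed on top of it, and the node symbol completes the code of the pair. -/
theorem cons (h : PT u v) (h' : PT u w) : PT u fun i => .cons (v i) (w i) := by
  obtain ⟨p, P, h⟩ := h
  obtain ⟨q, Q, h'⟩ := h'
  refine ⟨.seq dup (.seq q (.seq swap (.seq p (.push .d true)))),
    40 * .X + 21 * Q + P + 1, fun i => ⟨fun inp out r => ?_, ?_⟩⟩
  · refine ((run_dup inp out r (u i)).seq (((h' i).1 inp out _).seq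
      ((run_swap inp out r (w i) (u i)).seq (((h i).1 inp out _).seq
        (Run.push (by simp [enc])))))).mono ?_
    have := (h' i).2
    simp only [Polynomial.eval_add, Polynomial.eval_mul, Polynomial.eval_X, Polynomial.eval_ofNat,
      Polynomial.eval_one]
    omega
  · have := (h' i).2
    have := (h i).2
    simp only [Polynomial.eval_add, Polynomial.eval_mul, Polynomial.eval_X, Polynomial.eval_ofNat,
      Polynomial.eval_one, Dat.size]
    omega

theorem fst : PT (fun i => .cons (u i) (v i)) u := by
  refine ⟨.pop .d fun _ => discardSecond, 20 * .X + 1, fun i => ⟨fun inp out r => ?_, ?_⟩⟩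
  · refine (Run.pop rfl (by simp [enc]) (run_discardSecond inp out r (u i) (v i))).mono ?_
    simp [Dat.size]; omega
  · simp [Dat.size]; omega

theorem snd : PT (fun i => .cons (u i) (v i)) v := by
  refine ⟨.pop .d fun _ => discard, 20 * .X + 1, fun i => ⟨fun inp out r => ?_, ?_⟩⟩
  · refine (Run.pop rfl (by simp [enc]) (run_discard inp out _ (u i))).mono ?_
    simp [Dat.size]; omega
  · simp [Dat.size]; omega

theorem car (h : PT u fun i => .cons (v i) (w i)) : PT u v := h.comp fst

theorem cdr (h : PT u fun i => .cons (v i) (w i)) : PT u w := h.comp snd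

/-- The branches are families over subtypes, so each may use the outcome of the test. The test
consumes a copy of the argument. If its value is a node, the two children left after popping the
node symbol have to be deleted as well. -/
theorem ite {c : ι → Dat} (hc : PT u c)
    (h : PT (fun i : {i // c i = .nil} => u i) fun i => v i)
    (h' : PT (fun i : {i // c i ≠ .nil} => u i) fun i => v i) : PT u v := by
  obtain ⟨p, P, hc⟩ := hc
  obtain ⟨q, Q, h⟩ := h
  obtain ⟨q', Q', h'⟩ := h'
  refine ⟨.seq dup (.seq p (.pop .d fun
    | some true => .seq discard (.seq discard q')
    | _ => q)), 20 * .X + 11 * P + Q + Q' + 1, fun i => ?_⟩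
  have hs := (hc i).2
  by_cases hi : c i = .nil
  · refine ⟨fun inp out r => ?_, ?_⟩
    · refine ((run_dup inp out r (u i)).seq (((hc i).1 inp out _).seq
        (Run.pop (o := some false) (by simp [hi, enc]) (by simp [hi, enc])
          ((h ⟨i, hi⟩).1 inp out r)))).mono ?_
      simp; omega
    · have := (h ⟨i, hi⟩).2
      simp at this ⊢; omega
  · obtain ⟨x, y, hxy⟩ : ∃ x y, c i = .cons x y := by
      cases hci : c i with
      | nil => exact absurd hci hi
      | cons x y => exact ⟨x, y, rfl⟩
    refine ⟨fun inp out r => ?_, ?_⟩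
    · refine ((run_dup inp out r (u i)).seq (((hc i).1 inp out _).seq
        (Run.pop (o := some true) (by simp [hxy, enc]) (by simp [hxy, enc])
          ((run_discard inp out _ x).seq ((run_discard inp out _ y).seq
          ((h' ⟨i, hi⟩).1 inp out r)))))).mono ?_
      simp [hxy, Dat.size] at hs ⊢; omega
    · have := (h' ⟨i, hi⟩).2
      simp at this ⊢; omega

end PT

end StackProg

/-! ### Folds over lists, input and output -/

namespace StackProg

open Turing Function Dat

/-- A list, as the tree whose right spine carries its items. -/
def listDat {β : Type} (b : β → Dat) : List β → Dat
  | [] => .nil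
  | x :: l => .cons (b x) (listDat b l)

theorem length_le_size_listDat {β : Type} (b : β → Dat) (l : List β) :
    l.length ≤ (listDat b l).size := by
  induction l with
  | nil => simp
  | cons x l ih => simp [listDat, Dat.size]; omega

/-- Leave a symbol on the stack `c` if the list that is the left child of the top tree is not
empty. -/
def testList : Cmd Alph :=
  .pop .d fun _ => .pop .d fun
    | some true => .seq (.push .d true) (.seq (.push .d true) (.push .c true))
    | _ => .seq (.push .d false) (.push .d true)

/-- The stack `c` after `testList`. -/
def flag {β : Type} : List β → List Bool
  | [] => []
  | _ :: _ => [true]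

theorem run_testList {β : Type} (b : β → Dat) (l : List β) (t : Dat) (i o r) :
    Run testList (st i o ((Dat.cons (listDat b l) t).enc ++ r) [] [] [])
      (st i o ((Dat.cons (listDat b l) t).enc ++ r) [] [] (flag l)) 5 := by
  cases l with
  | nil =>
    exact (Run.pop (o := some true) rfl (update_st_d ..) (Run.pop (o := some false) rfl
      (update_st_d ..) ((Run.push (update_st_d ..)).seq (Run.push (update_st_d ..))))).mono
      (by norm_num)
  | cons x l =>
    exact (Run.pop (o := some true) rfl (update_st_d ..) (Run.pop (o := some true) rfl
      (update_st_d ..) ((Run.push (update_st_d ..)).seq ((Run.push (update_st_d ..)).seq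
        (Run.push (update_st_c ..)))))).mono (by norm_num)

/-- Stack `c` holds one flag as long as the list is nonempty. The loop pops the flag, the body
processes the head of the list, and `testList` sets the flag again if items remain. Iterating a
polynomial-time step can let the state explode, so a polynomial bound on all intermediate states is
a hypothesis. -/
theorem PT.foldl {ι π σ β : Type} {p : π → Dat} {s : σ → Dat} {b : β → Dat} {step : π → σ → β → σ}
    (h : PT (fun x : π × σ × β => .cons (p x.1) (.cons (s x.2.1) (b x.2.2)))
      fun x => s (step x.1 x.2.1 x.2.2))
    (f : ι → π) (g : ι → σ) (l : ι → List β) (Q : Polynomial ℕ)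
    (hQ : ∀ i l', l' <+: l i → (s (l'.foldl (step (f i)) (g i))).size ≤
      Q.eval (Dat.cons (listDat b (l i)) (.cons (p (f i)) (s (g i)))).size) :
    PT (fun i => .cons (listDat b (l i)) (.cons (p (f i)) (s (g i))))
      fun i => s ((l i).foldl (step (f i)) (g i)) := by
  have hG : PT (fun x : (β × List β) × π × σ => .cons (listDat b (x.1.1 :: x.1.2))
      (.cons (p x.2.1) (s x.2.2)))
      fun x => .cons (listDat b x.1.2) (.cons (p x.2.1) (s (step x.2.1 x.2.2 x.1.1))) := by
    have h0 := PT.refl fun x : (β × List β) × π × σ => Dat.cons (listDat b (x.1.1 :: x.1.2))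
      (.cons (p x.2.1) (s x.2.2))
    have h1 := h0.car
    exact PT.cons h1.cdr (PT.cons h0.cdr.car ((PT.cons h0.cdr.car (PT.cons h0.cdr.cdr h1.car)).comp
      (h.pull fun x : (β × List β) × π × σ => (x.2.1, x.2.2, x.1.1))))
  obtain ⟨q, P, hG⟩ := hG
  -- `L` bounds the remaining list together with the parameter, `B` bounds every intermediate state,
  -- and 2 counts the two pair nodes. Besides the body, a round costs 5 steps for the test and 1 for
  -- the loop.
  have hW : ∀ (L B : ℕ) (i o r) (x : π) (l : List β) (y : σ),
      (listDat b l).size + (p x).size ≤ L → (∀ l', l' <+: l → (s (l'.foldl (step x) y)).size ≤ B) →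
      Run (.loop .c fun _ => .seq q testList)
        (st i o ((Dat.cons (listDat b l) (.cons (p x) (s y))).enc ++ r) [] [] (flag l))
        (st i o ((Dat.cons .nil (.cons (p x) (s (l.foldl (step x) y)))).enc ++ r) [] [] [])
        (l.length * (P.eval (L + B + 2) + 6) + 1) := by
    intro L B i o r x l
    induction l with
    | nil => intro y _ _; exact (Run.loop_nil rfl).mono (by simp)
    | cons z l ih =>
      intro y hL hB
      have hb0 := hB [] List.nil_prefix
      have ih' := ih (step x y z) (by simp [listDat, Dat.size] at hL ⊢; omega) (fun l' hl' => by
        have := hB (z :: l') (List.cons_prefix_cons.2 ⟨rfl, hl'⟩)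
        exact this)
      refine (Run.loop_cons rfl (update_st_c ..)
        (((hG ((z, l), x, y)).1 i o r).seq (run_testList b l _ i o r)) ih').mono ?_
      have : P.eval (Dat.cons (listDat b (z :: l)) (.cons (p x) (s y))).size ≤
          P.eval (L + B + 2) := eval_mono P (by
        simp [listDat, Dat.size] at hL hb0 ⊢; omega)
      rw [List.length_cons, Nat.add_mul]
      simp only [one_mul]
      omega
  have hF : PT (fun i => Dat.cons (listDat b (l i)) (.cons (p (f i)) (s (g i))))
      fun i => .cons .nil (.cons (p (f i)) (s ((l i).foldl (step (f i)) (g i)))) := by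
    refine ⟨.seq testList (.loop .c fun _ => .seq q testList),
      5 + .X * (P.comp (.X + Q + 2) + 6) + 1 + .X + Q + 3, fun j => ⟨fun i o r => ?_, ?_⟩⟩
    · refine ((run_testList b (l j) _ i o r).seq (hW (listDat b (l j) |>.cons
        (.cons (p (f j)) (s (g j)))).size _ i o r (f j) (l j) (g j) ?_ (hQ j))).mono ?_
      · simp [Dat.size]; omega
      · have h1 : (l j).length ≤ (listDat b (l j) |>.cons (.cons (p (f j)) (s (g j)))).size :=
          (length_le_size_listDat b (l j)).trans (by simp [Dat.size]; omega)
        have h2 := Nat.mul_le_mul_right (P.eval ((listDat b (l j) |>.cons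
          (.cons (p (f j)) (s (g j)))).size + Q.eval (listDat b (l j) |>.cons
          (.cons (p (f j)) (s (g j)))).size + 2) + 6) h1
        simp only [Polynomial.eval_add, Polynomial.eval_mul, Polynomial.eval_X,
          Polynomial.eval_ofNat, Polynomial.eval_one, Polynomial.eval_comp]
        omega
    · have := hQ j (l j) List.prefix_rfl
      simp only [Polynomial.eval_add, Polynomial.eval_mul, Polynomial.eval_X,
        Polynomial.eval_ofNat, Polynomial.eval_one, Polynomial.eval_comp]
      simp only [Dat.size] at this ⊢
      omega
  exact hF.cdr.cdr

/-! ### Input and output -/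

/-- A numbering of the input symbols, as trees. -/
def numDat : ℕ → Dat
  | 0 => .nil
  | n + 1 => .cons .nil (numDat n)

theorem numDat_injective : Function.Injective numDat := by
  intro m
  induction m with
  | zero => intro n h; cases n <;> simp_all [numDat]
  | succ m ih =>
    intro n h
    cases n with
    | zero => simp [numDat] at h
    | succ n => simp only [numDat, Dat.cons.injEq, true_and] at h; rw [ih h]

/-- The items of a finite type, as trees. -/
noncomputable def finDat {α : Type} [Finite α] (x : α) : Dat :=
  numDat (Finite.equivFin α x)

theorem finDat_injective {α : Type} [Finite α] : Function.Injective (finDat (α := α)) :=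
  numDat_injective.comp (Fin.val_injective.comp (Finite.equivFin α).injective)

/-- The truth values, as trees. -/
def boolDat : Bool → Dat
  | false => .nil
  | true => .cons .nil .nil

/-- Push a list of symbols, one after the other. -/
def pushAll : List Bool → Cmd Alph
  | [] => .skip
  | x :: l => .seq (.push .a x) (pushAll l)

theorem run_pushAll (l : List Bool) (i o d a b c) :
    Run (pushAll l) (st i o d a b c) (st i o d (l.reverse ++ a) b c) (l.length + 1) := by
  induction l generalizing a with
  | nil => exact Run.skip _
  | cons x l ih =>
    refine Run.of ((Run.push (update_st_a ..)).seq (ih (x :: a))) (by simp) ?_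
    simp; omega

/-- Read the input. -/
noncomputable def readInput : Cmd Alph :=
  .seq (.loop .inp fun x => pushAll (true :: (finDat x).enc))
    (.seq (.push .d false) (.loop .a fun x => .push .d x))

theorem run_readLoop (i o d a b c) :
    Run (.loop .inp fun x => pushAll (true :: (finDat x).enc)) (st i o d a b c)
      (st [] o d ((i.flatMap fun x => true :: (finDat x).enc).reverse ++ a) b c)
      (3 * (listDat finDat i).size + 1) := by
  induction i generalizing a with
  | nil => exact (Run.loop_nil rfl).mono (by omega)
  | cons x i ih =>
    refine Run.of (Run.loop_cons (k := .inp) (x := x) (l := i) rfl (update_st_inp ..)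
      (run_pushAll ..) (ih _)) (by simp) ?_
    have := (finDat x).one_le_size
    simp [listDat, Dat.size, length_enc]; omega

/-- For a right spine the preorder code is a concatenation, item by item. The input can therefore be
converted into a tree by one loop that translates each symbol separately. -/
theorem enc_listDat {β : Type} (b : β → Dat) (l : List β) :
    (listDat b l).enc = (l.flatMap fun x => true :: (b x).enc) ++ [false] := by
  induction l with
  | nil => rfl
  | cons x l ih => simp [listDat, enc, ih]

theorem run_readInput (i : List Sym) :
    Run readInput (st i [] [] [] [] []) (st [] [] ((listDat finDat i).enc ++ []) [] [] [])
      (6 * (listDat finDat i).size) := by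
  refine Run.of ((run_readLoop i [] [] [] [] []).seq ((Run.push (update_st_d ..)).seq
    (run_drainA ..))) (by simp [enc_listDat]) ?_
  have h := congrArg List.length (enc_listDat finDat i)
  rw [length_enc] at h
  simp only [List.length_append, List.length_reverse, List.length_nil, List.length_cons] at h ⊢
  omega

/-- Write the output. -/
def writeOutput : Cmd Alph :=
  .pop .d fun
    | some true => .seq discard (.seq discard (.push .out true))
    | _ => .push .out false

theorem run_writeOutput (x : Bool) :
    Run writeOutput (st [] [] ((boolDat x).enc ++ []) [] [] []) (st [] [x] [] [] [] []) 22 := by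
  cases x with
  | false => exact (Run.pop (o := some false) rfl (update_st_d ..)
      (Run.push (update_st_out ..))).mono (by norm_num)
  | true => exact (Run.pop (o := some true) rfl (update_st_d ..)
      ((run_discard [] [] (Dat.enc .nil ++ []) .nil).seq ((run_discard [] [] [] .nil).seq
        (Run.push (update_st_out ..))))).mono (by simp [Dat.size])

/-- The input alphabet is finite, so its symbols have trees of bounded size and the tree of the
input is linear in the input length. A bound polynomial in the tree size is then polynomial in the
length. -/
theorem tm2ComputableInPolyTime_of_PT {α : Type} (ea : α → List Sym) (V : α → Bool)
    (F : List Sym → Bool) (hF : PT (fun l => listDat finDat l) fun l => boolDat (F l))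
    (hV : ∀ a, V a = F (ea a)) :
    Nonempty (TM2ComputableInPolyTime ea Computability.encodeBool V) := by
  obtain ⟨p, P, hp⟩ := hF
  obtain ⟨M, hM⟩ : ∃ M, ∀ x : Sym, (finDat x).size ≤ M :=
    ⟨Finset.univ.sup fun x : Sym => (finDat x).size,
      fun x => Finset.le_sup (f := fun x : Sym => (finDat x).size) (Finset.mem_univ x)⟩
  have hsize : ∀ l : List Sym, (listDat finDat l).size ≤ (M + 1) * l.length + 1 := by
    intro l
    induction l with
    | nil => simp [listDat, Dat.size]
    | cons x l ih =>
      have := hM x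
      simp only [listDat, Dat.size, List.length_cons, Nat.mul_add]
      omega
  refine tm2ComputableInPolyTime_of_exec (Γ := Alph) (.seq readInput (.seq p writeOutput))
    .inp .out ea _ V
    ((6 * .X + P + 22).comp (Polynomial.C (M + 1) * .X + 1)) fun a => ?_
  have h := (run_readInput (ea a)).seq (((hp (ea a)).1 [] [] []).seq (run_writeOutput (F (ea a))))
  have h0 : update (fun k : Reg => ([] : List (Alph k))) .inp (ea a) = st (ea a) [] [] [] [] [] := by
    funext k; cases k <;> rfl
  have h1 : update (fun k : Reg => ([] : List (Alph k))) .out (Computability.encodeBool (V a)) =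
      st [] [F (ea a)] [] [] [] [] := by
    funext k; cases k <;> simp [Computability.encodeBool, st, hV]
  rw [h0, h1]
  refine h.mono ?_
  rw [Polynomial.eval_comp]
  refine le_trans ?_ (eval_mono _ (show (listDat finDat (ea a)).size ≤ _ by
    simpa using hsize (ea a)))
  simp; omega

end StackProg

namespace StackProg

open Dat

/-! ### Functions that are computable in polynomial time -/

theorem Dat.exists_eq_cons {t : Dat} (h : t ≠ .nil) : ∃ x y, t = .cons x y := by
  cases t with
  | nil => exact absurd rfl h
  | cons x y => exact ⟨x, y, rfl⟩

theorem PT.const {ι : Type} {u : ι → Dat} (c : Dat) : PT u fun _ => c := by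
  induction c with
  | nil => exact PT.nil
  | cons x y ihx ihy => exact ihx.cons ihy

theorem PT.congr {ι : Type} {u v w : ι → Dat} (h : PT u v) (hvw : ∀ i, v i = w i) : PT u w :=
  (funext hvw : v = w) ▸ h

-- The constant tree is built into the program, which follows its shape by recursion. This suffices
-- to branch on the value of a finite type.
open Classical in
theorem PT.eqConst (c : Dat) : ∀ {ι : Type} (u : ι → Dat),
    PT u fun i => boolDat (decide (u i = c)) := by
  induction c with
  | nil =>
    intro ι u
    refine PT.ite (PT.refl u) ((PT.const (boolDat true)).congr fun i => ?_)
      ((PT.const (boolDat false)).congr fun i => ?_)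
    · rw [decide_eq_true i.2]
    · rw [decide_eq_false i.2]
  | cons x y ihx ihy =>
    intro ι u
    refine PT.ite (PT.refl u) ((PT.const (boolDat false)).congr fun i => ?_) ?_
    · rw [decide_eq_false (by rw [i.2]; exact fun h => Dat.noConfusion h)]
    · have : ∀ i : {i // u i ≠ .nil}, ∃ l r, u i = .cons l r := by
        exact fun i => Dat.exists_eq_cons i.2
      choose l r hlr using this
      have h0 : PT (fun i : {i // u i ≠ .nil} => u i) fun i => .cons (l i) (r i) :=
        (PT.refl _).congr hlr
      have hl := h0.car.comp (ihx l)
      have hr := h0.cdr.comp (ihy r)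
      refine PT.ite hl ((PT.const (boolDat false)).congr fun i => ?_) ((hr.pull _).congr fun i => ?_)
      · have := i.2
        rw [decide_eq_false]
        intro h
        rw [hlr, Dat.cons.injEq] at h
        simp [h.1, boolDat] at this
      · have := i.2
        have hx : l i = x := by
          by_contra hc
          simp [hc, boolDat] at this
        congr 1
        rw [decide_eq_decide, hlr, Dat.cons.injEq]
        simp [hx]

/-- Types whose items are represented by trees. -/
class Enc (α : Type) where
  /-- the tree that represents an item -/
  dat : α → Dat

instance : Enc Bool := ⟨boolDat⟩

instance {α β : Type} [Enc α] [Enc β] : Enc (α × β) := ⟨fun x => .cons (Enc.dat x.1) (Enc.dat x.2)⟩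

instance {α : Type} [Enc α] : Enc (List α) := ⟨listDat Enc.dat⟩

noncomputable instance : Enc Sym := ⟨finDat⟩

/-- The size of the tree that represents an item. -/
def size {α : Type} [Enc α] (a : α) : ℕ := (Enc.dat a).size

/-- `f` is computable in polynomial time. -/
@[fun_prop]
def PolyTime {α β : Type} [Enc α] [Enc β] (f : α → β) : Prop :=
  PT Enc.dat fun a => Enc.dat (f a)

/-- `q` is bounded by a polynomial in the size of the argument. -/
def PolyBound {α : Type} [Enc α] (q : α → ℕ) : Prop :=
  ∃ Q : Polynomial ℕ, ∀ a, q a ≤ Q.eval (size a)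

variable {α β γ σ : Type} [Enc α] [Enc β] [Enc γ] [Enc σ]

theorem size_prod (a : α) (b : β) : size (a, b) = size a + size b + 1 := rfl

theorem size_nil : size ([] : List α) = 1 := rfl

theorem size_cons (a : α) (l : List α) : size (a :: l) = size a + size l + 1 := rfl

theorem one_le_size (a : α) : 1 ≤ size a := Dat.one_le_size _

theorem size_bool (b : Bool) : size b ≤ 3 := by cases b <;> simp [size, Enc.dat, boolDat, Dat.size]

theorem length_lt_size (l : List α) : l.length < size l := by
  induction l with
  | nil => simp [size_nil]
  | cons a l ih => simp [size_cons]; omega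

theorem size_le_of_mem {a : α} {l : List α} (h : a ∈ l) : size a < size l := by
  induction l with
  | nil => simp at h
  | cons b l ih =>
    rw [size_cons]
    rcases List.mem_cons.1 h with rfl | h
    · omega
    · have := ih h
      omega

theorem size_tail_le (l : List α) : size l.tail ≤ size l := by
  cases l with
  | nil => simp
  | cons a l => rw [size_cons]; simp; omega

namespace PolyBound

variable {p q : α → ℕ}

theorem mono (h : PolyBound q) (hpq : ∀ a, p a ≤ q a) : PolyBound p :=
  let ⟨Q, hQ⟩ := h; ⟨Q, fun a => (hpq a).trans (hQ a)⟩

theorem size : PolyBound fun a : α => size a := ⟨.X, fun a => by simp⟩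

theorem const (c : ℕ) : PolyBound fun _ : α => c := ⟨.C c, fun a => by simp⟩

theorem add (hp : PolyBound p) (hq : PolyBound q) : PolyBound fun a => p a + q a := by
  obtain ⟨P, hP⟩ := hp
  obtain ⟨Q, hQ⟩ := hq
  exact ⟨P + Q, fun a => by simpa using Nat.add_le_add (hP a) (hQ a)⟩

theorem mul (hp : PolyBound p) (hq : PolyBound q) : PolyBound fun a => p a * q a := by
  obtain ⟨P, hP⟩ := hp
  obtain ⟨Q, hQ⟩ := hq
  exact ⟨P * Q, fun a => by simpa using Nat.mul_le_mul (hP a) (hQ a)⟩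

theorem comp {r : ℕ → ℕ} {R : Polynomial ℕ} (hR : ∀ n, r n ≤ R.eval n) (hp : PolyBound p) :
    PolyBound fun a => r (p a) := by
  obtain ⟨P, hP⟩ := hp
  exact ⟨R.comp P, fun a => by
    rw [Polynomial.eval_comp]; exact (hR _).trans (eval_mono R (hP a))⟩

theorem comp_polyTime {q : β → ℕ} (hq : PolyBound q) {f : α → β} (hf : PolyTime f) :
    PolyBound fun a => q (f a) := by
  obtain ⟨Q, hQ⟩ := hq
  obtain ⟨_, P, hP⟩ := hf
  exact ⟨Q.comp P, fun a => by
    rw [Polynomial.eval_comp]; exact (hQ _).trans (eval_mono Q (hP a).2)⟩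

end PolyBound

namespace PolyTime

theorem size_bound {f : α → β} (hf : PolyTime f) : PolyBound fun a => StackProg.size (f a) :=
  PolyBound.size.comp_polyTime hf

@[fun_prop]
theorem id : PolyTime fun a : α => a := PT.refl _

@[fun_prop]
theorem const (b : β) : PolyTime fun _ : α => b := PT.const _

@[fun_prop]
theorem comp {f : β → γ} {g : α → β} (hf : PolyTime f) (hg : PolyTime g) :
    PolyTime fun a => f (g a) := PT.comp hg (PT.pull hf g)

/-- Only the representing trees count, so `f` and `g` may even have different target types. -/
theorem of_dat_eq {f : α → β} {g : α → γ} (hf : PolyTime f)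
    (h : ∀ a, Enc.dat (f a) = Enc.dat (g a)) : PolyTime g :=
  PT.congr hf h

@[fun_prop]
theorem prodMk {f : α → β} {g : α → γ} (hf : PolyTime f) (hg : PolyTime g) :
    PolyTime fun a => (f a, g a) := PT.cons hf hg

@[fun_prop]
theorem fst {f : α → β × γ} (hf : PolyTime f) : PolyTime fun a => (f a).1 :=
  PT.car (v := fun a => Enc.dat (f a).1) (w := fun a => Enc.dat (f a).2) hf

@[fun_prop]
theorem snd {f : α → β × γ} (hf : PolyTime f) : PolyTime fun a => (f a).2 :=
  PT.cdr (v := fun a => Enc.dat (f a).1) (w := fun a => Enc.dat (f a).2) hf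

@[fun_prop]
theorem cons {f : α → β} {g : α → List β} (hf : PolyTime f) (hg : PolyTime g) :
    PolyTime fun a => f a :: g a := PT.cons hf hg

@[fun_prop]
theorem cond {c : α → Bool} {f g : α → β} (hc : PolyTime c) (hf : PolyTime f) (hg : PolyTime g) :
    PolyTime fun a => bif c a then f a else g a := by
  refine PT.ite hc ((PT.pull hg _).congr fun a => ?_) ((PT.pull hf _).congr fun a => ?_)
  · have := a.2
    cases h : c a
    · simp [h]
    · simp [h, Enc.dat, boolDat] at this
  · have := a.2
    cases h : c a
    · simp [h, Enc.dat, boolDat] at this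
    · simp [h]

@[fun_prop]
theorem and {f g : α → Bool} (hf : PolyTime f) (hg : PolyTime g) :
    PolyTime fun a => f a && g a :=
  (cond hf hg (const false)).of_dat_eq fun a => by cases f a <;> rfl

@[fun_prop]
theorem or {f g : α → Bool} (hf : PolyTime f) (hg : PolyTime g) :
    PolyTime fun a => f a || g a :=
  (cond hf (const true) hg).of_dat_eq fun a => by cases f a <;> rfl

@[fun_prop]
theorem not {f : α → Bool} (hf : PolyTime f) : PolyTime fun a => !f a :=
  (cond hf (const false) (const true)).of_dat_eq fun a => by cases f a <;> rfl

/-- The value is compared with all items of the type, one after the other. The induction is on the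
list of those still possible, with the domain restricted to the arguments whose value lies in it. -/
theorem of_finite_cases {δ : Type} [Enc δ] [Finite δ]
    (hinj : Function.Injective (Enc.dat : δ → Dat)) {f : α → δ} {g : δ → α → β} (hf : PolyTime f)
    (hg : ∀ d, PolyTime (g d)) : PolyTime fun a => g (f a) a := by
  classical
  have key : ∀ L : List δ, PT (fun a : {a // f a ∈ L} => Enc.dat a.1)
      fun a => Enc.dat (g (f a.1) a.1) := by
    intro L
    induction L with
    | nil => exact ⟨.skip, 0, fun a => absurd a.2 (by simp)⟩
    | cons d L ih =>
      refine PT.ite ((PT.pull hf _).comp (PT.eqConst (Enc.dat d) _)) ?_ ?_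
      · refine (ih.pull fun a : {a : {a // f a ∈ d :: L} //
            boolDat (decide (Enc.dat (f a.1) = Enc.dat d)) = .nil} => ⟨a.1.1, ?_⟩)
        have h1 := a.2
        rcases List.mem_cons.1 a.1.2 with h | h
        · simp [h, boolDat] at h1
        · exact h
      · refine ((hg d).pull _).congr fun a => ?_
        have h1 : f a.1.1 = d := by
          have := a.2
          by_contra hc
          simp [hinj.eq_iff, hc, boolDat] at this
        rw [h1]
  have := Fintype.ofFinite δ
  exact (key Finset.univ.toList).pull fun a => ⟨a, by simp⟩

theorem sym_cases {f : α → Sym} {g : Sym → α → β} (hf : PolyTime f)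
    (hg : ∀ d, PolyTime (g d)) : PolyTime fun a => g (f a) a :=
  of_finite_cases finDat_injective hf hg

@[fun_prop]
theorem list_cases {f : α → List β} {g : α → γ} {h : α → β → List β → γ} (hf : PolyTime f)
    (hg : PolyTime g) (hh : PolyTime fun x : α × β × List β => h x.1 x.2.1 x.2.2) :
    PolyTime fun a => List.casesOn (motive := fun _ => γ) (f a) (g a) (h a) := by
  refine PT.ite hf ((PT.pull hg _).congr fun a => ?_) ?_
  · have := a.2
    cases h : f a
    · simp only [h]
    · simp [h, Enc.dat, listDat] at this
  · have : ∀ a : {a // Enc.dat (f a) ≠ .nil}, ∃ b l, f a = b :: l := by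
      rintro ⟨a, ha⟩
      cases h : f a
      · simp [h, Enc.dat, listDat] at ha
      · exact ⟨_, _, rfl⟩
    choose b l hbl using this
    have h1 : PT (fun a : {a // Enc.dat (f a) ≠ .nil} => Enc.dat a.1)
        fun a => .cons (Enc.dat (b a)) (Enc.dat (l a)) :=
      (PT.pull hf _).congr fun a => by rw [hbl]; rfl
    exact (((PT.refl _).cons h1).comp
      (PT.pull hh fun a : {a // Enc.dat (f a) ≠ .nil} => (a.1, b a, l a))).congr
      fun a => by simp only [hbl]

@[fun_prop]
theorem tail {f : α → List β} (hf : PolyTime f) : PolyTime fun a => (f a).tail :=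
  (list_cases (h := fun _ _ l => l) hf (const []) (by fun_prop)).of_dat_eq fun a => by
    cases f a <;> rfl

@[fun_prop]
theorem headD {f : α → List β} {g : α → β} (hf : PolyTime f) (hg : PolyTime g) :
    PolyTime fun a => (f a).headD (g a) :=
  (list_cases (h := fun _ b _ => b) hf hg (by fun_prop)).of_dat_eq fun a => by
    cases f a <;> rfl

@[fun_prop]
theorem isEmpty {f : α → List β} (hf : PolyTime f) : PolyTime fun a => (f a).isEmpty :=
  (list_cases (h := fun _ _ _ => false) hf (const true) (by fun_prop)).of_dat_eq fun a => by
    cases f a <;> rfl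

theorem foldl {f : α → List β} {g : α → σ} {h : α → σ → β → σ} (hf : PolyTime f) (hg : PolyTime g)
    (hh : PolyTime fun x : α × σ × β => h x.1 x.2.1 x.2.2) {q : α → ℕ} (hq : PolyBound q)
    (hb : ∀ a l, l <+: f a → StackProg.size (l.foldl (h a) (g a)) ≤ q a) :
    PolyTime fun a => (f a).foldl (h a) (g a) := by
  obtain ⟨Q, hQ⟩ := hq
  refine PT.comp (PT.cons hf (PT.cons (PT.refl _) hg))
    (PT.foldl (p := Enc.dat) (s := Enc.dat) (b := Enc.dat) (step := h) hh (fun a => a) g f Q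
      fun a l hl => (hb a l hl).trans ((hQ a).trans (eval_mono Q ?_)))
  simp only [Dat.size, StackProg.size]
  omega

/-- Additive growth per step is harmless: after the fold the measure `Φ` has grown by at most the
length of the list times `q a`. The measure is separate from the tree size because for numbers the
natural measure is the bit length, which controls the size through `R`. -/
theorem foldl_of_growth {f : α → List β} {g : α → σ} {h : α → σ → β → σ} (hf : PolyTime f)
    (hg : PolyTime g) (hh : PolyTime fun x : α × σ × β => h x.1 x.2.1 x.2.2) (Φ : σ → ℕ)
    {R : Polynomial ℕ} (hR : ∀ s, StackProg.size s ≤ R.eval (Φ s))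
    (hΦ : PolyBound fun a => Φ (g a)) {q : α → ℕ} (hq : PolyBound q)
    (hb : ∀ a s, ∀ b ∈ f a, Φ (h a s b) ≤ Φ s + q a) :
    PolyTime fun a => (f a).foldl (h a) (g a) := by
  refine foldl hf hg hh (((hf.size_bound.mul hq).add hΦ).comp (r := fun n => R.eval n)
    (R := R) fun n => le_rfl) fun a l hl => (hR _).trans (eval_mono R ?_)
  have key : ∀ (l : List β), (∀ b ∈ l, b ∈ f a) → ∀ s,
      Φ (l.foldl (h a) s) ≤ Φ s + l.length * q a := by
    intro l
    induction l with
    | nil => intro _ s; simp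
    | cons b l ih =>
      intro hl s
      have h1 := ih (fun b hb => hl b (List.mem_cons_of_mem _ hb)) (h a s b)
      have h2 := hb a s b (hl b List.mem_cons_self)
      rw [List.foldl_cons, List.length_cons, Nat.add_mul]
      omega
  have h1 := key l (fun b hb => hl.subset hb) (g a)
  have h2 : l.length ≤ StackProg.size (f a) := hl.length_le.trans (length_lt_size _).le
  have h3 := Nat.mul_le_mul_right (q a) h2
  omega

theorem foldl_of_size_growth {f : α → List β} {g : α → σ} {h : α → σ → β → σ} (hf : PolyTime f)
    (hg : PolyTime g) (hh : PolyTime fun x : α × σ × β => h x.1 x.2.1 x.2.2)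
    {q : α → ℕ} (hq : PolyBound q)
    (hb : ∀ a s, ∀ b ∈ f a, StackProg.size (h a s b) ≤ StackProg.size s + q a) :
    PolyTime fun a => (f a).foldl (h a) (g a) :=
  foldl_of_growth hf hg hh StackProg.size (R := .X) (by simp) hg.size_bound hq hb

@[fun_prop]
theorem reverse {f : α → List β} (hf : PolyTime f) : PolyTime fun a => (f a).reverse := by
  refine (foldl_of_size_growth (g := fun _ => []) (h := fun _ (s : List β) b => b :: s) hf
    (by fun_prop) (by fun_prop) hf.size_bound fun a s b hb => ?_).of_dat_eq
    fun a => by rw [List.foldl_flip_cons_eq_append']; simp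
  have := size_le_of_mem hb
  rw [size_cons]
  omega

@[fun_prop]
theorem append {f g : α → List β} (hf : PolyTime f) (hg : PolyTime g) :
    PolyTime fun a => f a ++ g a := by
  refine (foldl_of_size_growth (g := g) (h := fun _ (s : List β) b => b :: s) hf.reverse
    hg (by fun_prop) hf.reverse.size_bound fun a s b hb => ?_).of_dat_eq
    fun a => by rw [List.foldl_flip_cons_eq_append']; simp
  have := size_le_of_mem hb
  rw [size_cons]
  omega

theorem map {f : α → List β} {h : α → β → γ} (hf : PolyTime f)
    (hh : PolyTime fun x : α × β => h x.1 x.2) : PolyTime fun a => (f a).map (h a) := by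
  obtain ⟨Q, hQ⟩ := hh.size_bound
  have hq : PolyBound fun a => Q.eval (StackProg.size a + StackProg.size (f a) + 1) + 1 :=
    ((PolyBound.size.add hf.size_bound).add (.const 1)).comp (r := fun n => Q.eval n + 1)
      (R := Q + 1) fun n => by simp
  have := (foldl_of_size_growth (g := fun _ => []) (h := fun a (s : List γ) b => h a b :: s) hf
    (by fun_prop) (PolyTime.cons (hh.comp (g := fun x : α × List γ × β => (x.1, x.2.2))
    (by fun_prop)) (by fun_prop)) hq fun a s b hb => ?_).reverse
  · exact this.of_dat_eq fun a => by simp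
  · have h1 := hQ (a, b)
    have h2 : Q.eval (StackProg.size (a, b)) ≤ Q.eval (StackProg.size a + StackProg.size (f a) + 1) := by
      refine eval_mono Q ?_
      have := size_le_of_mem hb
      rw [size_prod]
      omega
    simp only at h1
    rw [size_cons]
    omega

theorem all {f : α → List β} {h : α → β → Bool} (hf : PolyTime f)
    (hh : PolyTime fun x : α × β => h x.1 x.2) : PolyTime fun a => (f a).all (h a) := by
  refine (foldl (g := fun _ => true) (h := fun a s b => s && h a b) hf
    (by fun_prop) (PolyTime.and (by fun_prop) (hh.comp (g := fun x : α × Bool × β => (x.1, x.2.2))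
    (by fun_prop))) (.const 3) fun a l _ => size_bool _).of_dat_eq fun a => ?_
  congr 1
  have key : ∀ (l : List β) (s : Bool),
      l.foldl (fun s b => s && h a b) s = (s && l.all (h a)) := by
    intro l
    induction l with
    | nil => simp
    | cons b l ih => intro s; rw [List.foldl_cons, ih, List.all_cons, Bool.and_assoc]
  simpa using key (f a) true

/-- Drop as many items from a list as another list has. -/
theorem drop_length {f : α → List β} {g : α → List γ} (hf : PolyTime f) (hg : PolyTime g) :
    PolyTime fun a => (g a).drop (f a).length := by
  refine (foldl_of_size_growth (g := g) (h := fun _ (s : List γ) _ => s.tail) hf hg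
    (by fun_prop) (.const 0) fun a s b _ => size_tail_le s).of_dat_eq fun a => ?_
  congr 1
  have key : ∀ (l : List β) (s : List γ), l.foldl (fun s _ => s.tail) s = s.drop l.length := by
    intro l
    induction l with
    | nil => simp
    | cons b l ih => intro s; rw [List.foldl_cons, ih]; cases s <;> simp
  exact key _ _

end PolyTime

end StackProg

namespace StackProg

open Dat

/-! ### Binary arithmetic -/

/-- The number with the given binary digits, least significant first. -/
def bitsVal : List Bool → ℕ
  | [] => 0
  | b :: l => Nat.bit b (bitsVal l)

theorem bitsVal_bits (n : ℕ) : bitsVal n.bits = n := by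
  induction n using Nat.binaryRec' with
  | zero => simp [bitsVal]
  | bit b n h ih => rw [Nat.bits_append_bit n b h, bitsVal, ih]

/-- Prepending a digit to canonical digits keeps them canonical, except for a zero in front of the
empty list. This makes the removal of leading zeros a fold. -/
theorem bits_bitsVal_cons (b : Bool) (l : List Bool) :
    (bitsVal (b :: l)).bits = bif !b && (bitsVal l).bits.isEmpty then []
      else b :: (bitsVal l).bits := by
  by_cases h : bitsVal l = 0 → b = true
  · rw [bitsVal, Nat.bits_append_bit _ _ h]
    cases b with
    | true => rfl
    | false =>
      have h0 : bitsVal l ≠ 0 := fun h' => by simpa using h h'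
      have : (bitsVal l).bits ≠ [] := fun h' => h0 (by rw [← bitsVal_bits (bitsVal l), h']; rfl)
      cases hb : (bitsVal l).bits with
      | nil => exact absurd hb this
      | cons => rfl
  · push Not at h
    obtain ⟨h0, hb⟩ := h
    have hb : b = false := by simpa using hb
    simp [bitsVal, h0, hb]

theorem length_bits_le {n m : ℕ} (h : n < 2 ^ m) : n.bits.length ≤ m := by
  rw [Nat.size_eq_bits_len]
  exact Nat.size_le.2 h

theorem lt_two_pow_length_bits (n : ℕ) : n < 2 ^ n.bits.length := by
  rw [Nat.size_eq_bits_len]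
  exact Nat.lt_size_self n

/-- The number of binary digits. -/
def len (n : ℕ) : ℕ := n.bits.length

theorem len_mono {m n : ℕ} (h : m ≤ n) : len m ≤ len n :=
  length_bits_le (h.trans_lt (lt_two_pow_length_bits n))

theorem len_add_le (m n : ℕ) : len (m + n) ≤ max (len m) (len n) + 1 := by
  refine length_bits_le ?_
  have hm := (lt_two_pow_length_bits m).trans_le
    (Nat.pow_le_pow_right two_pos (le_max_left (len m) (len n)))
  have hn := (lt_two_pow_length_bits n).trans_le
    (Nat.pow_le_pow_right two_pos (le_max_right (len m) (len n)))
  rw [pow_succ]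
  omega

theorem len_mul_le (m n : ℕ) : len (m * n) ≤ len m + len n := by
  refine length_bits_le ?_
  rw [pow_add]
  exact Nat.mul_lt_mul'' (lt_two_pow_length_bits m) (lt_two_pow_length_bits n)

instance : Enc ℕ := ⟨fun n => Enc.dat n.bits⟩

instance : Enc ℕ+ := ⟨fun n => Enc.dat (n : ℕ)⟩

theorem size_bits_le (l : List Bool) : size l ≤ 4 * l.length + 1 := by
  induction l with
  | nil => simp [size_nil]
  | cons b l ih =>
    have := size_bool b
    rw [size_cons, List.length_cons]
    omega

theorem size_nat_le (n : ℕ) : size n ≤ 4 * len n + 1 := size_bits_le n.bits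

theorem len_lt_size (n : ℕ) : len n < size n := length_lt_size n.bits

/-- One step of the addition of two numbers: their remaining digits, the carry, and the digits of
the sum that have been computed. -/
def addStep (s : List Bool × List Bool × Bool × List Bool) :
    List Bool × List Bool × Bool × List Bool :=
  (s.1.tail, s.2.1.tail,
    (s.1.headD false && s.2.1.headD false) ||
      ((s.1.headD false || s.2.1.headD false) && s.2.2.1),
    (s.1.headD false ^^ (s.2.1.headD false ^^ s.2.2.1)) :: s.2.2.2)

theorem bitsVal_append (l m : List Bool) :
    bitsVal (l ++ m) = bitsVal l + 2 ^ l.length * bitsVal m := by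
  induction l with
  | nil => simp [bitsVal]
  | cons b l ih => simp only [List.cons_append, bitsVal, ih, Nat.bit_val, List.length_cons]; ring

theorem bitsVal_eq_head_tail (l : List Bool) :
    bitsVal l = 2 * bitsVal l.tail + (l.headD false).toNat := by
  cases l <;> simp [bitsVal, Nat.bit_val]

/-- The invariant of schoolbook addition: the output so far, plus the remaining summands and the
carry shifted by the number of digits already written. -/
theorem addStep_invariant (s : List Bool × List Bool × Bool × List Bool) :
    bitsVal (addStep s).2.2.2.reverse + 2 ^ (addStep s).2.2.2.length *
      (bitsVal (addStep s).1 + bitsVal (addStep s).2.1 + (addStep s).2.2.1.toNat) =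
    bitsVal s.2.2.2.reverse + 2 ^ s.2.2.2.length *
      (bitsVal s.1 + bitsVal s.2.1 + s.2.2.1.toNat) := by
  obtain ⟨l, m, c, o⟩ := s
  simp only [addStep, List.reverse_cons, bitsVal_append, List.length_cons, List.length_reverse]
  rw [bitsVal_eq_head_tail l, bitsVal_eq_head_tail m]
  cases l.headD false <;> cases m.headD false <;> cases c <;>
    simp [bitsVal, Nat.bit_val, pow_succ] <;> ring

theorem foldl_addStep (k : List Bool) : ∀ s : List Bool × List Bool × Bool × List Bool,
    (k.foldl (fun s _ => addStep s) s).1 = s.1.drop k.length ∧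
    (k.foldl (fun s _ => addStep s) s).2.1 = s.2.1.drop k.length ∧
    bitsVal (k.foldl (fun s _ => addStep s) s).2.2.2.reverse +
      2 ^ (k.foldl (fun s _ => addStep s) s).2.2.2.length *
      (bitsVal (k.foldl (fun s _ => addStep s) s).1 +
        bitsVal (k.foldl (fun s _ => addStep s) s).2.1 +
        (k.foldl (fun s _ => addStep s) s).2.2.1.toNat) =
    bitsVal s.2.2.2.reverse + 2 ^ s.2.2.2.length *
      (bitsVal s.1 + bitsVal s.2.1 + s.2.2.1.toNat) := by
  induction k with
  | nil => intro s; simp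
  | cons b k ih =>
    intro s
    obtain ⟨h1, h2, h3⟩ := ih (addStep s)
    refine ⟨?_, ?_, ?_⟩
    · rw [List.foldl_cons, h1, addStep, List.length_cons, List.drop_tail]
    · rw [List.foldl_cons, h2, addStep, List.length_cons, List.drop_tail]
    · rw [List.foldl_cons, h3, addStep_invariant]

/-- One step of the comparison of two numbers. -/
def leStep (s : List Bool × List Bool × Bool) : List Bool × List Bool × Bool :=
  (s.1.tail, s.2.1.tail,
    bif s.1.headD false then s.2.1.headD false && s.2.2 else s.2.1.headD false || s.2.2)

/-- The digits arrive least significant first. The flag says whether `≤` holds for the digits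
already read, and a later, more significant digit overrides it unless the two digits agree. -/
theorem foldl_leStep (k : List Bool) : ∀ s : List Bool × List Bool × Bool,
    (k.foldl (fun s _ => leStep s) s).1 = s.1.drop k.length ∧
    (k.foldl (fun s _ => leStep s) s).2.1 = s.2.1.drop k.length ∧
    ((bitsVal (k.foldl (fun s _ => leStep s) s).1 <
        bitsVal (k.foldl (fun s _ => leStep s) s).2.1 ∨
      (bitsVal (k.foldl (fun s _ => leStep s) s).1 =
        bitsVal (k.foldl (fun s _ => leStep s) s).2.1 ∧
        (k.foldl (fun s _ => leStep s) s).2.2 = true)) ↔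
      (bitsVal s.1 < bitsVal s.2.1 ∨ (bitsVal s.1 = bitsVal s.2.1 ∧ s.2.2 = true))) := by
  induction k with
  | nil => intro s; simp
  | cons b k ih =>
    intro s
    obtain ⟨h1, h2, h3⟩ := ih (leStep s)
    refine ⟨?_, ?_, ?_⟩
    · rw [List.foldl_cons, h1, leStep, List.length_cons, List.drop_tail]
    · rw [List.foldl_cons, h2, leStep, List.length_cons, List.drop_tail]
    · rw [List.foldl_cons, h3]
      obtain ⟨l, m, c⟩ := s
      simp only [leStep]
      rw [bitsVal_eq_head_tail l, bitsVal_eq_head_tail m]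
      cases l.headD false <;> cases m.headD false <;> cases c <;> simp <;> omega

variable {α β γ σ : Type} [Enc α] [Enc β] [Enc γ] [Enc σ]

namespace PolyTime

@[fun_prop]
theorem bits {f : α → ℕ} (hf : PolyTime f) : PolyTime fun a => (f a).bits := hf

@[fun_prop]
theorem bitsVal {f : α → List Bool} (hf : PolyTime f) : PolyTime fun a => bitsVal (f a) := by
  refine (foldl_of_size_growth (g := fun _ => [])
    (h := fun _ (s : List Bool) b => bif !b && s.isEmpty then [] else b :: s) hf.reverse
    (by fun_prop) (by fun_prop) (.const 4) fun a s b _ => ?_).of_dat_eq fun a => ?_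
  · have := size_bool b
    have := one_le_size s
    cases !b && s.isEmpty
    · simp only [cond_false, size_cons]; omega
    · simp only [cond_true, size_nil]; omega
  · change _ = Enc.dat (StackProg.bitsVal (f a)).bits
    congr 1
    rw [List.foldl_reverse]
    induction f a with
    | nil => simp [StackProg.bitsVal]
    | cons b l ih => rw [List.foldr_cons, ih, bits_bitsVal_cons]

theorem xor {f g : α → Bool} (hf : PolyTime f) (hg : PolyTime g) :
    PolyTime fun a => f a ^^ g a :=
  (cond hf hg.not hg).of_dat_eq fun a => by cases f a <;> simp

@[fun_prop]
theorem natAdd {f g : α → ℕ} (hf : PolyTime f) (hg : PolyTime g) :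
    PolyTime fun a => f a + g a := by
  -- The concatenation of both digit lists serves only as a counter, long enough to exhaust both
  -- summands. The carry left at the end becomes the leading digit.
  have h : PolyTime fun a : α => ((f a).bits ++ (g a).bits).foldl (fun s _ => addStep s)
      ((f a).bits, (g a).bits, false, []) := by
    refine foldl_of_size_growth (q := fun _ => 6) (h := fun _ s _ => addStep s)
      (by fun_prop) (by fun_prop) ?_ (.const 6) ?_
    · unfold addStep
      have h1 : PolyTime fun x : α × (List Bool × List Bool × Bool × List Bool) × Bool =>
        (x.2.1.1.headD false ^^ (x.2.1.2.1.headD false ^^ x.2.1.2.2.1)) :=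
        xor (by fun_prop) (xor (by fun_prop) (by fun_prop))
      fun_prop
    · rintro a ⟨l, m, c, o⟩ b _
      simp only [addStep, size_prod, size_cons]
      have h1 := size_tail_le l
      have h2 := size_tail_le m
      have h3 := size_bool (l.headD false ^^ (m.headD false ^^ c))
      have h4 := size_bool ((l.headD false && m.headD false) ||
        ((l.headD false || m.headD false) && c))
      have := one_le_size c
      omega
  refine (PolyTime.bitsVal (f := fun a => List.reverse (_ :: _))
    (reverse (cons h.snd.snd.fst h.snd.snd.snd))).of_dat_eq fun a => ?_
  congr 1
  obtain ⟨h1, h2, h3⟩ := foldl_addStep ((f a).bits ++ (g a).bits)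
    ((f a).bits, (g a).bits, false, [])
  rw [List.drop_eq_nil_of_le (by simp)] at h1 h2
  rw [h1, h2] at h3
  rw [List.reverse_cons, bitsVal_append, List.length_reverse]
  simp only [bitsVal_bits, StackProg.bitsVal, Nat.bit_val, List.reverse_nil, List.length_nil,
    Bool.toNat_false] at h3 ⊢
  simpa using h3

@[fun_prop]
theorem natLe {f g : α → ℕ} (hf : PolyTime f) (hg : PolyTime g) :
    PolyTime fun a => decide (f a ≤ g a) := by
  have h : PolyTime fun a : α => ((f a).bits ++ (g a).bits).foldl (fun s _ => leStep s)
      ((f a).bits, (g a).bits, true) := by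
    refine foldl_of_size_growth (q := fun _ => 3) (h := fun _ s _ => leStep s)
      (by fun_prop) (by fun_prop) (by unfold leStep; fun_prop) (.const 3) ?_
    rintro a ⟨l, m, c⟩ b _
    simp only [leStep, size_prod]
    have h1 := size_tail_le l
    have h2 := size_tail_le m
    have h3 := size_bool (bif l.headD false then m.headD false && c else m.headD false || c)
    omega
  refine h.snd.snd.of_dat_eq fun a => ?_
  congr 1
  obtain ⟨h1, h2, h3⟩ := foldl_leStep ((f a).bits ++ (g a).bits) ((f a).bits, (g a).bits, true)
  rw [List.drop_eq_nil_of_le (by simp)] at h1 h2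
  rw [h1, h2] at h3
  simp only [bitsVal_bits, lt_irrefl, false_or, true_and, and_true] at h3
  rw [Bool.eq_iff_iff, h3, decide_eq_true_iff, le_iff_lt_or_eq]

-- Horner's scheme from the most significant digit: doubling, and adding the second factor where the
-- digit is one. Each round lengthens the accumulator by at most the bit length of that factor plus
-- 2.
@[fun_prop]
theorem natMul {f g : α → ℕ} (hf : PolyTime f) (hg : PolyTime g) :
    PolyTime fun a => f a * g a := by
  refine (foldl_of_growth (f := fun a => (f a).bits.reverse) (g := fun _ => 0)
    (h := fun a s b => bif b then s + s + g a else s + s) (by fun_prop)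
    (by fun_prop) (by fun_prop) len (R := 4 * .X + 1)
    (fun s => by simpa using size_nat_le s) (.const 0)
    (q := fun a => size (g a) + 2) (hg.size_bound.add (.const 2)) ?_).of_dat_eq fun a => ?_
  · intro a s b _
    have h1 := len_add_le (s + s) (g a)
    have h2 := len_add_le s s
    have h3 := len_lt_size (g a)
    have h4 := len_mono (Nat.le_add_right (s + s) (g a))
    have : len (bif b then s + s + g a else s + s) ≤ len (s + s + g a) := by
      cases b <;> simp [h4]
    omega
  · congr 1
    rw [List.foldl_reverse]
    have key : ∀ l : List Bool, l.foldr (fun b s => bif b then s + s + g a else s + s) 0 =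
        StackProg.bitsVal l * g a := by
      intro l
      induction l with
      | nil => simp [StackProg.bitsVal]
      | cons b l ih =>
        rw [List.foldr_cons, ih, StackProg.bitsVal, Nat.bit_val]
        cases b <;> simp <;> ring
    rw [key, bitsVal_bits]

@[fun_prop]
theorem pnatVal {f : α → ℕ+} (hf : PolyTime f) : PolyTime fun a => (f a : ℕ) := hf

theorem of_pnatVal {f : α → ℕ+} (hf : PolyTime fun a => (f a : ℕ)) : PolyTime f := hf

theorem pnatMul {f g : α → ℕ+} (hf : PolyTime f) (hg : PolyTime g) :
    PolyTime fun a => f a * g a :=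
  of_pnatVal (by simp only [PNat.mul_coe]; fun_prop)

end PolyTime

end StackProg

namespace StackProg

/-! ### Exact arithmetic with real numbers -/

/-- Exact arithmetic, in polynomial time, in a ring of real numbers whose items are represented
by `R`. -/
structure NumRep (R : Type) [Enc R] where
  /-- the represented number -/
  val : R → ℝ
  /-- the natural numbers -/
  ofNat : ℕ → R
  /-- addition -/
  add : R → R → R
  /-- multiplication -/
  mul : R → R → R
  /-- negation -/
  neg : R → R
  /-- the sign test -/
  nonneg : R → Bool
  /-- the bit length -/
  height : R → ℕ
  /-- a bound for the growth of the bit length -/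
  c : ℕ
  /-- a bound for the size in terms of the bit length -/
  bound : Polynomial ℕ
  val_ofNat : ∀ n, val (ofNat n) = n
  val_add : ∀ x y, val (add x y) = val x + val y
  val_mul : ∀ x y, val (mul x y) = val x * val y
  val_neg : ∀ x, val (neg x) = -val x
  nonneg_iff : ∀ x, nonneg x = true ↔ 0 ≤ val x
  polyTime_ofNat : PolyTime ofNat
  polyTime_add : PolyTime fun x : R × R => add x.1 x.2
  polyTime_mul : PolyTime fun x : R × R => mul x.1 x.2
  polyTime_neg : PolyTime neg
  polyTime_nonneg : PolyTime nonneg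
  height_add : ∀ x y, height (add x y) ≤ max (height x) (height y) + c
  height_mul : ∀ x y, height (mul x y) ≤ height x + height y + c
  height_ofNat : ∀ n, height (ofNat n) ≤ len n + c
  height_le : ∀ x, height x ≤ size x
  size_le : ∀ x, size x ≤ bound.eval (height x)

namespace NumRep

variable {R α : Type} [Enc R] [Enc α] (N : NumRep R) {f g : α → R}

@[fun_prop]
theorem ofNat_polyTime {f : α → ℕ} (hf : PolyTime f) : PolyTime fun a => N.ofNat (f a) :=
  N.polyTime_ofNat.comp hf

@[fun_prop]
theorem add_polyTime (hf : PolyTime f) (hg : PolyTime g) : PolyTime fun a => N.add (f a) (g a) :=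
  PolyTime.comp (f := fun x : R × R => N.add x.1 x.2) N.polyTime_add (hf.prodMk hg)

@[fun_prop]
theorem mul_polyTime (hf : PolyTime f) (hg : PolyTime g) : PolyTime fun a => N.mul (f a) (g a) :=
  PolyTime.comp (f := fun x : R × R => N.mul x.1 x.2) N.polyTime_mul (hf.prodMk hg)

@[fun_prop]
theorem neg_polyTime (hf : PolyTime f) : PolyTime fun a => N.neg (f a) :=
  N.polyTime_neg.comp hf

@[fun_prop]
theorem nonneg_polyTime (hf : PolyTime f) : PolyTime fun a => N.nonneg (f a) :=
  N.polyTime_nonneg.comp hf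

end NumRep

/-- The integers, as differences of natural numbers. -/
noncomputable def intRep : NumRep (ℕ × ℕ) where
  val x := (x.1 : ℝ) - x.2
  ofNat n := (n, 0)
  add x y := (x.1 + y.1, x.2 + y.2)
  mul x y := (x.1 * y.1 + x.2 * y.2, x.1 * y.2 + x.2 * y.1)
  neg x := (x.2, x.1)
  nonneg x := decide (x.2 ≤ x.1)
  height x := max (len x.1) (len x.2)
  c := 1
  bound := 8 * .X + 3
  val_ofNat n := by simp
  val_add x y := by push_cast; ring
  val_mul x y := by push_cast; ring
  val_neg x := by ring
  nonneg_iff x := by simp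
  polyTime_ofNat := by fun_prop
  polyTime_add := by fun_prop
  polyTime_mul := by fun_prop
  polyTime_neg := by fun_prop
  polyTime_nonneg := by fun_prop
  height_add x y := by
    have h1 := len_add_le x.1 y.1
    have h2 := len_add_le x.2 y.2
    simp only [] at *
    omega
  height_mul x y := by
    have h1 := len_add_le (x.1 * y.1) (x.2 * y.2)
    have h2 := len_add_le (x.1 * y.2) (x.2 * y.1)
    have h3 := len_mul_le x.1 y.1
    have h4 := len_mul_le x.2 y.2
    have h5 := len_mul_le x.1 y.2
    have h6 := len_mul_le x.2 y.1
    simp only [] at *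
    omega
  height_ofNat n := by simp [len]
  height_le x := by
    have h1 := len_lt_size x.1
    have h2 := len_lt_size x.2
    rw [← Prod.mk.eta (p := x), size_prod]
    simp only at *
    omega
  size_le x := by
    have h1 := size_nat_le x.1
    have h2 := size_nat_le x.2
    rw [← Prod.mk.eta (p := x), size_prod]
    simp
    omega

/-- If the two summands have opposite signs, comparing their squares decides. For `r = √m` only
signs of expressions in `A`, `B` and `m` remain, so a sign test passes from a ring to its extension
by `√m`. -/
theorem nonneg_add_mul_iff {A B r : ℝ} (hr : 0 ≤ r) : 0 ≤ A + B * r ↔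
    (0 ≤ A ∧ 0 ≤ B) ∨ (0 ≤ A ∧ 0 ≤ A * A - r * r * (B * B)) ∨
      (0 ≤ B ∧ 0 ≤ r * r * (B * B) - A * A) := by
  constructor
  · intro h
    rcases le_or_gt 0 A with hA | hA
    · rcases le_or_gt 0 B with hB | hB
      · exact .inl ⟨hA, hB⟩
      · refine .inr (.inl ⟨hA, ?_⟩)
        have := mul_self_le_mul_self (mul_nonneg (neg_nonneg.2 hB.le) hr)
          (show -B * r ≤ A by linarith)
        nlinarith
    · rcases le_or_gt 0 B with hB | hB
      · refine .inr (.inr ⟨hB, ?_⟩)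
        have := mul_self_le_mul_self (neg_nonneg.2 hA.le) (show -A ≤ B * r by linarith)
        nlinarith
      · have := mul_nonneg (neg_nonneg.2 hB.le) hr
        linarith
  · rintro (⟨hA, hB⟩ | ⟨hA, h⟩ | ⟨hB, h⟩)
    · positivity
    · have := abs_le_of_sq_le_sq' (show (B * r) ^ 2 ≤ A ^ 2 by nlinarith) hA
      linarith
    · have := abs_le_of_sq_le_sq' (show A ^ 2 ≤ (B * r) ^ 2 by nlinarith) (mul_nonneg hB hr)
      linarith

/-- The numbers `A + B √m`. -/
noncomputable def quadRep {R : Type} [Enc R] (N : NumRep R) (m : ℕ) : NumRep (R × R) where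
  val x := N.val x.1 + N.val x.2 * √m
  ofNat n := (N.ofNat n, N.ofNat 0)
  add x y := (N.add x.1 y.1, N.add x.2 y.2)
  mul x y := (N.add (N.mul x.1 y.1) (N.mul (N.ofNat m) (N.mul x.2 y.2)),
    N.add (N.mul x.1 y.2) (N.mul x.2 y.1))
  neg x := (N.neg x.1, N.neg x.2)
  nonneg x := (N.nonneg x.1 && N.nonneg x.2) ||
    ((N.nonneg x.1 && N.nonneg (N.add (N.mul x.1 x.1)
        (N.neg (N.mul (N.ofNat m) (N.mul x.2 x.2))))) ||
      (N.nonneg x.2 && N.nonneg (N.add (N.mul (N.ofNat m) (N.mul x.2 x.2))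
        (N.neg (N.mul x.1 x.1)))))
  height x := max (N.height x.1) (N.height x.2)
  -- The worst case is the product: the constant `m`, two nested multiplications and one addition
  -- contribute `N.c` each, and `m` itself contributes its length.
  c := len m + 4 * N.c
  bound := 2 * N.bound + 1
  val_ofNat n := by simp [N.val_ofNat]
  val_add x y := by simp only [N.val_add]; ring
  val_mul x y := by
    simp only [N.val_add, N.val_mul, N.val_ofNat]
    linear_combination (-N.val x.2 * N.val y.2) * Real.mul_self_sqrt (Nat.cast_nonneg (α := ℝ) m)
  val_neg x := by simp only [N.val_neg]; ring
  nonneg_iff x := by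
    rw [nonneg_add_mul_iff (Real.sqrt_nonneg _), Real.mul_self_sqrt (Nat.cast_nonneg (α := ℝ) m)]
    simp only [Bool.or_eq_true, Bool.and_eq_true, N.nonneg_iff, N.val_add, N.val_mul, N.val_ofNat,
      N.val_neg, sub_eq_add_neg]
  polyTime_ofNat := by fun_prop
  polyTime_add := by fun_prop
  polyTime_mul := by fun_prop
  polyTime_neg := by fun_prop
  polyTime_nonneg := by fun_prop
  height_add x y := by
    have h1 := N.height_add x.1 y.1
    have h2 := N.height_add x.2 y.2
    simp only [] at *
    omega
  height_mul x y := by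
    have h1 := N.height_add (N.mul x.1 y.1) (N.mul (N.ofNat m) (N.mul x.2 y.2))
    have h2 := N.height_add (N.mul x.1 y.2) (N.mul x.2 y.1)
    have h3 := N.height_mul x.1 y.1
    have h4 := N.height_mul x.2 y.2
    have h5 := N.height_mul x.1 y.2
    have h6 := N.height_mul x.2 y.1
    have h7 := N.height_mul (N.ofNat m) (N.mul x.2 y.2)
    have h8 := N.height_ofNat m
    simp only [] at *
    omega
  height_ofNat n := by
    have h1 := N.height_ofNat n
    have h2 := N.height_ofNat 0
    have : len 0 = 0 := rfl
    simp only [] at *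
    omega
  height_le x := by
    have h1 := N.height_le x.1
    have h2 := N.height_le x.2
    rw [← Prod.mk.eta (p := x), size_prod]
    simp only at *
    omega
  size_le x := by
    have h1 := N.size_le x.1
    have h2 := N.size_le x.2
    have h3 := eval_mono N.bound (le_max_left (N.height x.1) (N.height x.2))
    have h4 := eval_mono N.bound (le_max_right (N.height x.1) (N.height x.2))
    rw [← Prod.mk.eta (p := x), size_prod]
    simp
    omega

/-- The numerators: the items of `ℤ[√2, √3]`. -/
abbrev Numer : Type := ((ℕ × ℕ) × (ℕ × ℕ)) × ((ℕ × ℕ) × (ℕ × ℕ))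

/-- Exact arithmetic in `ℤ[√2, √3]`. -/
noncomputable def numerRep : NumRep Numer := quadRep (quadRep intRep 2) 3

/-- The number that is represented by a numerator and a denominator. -/
noncomputable def fracVal (x : Numer × ℕ+) : ℝ := numerRep.val x.1 / (x.2 : ℕ)

/-- The sum of two fractions. -/
noncomputable def fracAdd (x y : Numer × ℕ+) : Numer × ℕ+ :=
  (numerRep.add (numerRep.mul x.1 (numerRep.ofNat y.2)) (numerRep.mul y.1 (numerRep.ofNat x.2)),
    x.2 * y.2)

theorem fracVal_fracAdd (x y : Numer × ℕ+) : fracVal (fracAdd x y) = fracVal x + fracVal y := by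
  have hx : ((x.2 : ℕ) : ℝ) ≠ 0 := by exact_mod_cast x.2.ne_zero
  have hy : ((y.2 : ℕ) : ℝ) ≠ 0 := by exact_mod_cast y.2.ne_zero
  simp only [fracVal, fracAdd, numerRep.val_add, numerRep.val_mul, numerRep.val_ofNat, PNat.mul_coe,
    Nat.cast_mul]
  field_simp

variable {α β γ : Type} [Enc α] [Enc β] [Enc γ]

theorem PolyTime.fracAdd {f g : α → Numer × ℕ+} (hf : PolyTime f) (hg : PolyTime g) :
    PolyTime fun a => fracAdd (f a) (g a) :=
  prodMk (numerRep.add_polyTime (numerRep.mul_polyTime hf.fst (numerRep.ofNat_polyTime hg.snd))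
    (numerRep.mul_polyTime hg.fst (numerRep.ofNat_polyTime hf.snd)))
    (pnatMul hf.snd hg.snd)

/-- The real number `f a` can be computed exactly, in polynomial time. -/
def RealPT (f : α → ℝ) : Prop := ∃ g : α → Numer × ℕ+, PolyTime g ∧ ∀ a, f a = fracVal (g a)

namespace RealPT

variable {f g : α → ℝ}

theorem congr (hf : RealPT f) (h : ∀ a, f a = g a) : RealPT g := funext h ▸ hf

theorem natCast {e : α → ℕ} (he : PolyTime e) : RealPT fun a => (e a : ℝ) :=
  ⟨fun a => (numerRep.ofNat (e a), 1), (numerRep.ofNat_polyTime he).prodMk (.const 1), fun a => by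
    simp [fracVal, numerRep.val_ofNat]⟩

theorem pnatInv {e : α → ℕ+} (he : PolyTime e) : RealPT fun a => ((e a : ℕ) : ℝ)⁻¹ :=
  ⟨fun a => (numerRep.ofNat 1, e a), (PolyTime.const _).prodMk he, fun a => by
    simp [fracVal, numerRep.val_ofNat]⟩

theorem natConst (n : ℕ) : RealPT fun _ : α => (n : ℝ) := natCast (.const n)

theorem zero : RealPT fun _ : α => (0 : ℝ) := (natConst 0).congr fun _ => by simp

theorem one : RealPT fun _ : α => (1 : ℝ) := (natConst 1).congr fun _ => by simp

theorem sqrt_two : RealPT fun _ : α => √2 :=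
  ⟨fun _ => (((((0, 0), (1, 0)), ((0, 0), (0, 0))), 1)), .const _, fun a => by
    simp [fracVal, numerRep, quadRep, intRep]⟩

theorem sqrt_three : RealPT fun _ : α => √3 :=
  ⟨fun _ => (((((0, 0), (0, 0)), ((1, 0), (0, 0))), 1)), .const _, fun a => by
    simp [fracVal, numerRep, quadRep, intRep]⟩

theorem add (hf : RealPT f) (hg : RealPT g) : RealPT fun a => f a + g a := by
  obtain ⟨f', hf', h⟩ := hf
  obtain ⟨g', hg', h'⟩ := hg
  exact ⟨_, hf'.fracAdd hg', fun a => by simp only [fracVal_fracAdd, h, h']⟩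

theorem mul (hf : RealPT f) (hg : RealPT g) : RealPT fun a => f a * g a := by
  obtain ⟨f', hf', h⟩ := hf
  obtain ⟨g', hg', h'⟩ := hg
  refine ⟨fun a => (numerRep.mul (f' a).1 (g' a).1, (f' a).2 * (g' a).2),
    (numerRep.mul_polyTime hf'.fst hg'.fst).prodMk (PolyTime.pnatMul hf'.snd hg'.snd), fun a => ?_⟩
  simp only [h, h', fracVal, numerRep.val_mul, PNat.mul_coe, Nat.cast_mul]
  rw [div_mul_div_comm]

theorem neg (hf : RealPT f) : RealPT fun a => -f a := by
  obtain ⟨f', hf', h⟩ := hf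
  refine ⟨fun a => (numerRep.neg (f' a).1, (f' a).2),
    (numerRep.polyTime_neg.comp hf'.fst).prodMk hf'.snd, fun a => ?_⟩
  simp only [h, fracVal, numerRep.val_neg, neg_div]

theorem sub (hf : RealPT f) (hg : RealPT g) : RealPT fun a => f a - g a :=
  (hf.add hg.neg).congr fun _ => (sub_eq_add_neg _ _).symm

theorem div_nat (hf : RealPT f) (n : ℕ+) : RealPT fun a => f a / (n : ℕ) :=
  (hf.mul (pnatInv (.const n))).congr fun _ => (div_eq_mul_inv _ _).symm

theorem finset_sum {ι : Type*} (s : Finset ι) {f : ι → α → ℝ} (hf : ∀ i, RealPT (f i)) :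
    RealPT fun a => ∑ i ∈ s, f i a := by
  classical
  induction s using Finset.induction_on with
  | empty => exact zero.congr fun a => by simp
  | insert i s hi ih => exact ((hf i).add ih).congr fun a => by rw [Finset.sum_insert hi]

theorem nonneg (hf : RealPT f) : PolyTime fun a => decide (0 ≤ f a) := by
  obtain ⟨f', hf', h⟩ := hf
  refine (numerRep.polyTime_nonneg.comp hf'.fst).of_dat_eq fun a => ?_
  congr 1
  rw [Bool.eq_iff_iff, numerRep.nonneg_iff, decide_eq_true_iff, h, fracVal]
  have : (0 : ℝ) < ((f' a).2 : ℕ) := by exact_mod_cast (f' a).2.pos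
  rw [le_div_iff₀ this, zero_mul]

theorem le (hf : RealPT f) (hg : RealPT g) : PolyTime fun a => decide (f a ≤ g a) :=
  (hg.sub hf).nonneg.of_dat_eq fun a => by simp only [sub_nonneg]

theorem cond {c : α → Bool} (hc : PolyTime c) (hf : RealPT f) (hg : RealPT g) :
    RealPT fun a => bif c a then f a else g a := by
  obtain ⟨f', hf', h⟩ := hf
  obtain ⟨g', hg', h'⟩ := hg
  exact ⟨_, hc.cond hf' hg', fun a => by cases hc : c a <;> simp [hc, h, h']⟩

theorem bool_cases {c : α → Bool} {f : Bool → α → ℝ} (hc : PolyTime c) (hf : ∀ b, RealPT (f b)) :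
    RealPT fun a => f (c a) a :=
  (cond hc (hf true) (hf false)).congr fun a => by cases c a <;> rfl

/-- Fractions are never reduced, so the denominators multiply. Still, each summand adds only its own
bit length to that of the partial sum, so `foldl_of_growth` applies with the larger of the bit
lengths of numerator and denominator as measure. -/
theorem list_sum {e : α → List β} {f : α → β → ℝ} (he : PolyTime e)
    (hf : RealPT fun x : α × β => f x.1 x.2) : RealPT fun a => ((e a).map (f a)).sum := by
  obtain ⟨f', hf', h⟩ := hf
  let Φ : Numer × ℕ+ → ℕ := fun x => max (numerRep.height x.1) (len x.2)
  -- The growth per step is bounded by the largest summand; the additional `3 * numerRep.c` below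
  -- accounts for one conversion, one multiplication and one addition.
  have hb : PolyBound fun a => ((e a).map fun b => size (f' (a, b))).foldr max 0 := by
    obtain ⟨Q, hQ⟩ := hf'.size_bound
    refine ((PolyBound.size.add he.size_bound).add (.const 1)).comp (r := fun n => Q.eval n)
      (R := Q) (fun n => le_rfl) |>.mono fun a => ?_
    have key : ∀ l : List β, (∀ b ∈ l, b ∈ e a) → (l.map fun b => size (f' (a, b))).foldr max 0 ≤
        Q.eval (size a + size (e a) + 1) := by
      intro l
      induction l with
      | nil => simp
      | cons b l ih =>
        intro hl
        refine max_le ((hQ (a, b)).trans (eval_mono Q ?_))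
          (ih fun b hb => hl b (List.mem_cons_of_mem _ hb))
        have := size_le_of_mem (hl b List.mem_cons_self)
        rw [size_prod]
        omega
    exact key _ fun b hb => hb
  refine ⟨_, PolyTime.foldl_of_growth (f := e) (g := fun _ => (numerRep.ofNat 0, 1))
    (h := fun a s b => fracAdd s (f' (a, b))) he (.const _)
    (PolyTime.fracAdd (by fun_prop) (hf'.comp (g := fun x : α × (Numer × ℕ+) × β => (x.1, x.2.2))
      (by fun_prop))) Φ (R := numerRep.bound + 4 * .X + 2) ?_ (.const _)
    (q := fun a => ((e a).map fun b => size (f' (a, b))).foldr max 0 + 3 * numerRep.c)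
    (hb.add (.const _)) ?_, fun a => ?_⟩
  · rintro ⟨x, d⟩
    have h1 := numerRep.size_le x
    have h2 : size d ≤ 4 * len d + 1 := size_nat_le d
    have h3 := eval_mono numerRep.bound (le_max_left (numerRep.height x) (len d))
    have h4 := le_max_right (numerRep.height x) (len d)
    rw [size_prod]
    simp [Φ] at h3 h4 ⊢
    omega
  · rintro a ⟨x, d⟩ b hb
    obtain ⟨⟨y, e'⟩, hy⟩ : ∃ z, f' (a, b) = z := ⟨_, rfl⟩
    have hle : ∀ l : List β, b ∈ l → size (f' (a, b)) ≤
        (l.map fun b => size (f' (a, b))).foldr max 0 := by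
      intro l
      induction l with
      | nil => simp
      | cons b' l ih =>
        intro hb
        rcases List.mem_cons.1 hb with rfl | hb
        · exact le_max_left _ _
        · exact (ih hb).trans (le_max_right _ _)
    have h0 := hle _ hb
    rw [hy, size_prod] at h0
    rw [hy]
    simp only [Φ, fracAdd, PNat.mul_coe]
    have h1 := numerRep.height_add (numerRep.mul x (numerRep.ofNat e'))
      (numerRep.mul y (numerRep.ofNat d))
    have h2 := numerRep.height_mul x (numerRep.ofNat e')
    have h3 := numerRep.height_mul y (numerRep.ofNat d)
    have h4 := numerRep.height_ofNat e'
    have h5 := numerRep.height_ofNat d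
    have h6 := len_mul_le d e'
    have h7 := numerRep.height_le y
    have h8 : len e' < size e' := len_lt_size e'
    omega
  · have key : ∀ (l : List β) (s : Numer × ℕ+),
        fracVal (l.foldl (fun s b => fracAdd s (f' (a, b))) s) =
          fracVal s + (l.map (f a)).sum := by
      intro l
      induction l with
      | nil => simp
      | cons b l ih =>
        intro s
        rw [List.foldl_cons, ih, fracVal_fracAdd, ← h (a, b), List.map_cons, List.sum_cons,
          add_assoc]
    rw [key]
    simp [fracVal, numerRep.val_ofNat]

end RealPT

/-- The complex number `f a` can be computed exactly, in polynomial time. -/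
def ComplexPT (f : α → ℂ) : Prop := (RealPT fun a => (f a).re) ∧ RealPT fun a => (f a).im

namespace ComplexPT

variable {f g : α → ℂ}

theorem congr (hf : ComplexPT f) (h : ∀ a, f a = g a) : ComplexPT g := funext h ▸ hf

theorem ofReal {f : α → ℝ} (hf : RealPT f) : ComplexPT fun a => (f a : ℂ) := ⟨hf, .zero⟩

theorem zero : ComplexPT fun _ : α => (0 : ℂ) := ⟨.zero, .zero⟩

theorem one : ComplexPT fun _ : α => (1 : ℂ) := ⟨.one, .zero⟩

theorem add (hf : ComplexPT f) (hg : ComplexPT g) : ComplexPT fun a => f a + g a :=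
  ⟨hf.1.add hg.1, hf.2.add hg.2⟩

theorem mul (hf : ComplexPT f) (hg : ComplexPT g) : ComplexPT fun a => f a * g a :=
  ⟨(hf.1.mul hg.1).sub (hf.2.mul hg.2), (hf.1.mul hg.2).add (hf.2.mul hg.1)⟩

theorem neg (hf : ComplexPT f) : ComplexPT fun a => -f a := ⟨hf.1.neg, hf.2.neg⟩

theorem finset_sum {ι : Type*} (s : Finset ι) {f : ι → α → ℂ} (hf : ∀ i, ComplexPT (f i)) :
    ComplexPT fun a => ∑ i ∈ s, f i a := by
  classical
  induction s using Finset.induction_on with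
  | empty => exact zero.congr fun a => by simp
  | insert i s hi ih => exact ((hf i).add ih).congr fun a => by rw [Finset.sum_insert hi]

theorem finset_prod {ι : Type*} (s : Finset ι) {f : ι → α → ℂ} (hf : ∀ i, ComplexPT (f i)) :
    ComplexPT fun a => ∏ i ∈ s, f i a := by
  classical
  induction s using Finset.induction_on with
  | empty => exact one.congr fun a => by simp
  | insert i s hi ih => exact ((hf i).mul ih).congr fun a => by rw [Finset.prod_insert hi]

theorem bool_cases {c : α → Bool} {f : Bool → α → ℂ} (hc : PolyTime c)
    (hf : ∀ b, ComplexPT (f b)) : ComplexPT fun a => f (c a) a :=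
  ⟨RealPT.bool_cases (f := fun b a => (f b a).re) hc fun b => (hf b).1,
    RealPT.bool_cases (f := fun b a => (f b a).im) hc fun b => (hf b).2⟩

theorem list_sum {e : α → List β} {f : α → β → ℂ} (he : PolyTime e)
    (hf : ComplexPT fun x : α × β => f x.1 x.2) : ComplexPT fun a => ((e a).map (f a)).sum := by
  have hre : ∀ l : List ℂ, l.sum.re = (l.map Complex.re).sum := fun l =>
    map_list_sum Complex.reAddGroupHom l
  have him : ∀ l : List ℂ, l.sum.im = (l.map Complex.im).sum := fun l =>
    map_list_sum Complex.imAddGroupHom l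
  refine ⟨(RealPT.list_sum (f := fun a b => (f a b).re) he hf.1).congr fun a => ?_, (RealPT.list_sum (f := fun a b => (f a b).im) he hf.2).congr fun a => ?_⟩
  · rw [hre, List.map_map]; rfl
  · rw [him, List.map_map]; rfl

end ComplexPT

end StackProg

namespace StackProg

open scoped ComplexOrder Matrix
open Polynomial

/-! ### Testing whether a matrix is positive semidefinite -/

variable {α : Type} [Enc α] {ι : Type} [Fintype ι] [DecidableEq ι]

/-- All coefficients of the polynomial `p a` can be computed exactly, in polynomial time. -/
def PolynomialPT (p : α → ℂ[X]) : Prop := ∀ n, ComplexPT fun a => (p a).coeff n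

namespace PolynomialPT

variable {p q : α → ℂ[X]}

theorem add (hp : PolynomialPT p) (hq : PolynomialPT q) : PolynomialPT fun a => p a + q a :=
  fun n => ((hp n).add (hq n)).congr fun _ => (coeff_add _ _ _).symm

theorem mul (hp : PolynomialPT p) (hq : PolynomialPT q) : PolynomialPT fun a => p a * q a :=
  fun n => (ComplexPT.finset_sum (Finset.HasAntidiagonal.antidiagonal n)
    fun i : ℕ × ℕ => (hp i.1).mul (hq i.2)).congr fun _ => (coeff_mul _ _ _).symm

theorem C {f : α → ℂ} (hf : ComplexPT f) : PolynomialPT fun a => C (f a) := fun n => by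
  by_cases hn : n = 0
  · exact hf.congr fun a => by simp [hn]
  · exact ComplexPT.zero.congr fun a => by rw [coeff_C, if_neg hn]

theorem X : PolynomialPT fun _ : α => (X : ℂ[X]) := fun n => by
  by_cases hn : n = 1
  · exact ComplexPT.one.congr fun a => by simp [hn]
  · exact ComplexPT.zero.congr fun a => by rw [coeff_X, if_neg (Ne.symm hn)]

theorem finset_sum {κ : Type*} (s : Finset κ) {p : κ → α → ℂ[X]} (hp : ∀ i, PolynomialPT (p i)) :
    PolynomialPT fun a => ∑ i ∈ s, p i a := fun n =>
  (ComplexPT.finset_sum s fun i => hp i n).congr fun _ => (finsetSum_coeff _ _ _).symm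

theorem finset_prod {κ : Type*} (s : Finset κ) {p : κ → α → ℂ[X]} (hp : ∀ i, PolynomialPT (p i)) :
    PolynomialPT fun a => ∏ i ∈ s, p i a := by
  classical
  induction s using Finset.induction_on with
  | empty => exact fun n => (C ComplexPT.one n).congr fun a => by simp
  | insert i s hi ih =>
    intro n
    exact ((hp i).mul ih n).congr fun a => by simp only [Finset.prod_insert hi]

end PolynomialPT

/-- Leibniz formula: the index type is fixed, so the number of permutations is a constant and no
elimination is needed. -/
theorem polynomialPT_charpoly {M : α → Matrix ι ι ℂ} (hM : ∀ i j, ComplexPT fun a => M a i j) :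
    PolynomialPT fun a => (M a).charpoly := by
  intro n
  refine (PolynomialPT.finset_sum Finset.univ (fun σ : Equiv.Perm ι => PolynomialPT.mul
    (p := fun _ => Polynomial.C (((Equiv.Perm.sign σ : ℤ) : ℂ)))
    (q := fun a => ∏ i, (M a).charmatrix (σ i) i) ?_
    (PolynomialPT.finset_prod _ fun i => ?_)) n).congr fun a => ?_
  · refine PolynomialPT.C ?_
    rcases Int.units_eq_one_or (Equiv.Perm.sign σ) with h | h
    · exact ComplexPT.one.congr fun _ => by simp [h]
    · exact ComplexPT.one.neg.congr fun _ => by simp [h]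
  · intro m
    by_cases h : σ i = i
    · exact ((PolynomialPT.X.add (PolynomialPT.C (f := fun a => -(M a (σ i) i))
        (hM (σ i) i).neg)) m).congr fun a => by
          simp only [h, Matrix.charmatrix_apply_eq, map_neg, sub_eq_add_neg]
    · exact ((PolynomialPT.C (f := fun a => -(M a (σ i) i)) (hM (σ i) i).neg) m).congr fun a => by
        simp only [Matrix.charmatrix_apply_ne _ _ _ h, map_neg]
  · change _ = (Matrix.det (M a).charmatrix).coeff n
    rw [Matrix.det_apply']
    simp

theorem coeff_prod_X_add_C_nonneg {κ : Type*} (s : Finset κ) {c : κ → ℝ} (hc : ∀ i ∈ s, 0 ≤ c i) :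
    ∀ n, 0 ≤ (∏ i ∈ s, (X + C (c i))).coeff n := by
  classical
  induction s using Finset.induction_on with
  | empty => intro n; rw [Finset.prod_empty, coeff_one]; split_ifs <;> norm_num
  | insert i s hi ih =>
    intro n
    have ih' := ih fun j hj => hc j (Finset.mem_insert_of_mem hj)
    have hci := hc i (Finset.mem_insert_self i s)
    rw [Finset.prod_insert hi, add_mul, coeff_add, coeff_C_mul]
    refine add_nonneg ?_ (mul_nonneg hci (ih' n))
    cases n with
    | zero => simp
    | succ n => rw [coeff_X_mul]; exact ih' n

/-- The characteristic polynomial of `-M` is `∏ (X + λ_i)`. If all `λ_i ≥ 0`, its coefficients are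
nonnegative. Conversely, a monic polynomial with nonnegative coefficients has no positive root,
whereas an eigenvalue `λ < 0` would make `-λ` one. -/
theorem posSemidef_iff_coeff_charpoly {M : Matrix ι ι ℂ} (hM : M.IsHermitian) :
    M.PosSemidef ↔ ∀ n ≤ Fintype.card ι, 0 ≤ ((-M).charpoly.coeff n).re := by
  have hE : (-M).charpoly = (∏ i, (X + C (hM.eigenvalues i))).map Complex.ofRealHom := by
    have h1 : (-M).charpoly = ∏ i, (X - C ((-hM.eigenvalues i : ℝ) : ℂ)) := by
      conv_lhs => rw [hM.spectral_theorem, ← map_neg, Unitary.conjStarAlgAut_apply,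
        Matrix.charpoly_mul_comm, ← mul_assoc]
      simp [Matrix.diagonal_neg, Matrix.charpoly_diagonal]
    rw [h1, Polynomial.map_prod]
    simp
  rw [hM.posSemidef_iff_eigenvalues_nonneg]
  constructor
  · intro h n _
    rw [hE, coeff_map]
    exact coeff_prod_X_add_C_nonneg _ (fun i _ => h i) n
  · intro h i
    by_contra! hi
    simp only [Pi.zero_apply] at hi
    set p := ∏ i, (X + C (hM.eigenvalues i)) with hp
    have hmon : p.Monic := monic_prod_of_monic _ _ fun i _ => monic_X_add_C _
    have hdeg : p.natDegree = Fintype.card ι := by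
      rw [hp, natDegree_prod_of_monic _ _ fun i _ => monic_X_add_C _]
      simp
    have hcoeff : ∀ n ≤ Fintype.card ι, 0 ≤ p.coeff n := by
      intro n hn
      have := h n hn
      rw [hE, coeff_map] at this
      exact this
    have hroot : p.eval (-hM.eigenvalues i) = 0 := by
      rw [hp, eval_prod]
      exact Finset.prod_eq_zero (Finset.mem_univ i) (by simp)
    have hpos : 0 < p.eval (-hM.eigenvalues i) := by
      rw [eval_eq_sum_range]
      refine Finset.sum_pos' (fun n hn => ?_) ⟨p.natDegree, by simp, ?_⟩
      · exact mul_nonneg (hcoeff n (by simpa [hdeg, Nat.lt_succ_iff] using hn))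
          (pow_nonneg (by linarith) _)
      · rw [hmon.coeff_natDegree, one_mul]
        exact pow_pos (by linarith) _
    exact hpos.ne' hroot

open Classical in
theorem PolyTime.posSemidef {M : α → Matrix ι ι ℂ} (hM : ∀ i j, ComplexPT fun a => M a i j)
    (hH : ∀ a, (M a).IsHermitian) : PolyTime fun a => decide (M a).PosSemidef := by
  have h := polynomialPT_charpoly (M := fun a => -M a) fun i j => (hM i j).neg
  have hall : ∀ m, PolyTime fun a => decide (∀ n < m, 0 ≤ ((-M a).charpoly.coeff n).re) := by
    intro m
    induction m with
    | zero => exact (PolyTime.const true).of_dat_eq fun a => by simp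
    | succ m ih =>
      refine (ih.and (h m).1.nonneg).of_dat_eq fun a => ?_
      congr 1
      rw [Bool.eq_iff_iff, Bool.and_eq_true, decide_eq_true_iff, decide_eq_true_iff,
        decide_eq_true_iff]
      exact (Nat.forall_lt_succ_right).symm
  refine (hall (Fintype.card ι + 1)).of_dat_eq fun a => ?_
  congr 1
  rw [decide_eq_decide, posSemidef_iff_coeff_charpoly (hH a)]
  simp only [Nat.lt_succ_iff]

end StackProg

namespace QuasiQuantum

open scoped ComplexOrder Matrix

/-! ### The dual basis -/

/-- The entry `√2 e^{2πi/3}` of the dual basis. -/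
noncomputable def sicEntry : ℂ := ⟨-√2 / 2, √2 * √3 / 2⟩

theorem exp_two_pi_div_three : Complex.exp (2 * Real.pi / 3 * Complex.I) = ⟨-1 / 2, √3 / 2⟩ := by
  have h : (2 * Real.pi / 3 * Complex.I : ℂ) = ((Real.pi - Real.pi / 3 : ℝ) : ℂ) * Complex.I := by
    push_cast; ring
  rw [h]
  apply Complex.ext
  · rw [Complex.exp_ofReal_mul_I_re, Real.cos_pi_sub, Real.cos_pi_div_three]; norm_num
  · rw [Complex.exp_ofReal_mul_I_im, Real.sin_pi_sub, Real.sin_pi_div_three]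

theorem exp_four_pi_div_three :
    Complex.exp (4 * Real.pi / 3 * Complex.I) = ⟨-1 / 2, -√3 / 2⟩ := by
  have h : (4 * Real.pi / 3 * Complex.I : ℂ) = ((Real.pi / 3 + Real.pi : ℝ) : ℂ) * Complex.I := by
    push_cast; ring
  rw [h]
  apply Complex.ext
  · rw [Complex.exp_ofReal_mul_I_re, Real.cos_add_pi, Real.cos_pi_div_three]; norm_num
  · rw [Complex.exp_ofReal_mul_I_im, Real.sin_add_pi, Real.sin_pi_div_three]; ring

/-- Up to a factor 1/2, all real and imaginary parts of the entries lie in `ℤ[√2, √3]`; this is what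
makes exact tests possible. -/
theorem sicD_eq (α : Fin 4) : sicD α = ![!![2, 0; 0, -1], !![0, (√2 : ℂ); (√2 : ℂ), 1],
    !![0, star sicEntry; sicEntry, 1], !![0, sicEntry; star sicEntry, 1]] α := by
  have h3 : (√3 : ℝ) ≠ 0 := by positivity
  have e1 : (1 / √3 : ℝ) * (1 / √3) = 1 / 3 := by
    rw [div_mul_div_comm, Real.mul_self_sqrt (by norm_num)]; norm_num
  have e2 : √(2 / 3 : ℝ) * √(2 / 3) = 2 / 3 := Real.mul_self_sqrt (by norm_num)
  have e3 : (1 / √3 : ℝ) * √(2 / 3) = √2 / 3 := by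
    rw [Real.sqrt_div (by norm_num), div_mul_div_comm, Real.mul_self_sqrt (by norm_num), one_mul]
  have e4 : √3 * √3 = (3 : ℝ) := Real.mul_self_sqrt (by norm_num)
  -- From here on `1/√3` and `√(2/3)` enter only through their products `1/3`, `2/3` and `√2/3`.
  generalize hs : (1 / √3 : ℝ) = s at e1 e3
  generalize ht : √(2 / 3 : ℝ) = t at e2 e3
  have key : ∀ i j, sicD α i j = 3 * (sicVector α i * star (sicVector α j)) -
      (1 : Matrix (Fin 2) (Fin 2) ℂ) i j := fun i j => rfl
  ext i j
  rw [key]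
  unfold sicVector
  rw [exp_two_pi_div_three, exp_four_pi_div_three, hs, ht]
  fin_cases α <;> fin_cases i <;> fin_cases j <;> apply Complex.ext <;>
    simp [sicEntry] <;> try norm_num
  all_goals first
    | linear_combination 3 * e1
    | linear_combination 3 * e2
    | linear_combination 3 * e3
    | linear_combination (-3 / 2) * e3
    | linear_combination (3 * √3 / 2) * e3
    | linear_combination (-3 * √3 / 2) * e3
    | linear_combination (3 / 4 + 3 * √3 * √3 / 4) * e2 + 1 / 2 * e4
    | ring1

theorem sicD_isHermitian (α : Fin 4) (i j : Fin 2) : star (sicD α i j) = sicD α j i := by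
  rw [sicD_eq]
  fin_cases α <;> fin_cases i <;> fin_cases j <;> simp

theorem sum_sicD_diag (α : Fin 4) : ∑ i, sicD α i i = 1 := by
  rw [sicD_eq]
  fin_cases α <;> simp; norm_num

theorem norm_sicEntry : ‖sicEntry‖ ≤ 2 := by
  have : ‖sicEntry‖ ^ 2 = 2 := by
    rw [← Complex.normSq_eq_norm_sq, Complex.normSq_apply, sicEntry]
    simp only
    have e2 : √2 * √2 = (2 : ℝ) := Real.mul_self_sqrt (by norm_num)
    have e4 : √3 * √3 = (3 : ℝ) := Real.mul_self_sqrt (by norm_num)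
    linear_combination (1 / 4 + √3 * √3 / 4) * e2 + 1 / 2 * e4
  nlinarith [norm_nonneg sicEntry]

theorem norm_sicD_le (α : Fin 4) (i j : Fin 2) : ‖sicD α i j‖ ≤ 2 := by
  have h2 : √2 ≤ (2 : ℝ) := Real.sqrt_le_iff.2 ⟨by norm_num, by norm_num⟩
  have := norm_sicEntry
  rw [sicD_eq]
  fin_cases α <;> fin_cases i <;> fin_cases j <;> simp <;> first | assumption | norm_num
  all_goals rwa [abs_of_nonneg (Real.sqrt_nonneg _)]

theorem sicF_eq (α : Fin 4) (i j : Fin 2) :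
    sicF α i j = (sicD α i j + (1 : Matrix (Fin 2) (Fin 2) ℂ) i j) / 6 := by
  have h1 : sicF α i j = 1 / 2 * sicProj α i j := rfl
  have h2 : sicD α i j = 3 * sicProj α i j - (1 : Matrix (Fin 2) (Fin 2) ℂ) i j := rfl
  rw [h1, h2]
  ring

/-- Duality: `Tr(F_β D_α) = (3 |⟨ψ_β|ψ_α⟩|² - 1) / 2`, and in a tetrahedron the squared overlap of
two different vectors is `1/3`. The proof evaluates all 16 cases. -/
theorem sum_sicF_mul_sicD (β α : Fin 4) :
    ∑ i, ∑ j, sicF β i j * sicD α j i = if β = α then 1 else 0 := by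
  have e2 : √2 * √2 = (2 : ℝ) := Real.mul_self_sqrt (by norm_num)
  have e4 : √3 * √3 = (3 : ℝ) := Real.mul_self_sqrt (by norm_num)
  simp only [sicF_eq, sicD_eq, Fin.sum_univ_two]
  fin_cases α <;> fin_cases β <;> apply Complex.ext <;>
    simp [sicEntry, -Complex.ofReal_mul] <;> ring_nf <;>
    (try simp only [Real.sq_sqrt (show (0 : ℝ) ≤ 2 by norm_num),
      Real.sq_sqrt (show (0 : ℝ) ≤ 3 by norm_num)]) <;> (try norm_num)

end QuasiQuantum

namespace QuasiQuantum

open scoped ComplexOrder Matrix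

/-! ### Expectation values of products of dual basis elements -/

theorem sum_prod_sicD_diag {κ : Type} [Fintype κ] [DecidableEq κ] (β : κ → Fin 4) :
    ∑ z : κ → Fin 2, ∏ i, sicD (β i) (z i) (z i) = 1 := by
  rw [← Fintype.prod_sum (fun i a => sicD (β i) a a)]
  exact Finset.prod_eq_one fun i _ => sum_sicD_diag _

theorem multiD_apply {n : ℕ} (α : Fin n → Fin 4) (x y : Fin n → Fin 2) :
    multiD α x y = ∏ i, sicD (α i) (x i) (y i) := rfl

/-- Each factor has trace one, so the factors that are traced out disappear. -/
theorem marginal_multiD {n : ℕ} (I : Finset (Fin n)) (α : Fin n → Fin 4) (x y : I → Fin 2) :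
    marginal I (multiD α) x y = ∏ i : I, sicD (α i) (x i) (y i) := by
  have key : ∀ z : {i : Fin n // i ∉ I} → Fin 2, multiD α (glue I x z) (glue I y z) =
      (∏ i : I, sicD (α i) (x i) (y i)) *
        ∏ i : {i : Fin n // i ∉ I}, sicD (α i) (z i) (z i) := by
    intro z
    rw [multiD_apply, ← Fintype.prod_subtype_mul_prod_subtype (· ∈ I)]
    congr 1
    · refine Finset.prod_congr (by ext; simp) fun i _ => ?_
      simp [glue, i.2]
    · exact Finset.prod_congr rfl fun i _ => by simp [glue, i.2]
  simp only [marginal, Matrix.of_apply, key]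
  rw [← Finset.mul_sum, sum_prod_sicD_diag (fun i : {i : Fin n // i ∉ I} => α i), mul_one]

theorem trace_multiD {n : ℕ} (α : Fin n → Fin 4) : (multiD α).trace = 1 :=
  sum_prod_sicD_diag α

theorem multiD_isHermitian {n : ℕ} (α : Fin n → Fin 4) : (multiD α).IsHermitian := by
  ext x y
  rw [Matrix.conjTranspose_apply, multiD_apply, multiD_apply, star_prod]
  exact Finset.prod_congr rfl fun i _ => sicD_isHermitian _ _ _

theorem trace_multiF_mul_multiD {n : ℕ} (β α : Fin n → Fin 4) :
    (multiF β * multiD α).trace = if β = α then 1 else 0 := by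
  rw [multiF, tensorOp_mul_trace_sum]
  simp only [multiD_apply, ← Finset.prod_mul_distrib]
  have : ∀ x : Fin n → Fin 2, (∑ y : Fin n → Fin 2,
      ∏ i, sicF (β i) (x i) (y i) * sicD (α i) (y i) (x i)) =
      ∏ i, ∑ b, sicF (β i) (x i) b * sicD (α i) b (x i) := fun x =>
    (Fintype.prod_sum fun i b => sicF (β i) (x i) b * sicD (α i) b (x i)).symm
  simp only [this]
  rw [← Fintype.prod_sum fun i a => ∑ b, sicF (β i) a b * sicD (α i) b a]
  simp only [sum_sicF_mul_sicD]
  by_cases h : β = α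
  · simp [h]
  · obtain ⟨i, hi⟩ := Function.ne_iff.1 h
    rw [if_neg h]
    exact Finset.prod_eq_zero (Finset.mem_univ i) (if_neg hi)

/-- The decomposition of the basis vectors into the part on the given qubits and the rest. -/
noncomputable def splitSites {n k : ℕ} (s : Fin k ↪ Fin n) :
    (Fin n → Fin 2) ≃ (Fin k → Fin 2) × ({i // i ∉ Set.range s} → Fin 2) :=
  open Classical in
  (Equiv.piEquivPiSubtypeProd (· ∈ Set.range s) fun _ => Fin 2).trans
    (Equiv.prodCongr ((Equiv.ofInjective s s.injective).arrowCongr (Equiv.refl _)).symm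
      (Equiv.refl _))

theorem splitSites_apply {n k : ℕ} (s : Fin k ↪ Fin n) (x : Fin n → Fin 2) :
    splitSites s x = (fun j => x (s j), fun i : {i // i ∉ Set.range s} => x i) := rfl

section
variable {n k : ℕ} (s : Fin k ↪ Fin n) (u : Fin k → Fin 2) (z : {i // i ∉ Set.range s} → Fin 2)

theorem splitSites_symm_site (j : Fin k) : (splitSites s).symm (u, z) (s j) = u j := by
  have h := (splitSites s).apply_symm_apply (u, z)
  rw [splitSites_apply] at h
  exact congrFun (congrArg Prod.fst h) j

theorem splitSites_symm_rest (i : {i // i ∉ Set.range s}) :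
    (splitSites s).symm (u, z) i = z i := by
  have h := (splitSites s).apply_symm_apply (u, z)
  rw [splitSites_apply] at h
  exact congrFun (congrArg Prod.snd h) i

end

theorem LocalTerm.op_split {n k : ℕ} (h : LocalTerm n k) (u v : Fin k → Fin 2)
    (z w : {i // i ∉ Set.range h.sites} → Fin 2) [Decidable (z = w)] :
    h.op ((splitSites h.sites).symm (u, z)) ((splitSites h.sites).symm (v, w)) =
      if z = w then h.localOp u v else 0 := by
  classical
  have hiff : (∀ i, i ∉ Set.range h.sites → (splitSites h.sites).symm (u, z) i =
      (splitSites h.sites).symm (v, w) i) ↔ z = w := by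
    constructor
    · intro hi
      funext i
      have := hi i i.2
      rwa [splitSites_symm_rest, splitSites_symm_rest] at this
    · rintro rfl i hi
      rw [splitSites_symm_rest h.sites u z ⟨i, hi⟩, splitSites_symm_rest h.sites v z ⟨i, hi⟩]
  simp only [LocalTerm.op, Matrix.of_apply, splitSites_symm_site, hiff]

/-- The expectation value of `ĥ` in the product of the dual basis elements on its qubits. -/
noncomputable def LocalTerm.expect {n k : ℕ} (h : LocalTerm n k) (α : Fin n → Fin 4) : ℂ :=
  ∑ x, ∑ y, h.localOp x y * ∏ j, sicD (α (h.sites j)) (y j) (x j)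

/-- The basis vectors are split into the sites of the term and the rest. Off the sites the identity
forces equal indices, and there the trace-one factors sum up to one. -/
theorem LocalTerm.trace_op_mul_multiD {n k : ℕ} (h : LocalTerm n k) (α : Fin n → Fin 4) :
    (h.op * multiD α).trace = h.expect α := by
  classical
  have h1 : (h.op * multiD α).trace = ∑ x, ∑ y, h.op x y * multiD α y x := rfl
  have hD : ∀ u v (z w : {i // i ∉ Set.range h.sites} → Fin 2),
      multiD α ((splitSites h.sites).symm (v, w)) ((splitSites h.sites).symm (u, z)) =
      (∏ j, sicD (α (h.sites j)) (v j) (u j)) *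
        ∏ i : {i // i ∉ Set.range h.sites}, sicD (α i) (w i) (z i) := by
    intro u v z w
    rw [multiD_apply, ← Fintype.prod_subtype_mul_prod_subtype (· ∈ Set.range h.sites)]
    congr 1
    · let e : Fin k ≃ {i // i ∈ Set.range h.sites} := Equiv.ofInjective _ h.sites.injective
      refine (Finset.prod_congr (by ext; simp) fun _ _ => rfl).trans
        (Fintype.prod_equiv e (fun j => sicD (α (h.sites j)) (v j) (u j)) (fun i => sicD (α i)
          ((splitSites h.sites).symm (v, w) i) ((splitSites h.sites).symm (u, z) i))
        fun j => ?_).symm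
      rw [show (e j : Fin n) = h.sites j from rfl, splitSites_symm_site, splitSites_symm_site]
    · exact Finset.prod_congr rfl fun i _ => by rw [splitSites_symm_rest, splitSites_symm_rest]
  rw [h1, ← (splitSites h.sites).symm.sum_comp, Fintype.sum_prod_type, LocalTerm.expect]
  refine Finset.sum_congr rfl fun u _ => ?_
  have h2 : ∀ z, ∑ y, h.op ((splitSites h.sites).symm (u, z)) y *
      multiD α y ((splitSites h.sites).symm (u, z)) = ∑ v, h.localOp u v *
      (∏ j, sicD (α (h.sites j)) (v j) (u j)) *
        ∏ i : {i // i ∉ Set.range h.sites}, sicD (α i) (z i) (z i) := by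
    intro z
    rw [← (splitSites h.sites).symm.sum_comp, Fintype.sum_prod_type]
    refine Finset.sum_congr rfl fun v _ => ?_
    rw [Finset.sum_eq_single z]
    · rw [h.op_split, if_pos rfl, hD, mul_assoc]
    · intro w _ hw
      rw [h.op_split, if_neg (Ne.symm hw), zero_mul]
    · simp
  simp only [h2]
  rw [Finset.sum_comm]
  refine Finset.sum_congr rfl fun v _ => ?_
  rw [← Finset.mul_sum, sum_prod_sicD_diag (fun i : {i // i ∉ Set.range h.sites} => α i), mul_one]

/-- The sum of the absolute values of the real and imaginary parts of the entries of `ĥ`. -/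
def LocalTerm.absSum {n k : ℕ} (h : LocalTerm n k) : ℚ := ∑ x, ∑ y, (|h.re x y| + |h.im x y|)

theorem norm_prod_sicD_le {κ : Type} [Fintype κ] (β : κ → Fin 4) (x y : κ → Fin 2) :
    ‖∏ j, sicD (β j) (x j) (y j)‖ ≤ 2 ^ Fintype.card κ := by
  rw [norm_prod]
  calc ∏ j, ‖sicD (β j) (x j) (y j)‖ ≤ ∏ _j : κ, (2 : ℝ) :=
        Finset.prod_le_prod (fun _ _ => norm_nonneg _) fun j _ => norm_sicD_le _ _ _
    _ = 2 ^ Fintype.card κ := by simp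

theorem LocalTerm.norm_localOp_le {n k : ℕ} (h : LocalTerm n k) (x y : Fin k → Fin 2) :
    ‖h.localOp x y‖ ≤ |(h.re x y : ℝ)| + |(h.im x y : ℝ)| := by
  refine (Complex.norm_le_abs_re_add_abs_im _).trans_eq ?_
  simp [LocalTerm.localOp]

theorem LocalTerm.norm_expect_le {n k : ℕ} (h : LocalTerm n k) (α : Fin n → Fin 4) :
    ‖h.expect α‖ ≤ 2 ^ k * h.absSum := by
  rw [LocalTerm.expect, LocalTerm.absSum]
  push_cast
  rw [Finset.mul_sum]
  refine (norm_sum_le _ _).trans (Finset.sum_le_sum fun x _ => ?_)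
  rw [Finset.mul_sum]
  refine (norm_sum_le _ _).trans (Finset.sum_le_sum fun y _ => ?_)
  rw [norm_mul, mul_comm]
  have := norm_prod_sicD_le (fun j => α (h.sites j)) y x
  rw [Fintype.card_fin] at this
  exact mul_le_mul this (h.norm_localOp_le x y) (norm_nonneg _) (by positivity)

/-! ### Operator norms and entries -/

section opNorm
variable {ι : Type} [Fintype ι] [DecidableEq ι]

theorem norm_entry_le_opNorm (A : Matrix ι ι ℂ) (i j : ι) : ‖A i j‖ ≤ opNorm A := by
  have h1 := (Matrix.toEuclideanCLM (n := ι) (𝕜 := ℂ) A).le_opNorm (EuclideanSpace.single j 1)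
  rw [PiLp.norm_single, norm_one, mul_one] at h1
  have h2 : (Matrix.toEuclideanCLM (n := ι) (𝕜 := ℂ) A (EuclideanSpace.single j 1)) i = A i j := by
    simp [EuclideanSpace.single]
  rw [← h2]
  exact (PiLp.norm_apply_le _ i).trans h1

theorem opNorm_le_sum_norm (A : Matrix ι ι ℂ) : opNorm A ≤ ∑ i, ∑ j, ‖A i j‖ := by
  refine ContinuousLinearMap.opNorm_le_bound _ (by positivity) fun v => ?_
  set w := Matrix.toEuclideanCLM (n := ι) (𝕜 := ℂ) A v with hw
  have h1 : ‖w‖ ≤ ∑ i, ‖w i‖ := by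
    rw [EuclideanSpace.norm_eq]
    refine Real.sqrt_le_iff.2 ⟨by positivity, ?_⟩
    exact Finset.sum_sq_le_sq_sum_of_nonneg fun i _ => norm_nonneg _
  refine h1.trans ?_
  rw [Finset.sum_mul]
  refine Finset.sum_le_sum fun i _ => ?_
  have h2 : w i = ∑ j, A i j * v j := by
    rw [hw]; rfl
  rw [h2, Finset.sum_mul]
  refine (norm_sum_le _ _).trans (Finset.sum_le_sum fun j _ => ?_)
  rw [norm_mul]
  exact mul_le_mul_of_nonneg_left (PiLp.norm_apply_le v j) (norm_nonneg _)

/-- Every entry of `ĥ` is also an entry of `h`, hence bounded by the operator norm; there are `4^k`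
entries with two parts each. The verifier can thus use the rational `absSum` in place of the norm.
-/
theorem LocalTerm.absSum_le {n k : ℕ} (h : LocalTerm n k) :
    (h.absSum : ℝ) ≤ 2 * 4 ^ k * opNorm h.op := by
  have key : ∀ x y, |(h.re x y : ℝ)| + |(h.im x y : ℝ)| ≤ 2 * opNorm h.op := by
    classical
    intro x y
    have h1 := norm_entry_le_opNorm h.op ((splitSites h.sites).symm (x, fun _ => 0))
      ((splitSites h.sites).symm (y, fun _ => 0))
    rw [h.op_split, if_pos rfl] at h1
    have h2 : (h.localOp x y).re = h.re x y := by simp [LocalTerm.localOp]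
    have h3 : (h.localOp x y).im = h.im x y := by simp [LocalTerm.localOp]
    rw [← h2, ← h3]
    have := Complex.abs_re_le_norm (h.localOp x y)
    have := Complex.abs_im_le_norm (h.localOp x y)
    linarith
  rw [LocalTerm.absSum]
  push_cast
  refine (Finset.sum_le_sum fun x _ => Finset.sum_le_sum fun y _ => key x y).trans_eq ?_
  simp only [Finset.sum_const, Finset.card_univ, Fintype.card_fun, Fintype.card_fin, nsmul_eq_mul]
  push_cast
  rw [show (4 : ℝ) = 2 * 2 by norm_num, mul_pow]
  ring

/-- The quadratic form of `B` is at least `-(∑ |B i j|) ‖x‖²`, since `|x_i| |x_j| ≤ ‖x‖²` for all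
pairs. -/
theorem posSemidef_add_of_sum_norm_le {P B : Matrix ι ι ℂ} {ε : ℝ} (hP : P.PosSemidef)
    (hB : B.IsHermitian) (h : ∑ i, ∑ j, ‖B i j‖ ≤ ε) : (P + B + (ε : ℂ) • 1).PosSemidef := by
  rw [add_assoc]
  refine hP.add ?_
  have hH : (B + (ε : ℂ) • (1 : Matrix ι ι ℂ)).IsHermitian := by
    refine hB.add ?_
    rw [Matrix.IsHermitian, Matrix.conjTranspose_smul, Matrix.conjTranspose_one]
    simp
  refine Matrix.PosSemidef.of_dotProduct_mulVec_nonneg hH fun x => ?_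
  have hre := hH.im_star_dotProduct_mulVec_self x
  rw [Complex.nonneg_iff]
  refine ⟨?_, hre.symm⟩
  have e1 : star x ⬝ᵥ ((B + (ε : ℂ) • (1 : Matrix ι ι ℂ)) *ᵥ x) =
      (∑ i, ∑ j, star (x i) * (B i j * x j)) + ((ε * ∑ i, ‖x i‖ ^ 2 : ℝ) : ℂ) := by
    rw [Matrix.add_mulVec, dotProduct_add, Matrix.smul_mulVec, Matrix.one_mulVec, dotProduct_smul]
    congr 1
    · simp only [dotProduct, Matrix.mulVec, Finset.mul_sum, Pi.star_apply]
    · simp only [dotProduct, Pi.star_apply, smul_eq_mul]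
      push_cast
      congr 1
      exact Finset.sum_congr rfl fun i _ => by
        rw [← Complex.conj_mul']; rfl
  rw [e1, Complex.add_re, Complex.ofReal_re]
  have e2 : ‖∑ i, ∑ j, star (x i) * (B i j * x j)‖ ≤ (∑ i, ∑ j, ‖B i j‖) * ∑ i, ‖x i‖ ^ 2 := by
    rw [Finset.sum_mul]
    refine (norm_sum_le _ _).trans (Finset.sum_le_sum fun i _ => ?_)
    rw [Finset.sum_mul]
    refine (norm_sum_le _ _).trans (Finset.sum_le_sum fun j _ => ?_)
    rw [norm_mul, norm_mul, norm_star]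
    have hi := Finset.single_le_sum (f := fun i => ‖x i‖ ^ 2) (fun i _ => by positivity)
      (Finset.mem_univ i)
    have hj := Finset.single_le_sum (f := fun i => ‖x i‖ ^ 2) (fun i _ => by positivity)
      (Finset.mem_univ j)
    have : ‖x i‖ * ‖x j‖ ≤ ∑ i, ‖x i‖ ^ 2 := by
      nlinarith [sq_nonneg (‖x i‖ - ‖x j‖)]
    calc ‖x i‖ * (‖B i j‖ * ‖x j‖) = ‖B i j‖ * (‖x i‖ * ‖x j‖) := by ring
      _ ≤ _ := mul_le_mul_of_nonneg_left this (norm_nonneg _)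
  have e3 := (abs_le.1 (Complex.abs_re_le_norm (∑ i, ∑ j, star (x i) * (B i j * x j)))).1
  have e4 : (∑ i, ∑ j, ‖B i j‖) * ∑ i, ‖x i‖ ^ 2 ≤ ε * ∑ i, ‖x i‖ ^ 2 :=
    mul_le_mul_of_nonneg_right h (by positivity)
  linarith

end opNorm

end QuasiQuantum

namespace QuasiQuantum

open scoped ComplexOrder Matrix

/-! ### Quasi-quantum states as distributions -/

section opOfDist
variable {n k : ℕ} (μ ν : (Fin n → Fin 4) → ℝ)

theorem marginal_opOfDist (I : Finset (Fin n)) (x y : I → Fin 2) :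
    marginal I (opOfDist μ) x y = ∑ α, (μ α : ℂ) * ∏ i : I, sicD (α i) (x i) (y i) := by
  simp only [← marginal_multiD]
  simp only [marginal, opOfDist, Matrix.of_apply, Matrix.sum_apply, Matrix.smul_apply, smul_eq_mul,
    Finset.mul_sum]
  exact Finset.sum_comm

theorem trace_opOfDist : (opOfDist μ).trace = ((∑ α, μ α : ℝ) : ℂ) := by
  simp [opOfDist, Matrix.trace_sum, Matrix.trace_smul, trace_multiD]

theorem trace_multiF_mul_opOfDist (β : Fin n → Fin 4) : (multiF β * opOfDist μ).trace = μ β := by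
  simp [opOfDist, Matrix.mul_sum, Matrix.trace_sum, Matrix.trace_smul, trace_multiF_mul_multiD]

theorem opOfDist_isHermitian : (opOfDist μ).IsHermitian := by
  rw [Matrix.IsHermitian, opOfDist, Matrix.conjTranspose_sum]
  refine Finset.sum_congr rfl fun α _ => ?_
  rw [Matrix.conjTranspose_smul, (multiD_isHermitian α).eq]
  simp

theorem marginal_isHermitian {X : QubitOp n} (hX : X.IsHermitian) (I : Finset (Fin n)) :
    (marginal I X).IsHermitian := by
  ext x y
  simp only [marginal, Matrix.conjTranspose_apply, Matrix.of_apply, star_sum]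
  exact Finset.sum_congr rfl fun z _ => hX.apply _ _

variable {μ} in
theorem isQQState_opOfDist (h0 : ∀ α, 0 ≤ μ α) (h1 : ∑ α, μ α = 1)
    (hl : ∀ I : Finset (Fin n), I.card = k → (marginal I (opOfDist μ)).PosSemidef) :
    IsQQState k (opOfDist μ) where
  trace_eq_one := by rw [trace_opOfDist, h1, Complex.ofReal_one]
  isHermitian := opOfDist_isHermitian μ
  global_pos α := by
    rw [trace_multiF_mul_opOfDist]
    exact_mod_cast h0 α
  local_pos := hl

/-- The distribution is `μ(α) = Tr(F_α X)`. By duality `X(μ)` has the same numbers `Tr(F_α ·)` as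
`X`, and these determine an operator. -/
theorem IsQQState.exists_eq_opOfDist {X : QubitOp n} (hX : IsQQState k X) :
    ∃ μ : (Fin n → Fin 4) → ℝ, (∀ α, 0 ≤ μ α) ∧ ∑ α, μ α = 1 ∧ opOfDist μ = X := by
  have hre : ∀ α, (((multiF α * X).trace.re : ℝ) : ℂ) = (multiF α * X).trace := fun α =>
    (Complex.eq_re_of_ofReal_le (hX.global_pos α)).symm
  have hμ : opOfDist (fun α => (multiF α * X).trace.re) = X := by
    rw [← sub_eq_zero]
    refine eq_zero_of_trace_multiF _ fun α => ?_
    rw [Matrix.mul_sub, Matrix.trace_sub, trace_multiF_mul_opOfDist, hre, sub_self]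
  refine ⟨_, fun α => (Complex.le_def.1 (hX.global_pos α)).1, ?_, hμ⟩
  have := hX.trace_eq_one
  rw [← hμ, trace_opOfDist] at this
  exact_mod_cast this

variable {μ ν} in
-- The constant is `8^k = 4^k · 2^k`: the number of entries of a marginal times the bound on an
-- entry of a product of `k` dual basis elements.
theorem sum_norm_marginal_sub_le {I : Finset (Fin n)} (hI : I.card = k) :
    ∑ x, ∑ y, ‖(marginal I (opOfDist μ) - marginal I (opOfDist ν)) x y‖ ≤
      8 ^ k * ∑ α, |μ α - ν α| := by
  have key : ∀ x y, ‖(marginal I (opOfDist μ) - marginal I (opOfDist ν)) x y‖ ≤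
      2 ^ k * ∑ α, |μ α - ν α| := by
    intro x y
    rw [Matrix.sub_apply, marginal_opOfDist, marginal_opOfDist, ← Finset.sum_sub_distrib,
      Finset.mul_sum]
    refine (norm_sum_le _ _).trans (Finset.sum_le_sum fun α _ => ?_)
    rw [← sub_mul, norm_mul, ← Complex.ofReal_sub, Complex.norm_real, Real.norm_eq_abs, mul_comm]
    have := norm_prod_sicD_le (fun i : I => α i) x y
    rw [Fintype.card_coe, hI] at this
    exact mul_le_mul_of_nonneg_right this (abs_nonneg _)
  refine (Finset.sum_le_sum fun x _ => Finset.sum_le_sum fun y _ => key x y).trans_eq ?_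
  simp only [Finset.sum_const, Finset.card_univ, Fintype.card_fun, Fintype.card_fin, nsmul_eq_mul,
    Fintype.card_coe, hI]
  push_cast
  rw [show (8 : ℝ) = 2 * 2 * 2 by norm_num, mul_pow, mul_pow]
  ring

end opOfDist

namespace Instance
variable {k : ℕ} (x : Instance k)

/-- The energy of `D_α`. -/
noncomputable def energyAt (α : Fin x.n → Fin 4) : ℝ := (x.terms.map fun h => (h.expect α).re).sum

/-- The sum of the absolute values of the real and imaginary parts of the entries of all the
terms. -/
def absSum : ℚ := (x.terms.map fun h => h.absSum).sum

theorem absSum_nonneg : 0 ≤ x.absSum := by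
  refine List.sum_nonneg fun q hq => ?_
  obtain ⟨h, -, rfl⟩ := List.mem_map.1 hq
  exact Finset.sum_nonneg fun _ _ => Finset.sum_nonneg fun _ _ => by positivity

theorem absSum_le : (x.absSum : ℝ) ≤ 2 * 4 ^ k * x.scale := by
  rw [absSum, scale]
  induction x.terms with
  | nil => simp
  | cons h l ih =>
    simp only [List.map_cons, List.sum_cons]
    rw [Rat.cast_add]
    have := h.absSum_le
    linarith

theorem energy_sum_smul {ι : Type*} (s : Finset ι) (c : ι → ℝ) (X : ι → QubitOp x.n) :
    x.energy (∑ i ∈ s, (c i : ℂ) • X i) = ∑ i ∈ s, c i * x.energy (X i) := by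
  simp [energy, Matrix.mul_sum, Matrix.trace_sum, Matrix.trace_smul]

theorem energy_multiD (α : Fin x.n → Fin 4) : x.energy (multiD α) = x.energyAt α := by
  rw [energy, hamiltonian, energyAt]
  induction x.terms with
  | nil => simp
  | cons h l ih =>
    simp only [List.map_cons, List.sum_cons, Matrix.add_mul, Matrix.trace_add, Complex.add_re, ih,
      h.trace_op_mul_multiD]

theorem energy_opOfDist (μ : (Fin x.n → Fin 4) → ℝ) :
    x.energy (opOfDist μ) = ∑ α, μ α * x.energyAt α := by
  simp only [opOfDist, energy_sum_smul, energy_multiD]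

theorem abs_energyAt_le (α : Fin x.n → Fin 4) : |x.energyAt α| ≤ 2 ^ k * x.absSum := by
  rw [energyAt, absSum]
  induction x.terms with
  | nil => simp
  | cons h l ih =>
    simp only [List.map_cons, List.sum_cons]
    rw [Rat.cast_add]
    have h1 := (Complex.abs_re_le_norm _).trans (h.norm_expect_le α)
    refine (abs_add_le _ _).trans ?_
    linarith

theorem abs_energy_sub_le (μ ν : (Fin x.n → Fin 4) → ℝ) :
    |x.energy (opOfDist μ) - x.energy (opOfDist ν)| ≤
      2 ^ k * x.absSum * ∑ α, |μ α - ν α| := by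
  rw [energy_opOfDist, energy_opOfDist, ← Finset.sum_sub_distrib, Finset.mul_sum]
  refine (Finset.abs_sum_le_sum_abs _ _).trans (Finset.sum_le_sum fun α _ => ?_)
  rw [← sub_mul, abs_mul, mul_comm]
  exact mul_le_mul_of_nonneg_right (x.abs_energyAt_le α) (abs_nonneg _)

theorem abs_energy_le {μ : (Fin x.n → Fin 4) → ℝ} (h0 : ∀ α, 0 ≤ μ α) (h1 : ∑ α, μ α = 1) :
    |x.energy (opOfDist μ)| ≤ 2 ^ k * x.absSum := by
  have h := x.abs_energy_sub_le μ 0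
  have hz : x.energy (opOfDist 0) = 0 := by simp [energy_opOfDist]
  simpa [hz, abs_of_nonneg (h0 _), h1] using h

end Instance

/-! ### Sparse distributions with given local marginals -/

/-- The two distributions have the same marginals on all sets of `k` qubits. -/
def SameMarginals {n : ℕ} (k : ℕ) (μ ν : (Fin n → Fin 4) → ℝ) : Prop :=
  ∀ I : Finset (Fin n), I.card = k → ∀ f : (I → Fin 4) → ℂ,
    ∑ α, (μ α : ℂ) * f (fun i => α i) = ∑ α, (ν α : ℂ) * f (fun i => α i)

theorem SameMarginals.marginal_eq {n k : ℕ} {μ ν : (Fin n → Fin 4) → ℝ}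
    (h : SameMarginals k μ ν) {I : Finset (Fin n)} (hI : I.card = k) :
    marginal I (opOfDist μ) = marginal I (opOfDist ν) := by
  ext x y
  rw [marginal_opOfDist, marginal_opOfDist]
  exact h I hI fun β => ∏ i, sicD (β i) (x i) (y i)

theorem SameMarginals.sum_expect {n k : ℕ} {μ ν : (Fin n → Fin 4) → ℝ} (h : SameMarginals k μ ν)
    (t : LocalTerm n k) : ∑ α, (μ α : ℂ) * t.expect α = ∑ α, (ν α : ℂ) * t.expect α := by
  have hI : (Finset.univ.map t.sites).card = k := by simp
  exact h _ hI fun β => ∑ x, ∑ y, t.localOp x y *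
    ∏ j, sicD (β ⟨t.sites j, Finset.mem_map_of_mem _ (Finset.mem_univ j)⟩) (y j) (x j)

theorem SameMarginals.energy_eq {k : ℕ} {x : Instance k} {μ ν : (Fin x.n → Fin 4) → ℝ}
    (h : SameMarginals k μ ν) : x.energy (opOfDist μ) = x.energy (opOfDist ν) := by
  rw [x.energy_opOfDist, x.energy_opOfDist]
  simp only [Instance.energyAt]
  induction x.terms with
  | nil => simp
  | cons t l ih =>
    simp only [List.map_cons, List.sum_cons, mul_add, Finset.sum_add_distrib, ih]
    have := congrArg Complex.re (h.sum_expect t)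
    simp only [Complex.re_sum, Complex.re_ofReal_mul] at this
    rw [this]

/-- Carathéodory: a string is sent to the indicator vector of its restrictions to all `k`-sets, and
`μ` becomes a convex combination of such vectors in dimension `binom(n,k) 4^k`. An affinely
independent subfamily carries the same point and has at most one member more than the dimension. -/
theorem exists_sparse_sameMarginals {n : ℕ} (k : ℕ) {μ : (Fin n → Fin 4) → ℝ}
    (h0 : ∀ α, 0 ≤ μ α) (h1 : ∑ α, μ α = 1) :
    ∃ ν : (Fin n → Fin 4) → ℝ, (∀ α, 0 ≤ ν α) ∧ ∑ α, ν α = 1 ∧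
      (Function.support ν).ncard ≤ n.choose k * 4 ^ k + 1 ∧ SameMarginals k ν μ := by
  classical
  let J := (I : {I : Finset (Fin n) // I.card = k}) × (I.1 → Fin 4)
  let v : (Fin n → Fin 4) → J → ℝ := fun α p => if (fun i : p.1.1 => α i) = p.2 then 1 else 0
  have hmem : ∑ α, μ α • v α ∈ convexHull ℝ (Set.range v) :=
    (convex_convexHull ℝ _).sum_mem (fun α _ => h0 α) h1
      fun α _ => subset_convexHull ℝ _ (Set.mem_range_self α)
  obtain ⟨ι, _, z, w, hz, hind, hw, hw1, hsum⟩ := eq_pos_convex_span_of_mem_convexHull hmem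
  choose a ha using fun i => hz (Set.mem_range_self i)
  have hJ : Module.finrank ℝ (J → ℝ) = n.choose k * 4 ^ k := by
    rw [Module.finrank_fintype_fun_eq_card, Fintype.card_sigma]
    have : ∀ I : {I : Finset (Fin n) // I.card = k}, Fintype.card (I.1 → Fin 4) = 4 ^ k := by
      intro I; simp [I.2]
    simp only [this, Finset.sum_const, Finset.card_univ, smul_eq_mul]
    congr 1
    rw [Fintype.card_finset_len, Fintype.card_fin]
  have hι : Fintype.card ι ≤ n.choose k * 4 ^ k + 1 := by
    rw [← hJ]
    exact hind.card_le_finrank_succ.trans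
      (Nat.succ_le_succ (Submodule.finrank_le _))
  have hν : ∀ f : (Fin n → Fin 4) → ℂ,
      ∑ α, ((∑ i, if a i = α then w i else 0 : ℝ) : ℂ) * f α = ∑ i, (w i : ℂ) * f (a i) := by
    intro f
    simp only [Complex.ofReal_sum, Finset.sum_mul]
    rw [Finset.sum_comm]
    refine Finset.sum_congr rfl fun i _ => ?_
    rw [Finset.sum_eq_single (a i)] <;> simp +contextual [eq_comm]
  refine ⟨fun α => ∑ i, if a i = α then w i else 0, fun α => Finset.sum_nonneg fun i _ => ?_,
    ?_, ?_, ?_⟩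
  · split_ifs
    exacts [(hw i).le, le_rfl]
  · rw [Finset.sum_comm]
    simpa using hw1
  · refine le_trans ?_ hι
    calc _ ≤ (Set.range a).ncard := by
          refine Set.ncard_le_ncard (fun α hα => ?_) (Set.toFinite _)
          obtain ⟨i, -, hi⟩ := Finset.exists_ne_zero_of_sum_ne_zero hα
          exact ⟨i, by by_contra h; exact hi (if_neg h)⟩
      _ ≤ Fintype.card ι := by
          rw [← Set.image_univ]
          refine (Set.ncard_image_le Set.finite_univ).trans ?_
          rw [Set.ncard_univ, Nat.card_eq_fintype_card]
  · intro I hI f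
    have hβ : ∀ β : I → Fin 4, (∑ i, (w i : ℂ) * if (fun j : I => a i j) = β then 1 else 0) =
        ∑ α, (μ α : ℂ) * if (fun j : I => α j) = β then 1 else 0 := by
      intro β
      have := congrFun hsum ⟨⟨I, hI⟩, β⟩
      simp only [Finset.sum_apply, Pi.smul_apply, ← ha, smul_eq_mul, v] at this
      have := congrArg ((↑) : ℝ → ℂ) this
      simpa only [Complex.ofReal_sum, Complex.ofReal_mul, apply_ite Complex.ofReal,
        Complex.ofReal_one, Complex.ofReal_zero] using this
    -- Equality for the indicators of single restrictions extends to every `f` by linearity.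
    have hf : ∀ α : Fin n → Fin 4, f (fun j => α j) =
        ∑ β, (if (fun j : I => α j) = β then 1 else 0) * f β := by
      intro α; simp
    rw [hν fun α => f fun j => α j]
    simp only [hf, Finset.mul_sum]
    rw [Finset.sum_comm, Finset.sum_comm (s := (Finset.univ : Finset (Fin n → Fin 4)))]
    refine Finset.sum_congr rfl fun β _ => ?_
    simp only [← mul_assoc, ← Finset.sum_mul]
    rw [hβ]

/-- Rounding a distribution to a multiple of `1 / N`. -/
theorem exists_nat_weights {A : Type*} [Fintype A] {ν : A → ℝ} (h0 : ∀ a, 0 ≤ ν a)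
    (h1 : ∑ a, ν a = 1) {m N : ℕ} (hm : (Function.support ν).ncard ≤ m) (hN : m < N) :
    ∃ w : A → ℕ, (∀ a, w a ≠ 0 → ν a ≠ 0) ∧ (∀ a, w a ≤ N) ∧ 0 < ∑ a, w a ∧
      ∑ a, |(w a : ℝ) / (∑ a, w a : ℕ) - ν a| ≤ 2 * m / N := by
  classical
  have hN0 : (0 : ℝ) < N := by exact_mod_cast (Nat.zero_le m).trans_lt hN
  -- Rounding down loses at most 1 at each point of the support and nothing elsewhere. The total
  -- weight therefore lies between `N - m` and `N`, and it is positive because `m < N`.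
  let w : A → ℕ := fun a => ⌊ν a * N⌋₊
  have hwle : ∀ a, (w a : ℝ) ≤ ν a * N := fun a => Nat.floor_le (by have := h0 a; positivity)
  have hwge : ∀ a, ν a * N - w a ≤ if ν a = 0 then 0 else 1 := by
    intro a
    split_ifs with h
    · simp [h]
    · have := Nat.lt_floor_add_one (ν a * N)
      simp only [w]; linarith
  have hcard : ∑ a, (if ν a = 0 then (0 : ℝ) else 1) ≤ m := by
    have : ∑ a, (if ν a = 0 then (0 : ℝ) else 1) = (Function.support ν).ncard := by
      rw [show Function.support ν = ((Finset.univ.filter fun a => ν a ≠ 0 : Finset A) : Set A) by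
        ext; simp, Set.ncard_coe_finset, Finset.card_filter]
      push_cast
      simp only [ne_eq, ite_not]
    rw [this]; exact_mod_cast hm
  have hdef : ∑ a, (ν a * N - w a) ≤ m := (Finset.sum_le_sum fun a _ => hwge a).trans hcard
  have hT : (N : ℝ) - m ≤ (∑ a, w a : ℕ) := by
    rw [Finset.sum_sub_distrib, ← Finset.sum_mul, h1] at hdef
    push_cast
    linarith
  have hT' : ((∑ a, w a : ℕ) : ℝ) ≤ N := by
    push_cast
    calc ∑ a, (w a : ℝ) ≤ ∑ a, ν a * N := Finset.sum_le_sum fun a _ => hwle a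
      _ = N := by rw [← Finset.sum_mul, h1, one_mul]
  have hTpos : (0 : ℝ) < (∑ a, w a : ℕ) := by
    have : (m : ℝ) < N := by exact_mod_cast hN
    linarith
  refine ⟨w, fun a ha h => ha (by simp [w, h]), fun a => ?_, by exact_mod_cast hTpos, ?_⟩
  · have hle : ν a ≤ 1 := by
      rw [← h1]; exact Finset.single_le_sum (fun b _ => h0 b) (Finset.mem_univ a)
    have : (w a : ℝ) ≤ N := (hwle a).trans (mul_le_of_le_one_left hN0.le hle)
    exact_mod_cast this
  · set T : ℝ := ((∑ a, w a : ℕ) : ℝ) with hTd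
    have hTs : ∑ a, (w a : ℝ) = T := by rw [hTd]; push_cast; rfl
    -- One part of the error comes from renormalizing by `T` instead of `N`, the other from rounding
    -- down. Each sums up to `(N - T)/N ≤ m/N`.
    have hterm : ∀ a, |(w a : ℝ) / T - ν a| ≤ w a * (1 / T - 1 / N) + (ν a * N - w a) / N := by
      intro a
      have e : (w a : ℝ) / T - ν a = w a * (1 / T - 1 / N) - (ν a * N - w a) / N := by
        field_simp
        ring
      have p1 : 0 ≤ (w a : ℝ) * (1 / T - 1 / N) :=
        mul_nonneg (by positivity) (sub_nonneg.2 (one_div_le_one_div_of_le hTpos hT'))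
      have p2 : 0 ≤ (ν a * N - w a) / N := div_nonneg (sub_nonneg.2 (hwle a)) hN0.le
      rw [e, abs_le]
      constructor <;> linarith
    refine (Finset.sum_le_sum fun a _ => hterm a).trans ?_
    rw [Finset.sum_add_distrib, ← Finset.sum_mul, ← Finset.sum_div, hTs]
    have e : T * (1 / T - 1 / N) = (N - T) / N := by field_simp
    rw [e, ← add_div]
    exact div_le_div_of_nonneg_right (by linarith) hN0.le

end QuasiQuantum

namespace QuasiQuantum

open scoped ComplexOrder Matrix

open Computability (encodeNat)

/-! ### Binary digits -/

theorem encodePosNum_eq_bits (p : PosNum) : Computability.encodePosNum p = (p : ℕ).bits := by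
  induction p with
  | one => simp [Computability.encodePosNum]
  | bit0 p ih =>
    rw [Computability.encodePosNum, ih, PosNum.cast_bit0, ← two_mul,
      Nat.bit0_bits _ (PosNum.cast_pos p).ne']
  | bit1 p ih => rw [Computability.encodePosNum, ih, PosNum.cast_bit1, ← two_mul, Nat.bit1_bits]

theorem encodeNat_eq_bits (m : ℕ) : encodeNat m = m.bits := by
  rw [encodeNat]
  conv_rhs => rw [← Num.to_of_nat m]
  cases (m : Num) with
  | zero => simp [Computability.encodeNum]
  | pos p => exact encodePosNum_eq_bits p

theorem length_encodeNat_le {m M : ℕ} (h : m ≤ 2 ^ M) : (encodeNat m).length ≤ M + 1 := by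
  rw [encodeNat_eq_bits, Nat.size_eq_bits_len, Nat.size_le]
  exact h.trans_lt (Nat.pow_lt_pow_right (by norm_num) (Nat.lt_succ_self M))

/-! ### Descriptions of distributions -/

namespace DistDesc
variable {n : ℕ}

theorem length_encode_le (W : DistDesc n) {M : ℕ} (h : ∀ e ∈ W, e.2 ≤ 2 ^ M) :
    W.encode.length ≤ W.length * (2 * n + 2 * M + 4) + 1 := by
  rw [encode, List.length_append, List.length_singleton, List.length_flatMap]
  refine Nat.succ_le_succ ?_
  rw [← smul_eq_mul, ← List.length_map (f := fun e => (true ::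
      ((List.finRange n).flatMap (fun i => [(e.1 i).val.testBit 0, (e.1 i).val.testBit 1]) ++
        (encodeNat e.2).flatMap (fun d => [true, d]) ++ [false])).length)]
  refine List.sum_le_card_nsmul _ _ fun l hl => ?_
  obtain ⟨e, he, rfl⟩ := List.mem_map.1 hl
  have := length_encodeNat_le (h e he)
  simp only [List.length_cons, List.length_append, List.length_flatMap, List.length_nil,
    List.map_const', List.sum_replicate, List.length_finRange, smul_eq_mul]
  omega

theorem dist_nonneg (W : DistDesc n) (α : Fin n → Fin 4) : 0 ≤ W.dist α := by
  rw [dist]; positivity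

/-- Averages over the distribution are sums over the list, even if strings are repeated, so the
verifier never merges items. For total weight zero both sides vanish, as division by zero gives
zero. -/
theorem sum_dist_smul {M : Type*} [AddCommGroup M] [Module ℝ M] (W : DistDesc n)
    (f : (Fin n → Fin 4) → M) :
    ∑ α, W.dist α • f α = (W.total : ℝ)⁻¹ • (W.map fun e => (e.2 : ℝ) • f e.1).sum := by
  simp only [dist, div_eq_inv_mul, mul_smul]
  rw [← Finset.smul_sum]
  congr 1
  generalize W = L
  induction L with
  | nil => simp
  | cons e L ih =>
    simp only [List.map_cons, List.sum_cons, ← ih]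
    have h1 : (e.2 : ℝ) • f e.1 = ∑ α, if e.1 = α then (e.2 : ℝ) • f α else 0 := by simp
    rw [h1, ← Finset.sum_add_distrib]
    refine Finset.sum_congr rfl fun α _ => ?_
    by_cases h : e.1 = α <;> simp [h, add_smul]

theorem sum_dist (W : DistDesc n) (h : 0 < W.total) : ∑ α, W.dist α = 1 := by
  have := W.sum_dist_smul (fun _ => (1 : ℝ))
  simp only [smul_eq_mul, mul_one] at this
  have h2 : (W.map fun e => (e.2 : ℝ)).sum = W.total := by
    rw [total, Nat.cast_list_sum, List.map_map]; rfl
  rw [this, h2, inv_mul_cancel₀ (by exact_mod_cast h.ne')]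

/-- The description of the distribution with the given weights. -/
noncomputable def ofWeights (w : (Fin n → Fin 4) → ℕ) : DistDesc n :=
  (Finset.univ.filter fun α => w α ≠ 0).toList.map fun α => (α, w α)

theorem total_ofWeights (w : (Fin n → Fin 4) → ℕ) : (ofWeights w).total = ∑ α, w α := by
  rw [total, ofWeights, List.map_map]
  show ((Finset.univ.filter fun α => w α ≠ 0).toList.map w).sum = _
  rw [Finset.sum_map_toList, Finset.sum_filter_ne_zero]

theorem dist_ofWeights (w : (Fin n → Fin 4) → ℕ) (α : Fin n → Fin 4) :
    (ofWeights w).dist α = (w α : ℝ) / (∑ α, w α : ℕ) := by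
  rw [dist, total_ofWeights]
  congr 2
  rw [ofWeights, List.filter_map, List.map_map]
  show (((Finset.univ.filter fun α => w α ≠ 0).toList.filter fun β => decide (β = α)).map w).sum = _
  by_cases h : w α = 0
  · rw [h]
    refine List.sum_eq_zero fun m hm => ?_
    simp only [List.mem_map, List.mem_filter, decide_eq_true_eq] at hm
    obtain ⟨β, ⟨-, rfl⟩, rfl⟩ := hm
    exact h
  · have : ((Finset.univ.filter fun α => w α ≠ 0).toList.filter fun β => decide (β = α)) = [α] := by
      rw [List.filter_eq, List.count_eq_one_of_mem (Finset.nodup_toList _) (by simpa using h),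
        List.replicate_one]
    rw [this]; simp

end DistDesc

end QuasiQuantum

namespace QuasiQuantum

open scoped ComplexOrder Matrix

/-! ### The acceptance condition of the verifier -/

theorem posSemidef_ofReal_smul_one {ι : Type} [Fintype ι] [DecidableEq ι] {ε : ℝ} (h : 0 ≤ ε) :
    ((ε : ℂ) • (1 : Matrix ι ι ℂ)).PosSemidef :=
  Matrix.PosSemidef.one.smul (by exact_mod_cast h)

theorem LocallyPositiveUpTo.mono {n k : ℕ} {ε δ : ℝ} {X : QubitOp n}
    (h : LocallyPositiveUpTo k ε X) (hεδ : ε ≤ δ) : LocallyPositiveUpTo k δ X := by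
  intro I hI
  have := (h I hI).add (posSemidef_ofReal_smul_one (ι := I → Fin 2) (sub_nonneg.2 hεδ))
  rwa [add_assoc, ← add_smul, ← Complex.ofReal_add, add_sub_cancel] at this

namespace Instance
variable {k : ℕ} {x : Instance k}

/-- The description `W` passes all tests with precision `ε`. -/
structure Accepts (x : Instance k) (ε : ℝ) (W : DistDesc x.n) : Prop where
  total_pos : 0 < W.total
  locallyPositive : LocallyPositiveUpTo k ε (opOfDist W.dist)
  -- The slack is a multiple of `absSum / (2 * 4 ^ k)`: unlike `L_H` this is rational and easy to
  -- compute, and by `absSum_div_le` it is at most `L_H`.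
  energy_le : x.energy (opOfDist W.dist) ≤ x.a + ε * (x.absSum / (2 * 4 ^ k))

theorem accepts_of_locallyPositive {ε : ℝ} (hε : 0 ≤ ε) {W : DistDesc x.n} (h0 : 0 < W.total)
    (h1 : LocallyPositiveUpTo k 0 (opOfDist W.dist)) (h2 : x.energy (opOfDist W.dist) ≤ x.a) :
    x.Accepts ε W := by
  refine ⟨h0, h1.mono hε, h2.trans (le_add_of_nonneg_right ?_)⟩
  have : (0 : ℝ) ≤ x.absSum := by exact_mod_cast x.absSum_nonneg
  positivity

theorem absSum_div_le (x : Instance k) : (x.absSum : ℝ) / (2 * 4 ^ k) ≤ x.scale := by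
  rw [div_le_iff₀ (by positivity), mul_comm]
  exact x.absSum_le

theorem Accepts.energy_le_scale {ε : ℝ} (hε : 0 ≤ ε) {W : DistDesc x.n} (h : x.Accepts ε W) :
    x.energy (opOfDist W.dist) ≤ x.a + ε * x.scale :=
  h.energy_le.trans (by have := mul_le_mul_of_nonneg_left x.absSum_div_le hε; linarith)

end Instance

theorem marginal_smul_one {n k : ℕ} {I : Finset (Fin n)} (hI : I.card = k) :
    marginal I (((2 : ℂ) ^ n)⁻¹ • (1 : QubitOp n)) = ((2 : ℂ) ^ k)⁻¹ • 1 := by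
  ext x y
  have hiff : ∀ z, glue I x z = glue I y z ↔ x = y := by
    intro z
    refine ⟨fun h => funext fun i => ?_, fun h => by rw [h]⟩
    simpa [glue, i.2] using congrFun h i.1
  have hc : Fintype.card ({i : Fin n // i ∉ I} → Fin 2) = 2 ^ (n - k) := by
    rw [Fintype.card_fun, Fintype.card_fin, Fintype.card_subtype_compl, Fintype.card_fin,
      Fintype.card_coe, hI]
  have hk : k ≤ n := by
    rw [← hI]; simpa using Finset.card_le_univ I
  simp only [marginal, Matrix.of_apply, Matrix.smul_apply, Matrix.one_apply, hiff, smul_eq_mul,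
    Finset.sum_const, Finset.card_univ, hc, nsmul_eq_mul]
  rw [← mul_assoc]
  congr 1
  rw [← Nat.sub_add_cancel hk, Nat.add_sub_cancel, pow_add]
  push_cast
  field_simp

theorem marginal_add_smul {n : ℕ} (I : Finset (Fin n)) (a b : ℂ) (X Y : QubitOp n) :
    marginal I (a • X + b • Y) = a • marginal I X + b • marginal I Y := by
  ext x y
  simp [marginal, Finset.sum_add_distrib, Finset.mul_sum]

/-- Mixing with the maximally mixed state turns approximate local positivity into a quasi-quantum
state. -/
theorem isQQState_mix {n k : ℕ} {μ : (Fin n → Fin 4) → ℝ} (h0 : ∀ α, 0 ≤ μ α)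
    (h1 : ∑ α, μ α = 1) {ε : ℝ} (hε : 0 ≤ ε) (hk : 2 ^ k * ε ≤ 1)
    (h : LocallyPositiveUpTo k ε (opOfDist μ)) :
    IsQQState k (((1 - 2 ^ k * ε : ℝ) : ℂ) • opOfDist μ +
      ((2 ^ k * ε : ℝ) : ℂ) • ((2 : ℂ) ^ n)⁻¹ • (1 : QubitOp n)) := by
  have hm := isQQState_maximallyMixed n k
  have hη : (0 : ℂ) ≤ ((2 ^ k * ε : ℝ) : ℂ) := by
    rw [Complex.zero_le_real]; positivity
  have hη' : (0 : ℂ) ≤ ((1 - 2 ^ k * ε : ℝ) : ℂ) := by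
    rw [Complex.zero_le_real]; linarith
  refine ⟨?_, ?_, fun α => ?_, fun I hI => ?_⟩
  · rw [Matrix.trace_add, Matrix.trace_smul, Matrix.trace_smul, hm.trace_eq_one, trace_opOfDist, h1]
    simp
  · refine Matrix.IsHermitian.add ?_ ?_
    · rw [Matrix.IsHermitian, Matrix.conjTranspose_smul, (opOfDist_isHermitian μ).eq]
      simp
    · rw [Matrix.IsHermitian, Matrix.conjTranspose_smul, hm.isHermitian.eq]
      simp
  · rw [Matrix.mul_add, Matrix.mul_smul, Matrix.mul_smul, Matrix.trace_add, Matrix.trace_smul,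
      Matrix.trace_smul, trace_multiF_mul_opOfDist]
    exact add_nonneg (mul_nonneg hη' (by exact_mod_cast h0 α)) (mul_nonneg hη (hm.global_pos α))
  · rw [marginal_add_smul, marginal_smul_one hI]
    -- With mixing weight `η = 2^k ε`, the maximally mixed state contributes `η 2^(-k) = ε` times
    -- the identity. Of this, `(1 - η) ε` repairs the marginal and the positive remainder is `η ε`.
    have e : ((1 - 2 ^ k * ε : ℝ) : ℂ) • marginal I (opOfDist μ) +
        ((2 ^ k * ε : ℝ) : ℂ) • ((2 : ℂ) ^ k)⁻¹ • (1 : Matrix (I → Fin 2) (I → Fin 2) ℂ) =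
        ((1 - 2 ^ k * ε : ℝ) : ℂ) • (marginal I (opOfDist μ) + (ε : ℂ) • 1) +
          ((2 ^ k * ε * ε : ℝ) : ℂ) • 1 := by
      rw [smul_add, add_assoc, smul_smul, smul_smul, ← add_smul]
      congr 2
      push_cast
      field_simp
      ring
    rw [e]
    exact ((h I hI).smul hη').add (posSemidef_ofReal_smul_one (by positivity))

namespace Instance
variable {k : ℕ} {x : Instance k}

theorem qqGroundEnergy_le {X : QubitOp x.n} (hX : IsQQState k X) :
    x.qqGroundEnergy ≤ x.energy X :=
  (isLeast_qqGroundEnergy x).2 ⟨X, hX, rfl⟩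

theorem IsQQState.abs_energy_le {X : QubitOp x.n} (hX : IsQQState k X) :
    |x.energy X| ≤ 2 ^ k * x.absSum := by
  obtain ⟨μ, h0, h1, rfl⟩ := hX.exists_eq_opOfDist
  exact x.abs_energy_le h0 h1

/-- The mixture with the maximally mixed state bounds the ground energy. Both states have energy at
most `2^k S` in absolute value, where `S` is `absSum`, so mixing with weight `2^k ε` costs at most
`2·4^k ε S`. The slack of the energy test is at most `ε S`. -/
theorem Accepts.qqGroundEnergy_le {ε : ℝ} (hε : 0 ≤ ε) (hk : 2 ^ k * ε ≤ 1) {W : DistDesc x.n}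
    (h : x.Accepts ε W) : x.qqGroundEnergy ≤ x.a + ε * (x.absSum * (1 + 2 * 4 ^ k)) := by
  have hs : (0 : ℝ) ≤ x.absSum := by exact_mod_cast x.absSum_nonneg
  have h1 := W.sum_dist h.total_pos
  refine (Instance.qqGroundEnergy_le
    (isQQState_mix W.dist_nonneg h1 hε hk h.locallyPositive)).trans ?_
  have e := x.energy_sum_smul Finset.univ ![1 - 2 ^ k * ε, 2 ^ k * ε]
    ![opOfDist W.dist, ((2 : ℂ) ^ x.n)⁻¹ • (1 : QubitOp x.n)]
  simp only [Fin.sum_univ_two, Matrix.cons_val_zero, Matrix.cons_val_one] at e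
  rw [e]
  have b1 := neg_abs_le (x.energy (opOfDist W.dist))
  have b2 := x.abs_energy_le W.dist_nonneg h1
  have b3 := (le_abs_self _).trans (IsQQState.abs_energy_le (isQQState_maximallyMixed x.n k))
  have b4 := h.energy_le
  have b5 : (x.absSum : ℝ) / (2 * 4 ^ k) ≤ x.absSum :=
    div_le_self hs (by have := one_le_pow₀ (M₀ := ℝ) (a := 4) (n := k) (by norm_num); linarith)
  have b6 := mul_le_mul_of_nonneg_left b5 hε
  have hη : 0 ≤ 2 ^ k * ε := by positivity
  have b7 := mul_le_mul_of_nonneg_left (add_le_add b3 ((neg_le_neg b1).trans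
    ((neg_neg _).trans_le b2))) hη
  have e4 : (4 : ℝ) ^ k = 2 ^ k * 2 ^ k := by rw [← mul_pow]; norm_num
  rw [e4]
  nlinarith

/-- No description is accepted for an input whose ground energy is above the promise gap. -/
theorem Accepts.lt {c : ℝ} {C E : ℕ} {W : DistDesc x.n} (hgap : HasGap c C x)
    (hCE : C ≤ E) (hkE : k ≤ E) (hcE : 2 * 4 ^ k * (1 + 2 * 4 ^ k) < c * 2 ^ E)
    (h : x.Accepts (1 / 2 ^ (E * (x.n + 1))) W) : x.qqGroundEnergy < x.b := by
  have hs : (0 : ℝ) ≤ x.absSum := by exact_mod_cast x.absSum_nonneg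
  have hk : (2 : ℝ) ^ k * (1 / 2 ^ (E * (x.n + 1))) ≤ 1 := by
    rw [mul_one_div, div_le_one (by positivity)]
    exact pow_le_pow_right₀ (by norm_num) (by nlinarith)
  refine (h.qqGroundEnergy_le (by positivity) hk).trans_lt ?_
  have hab : (x.a : ℝ) < x.b := by exact_mod_cast hgap.1
  -- If `absSum` vanishes, the error vanishes too and `a < b` is enough; the strict estimate below
  -- needs a positive `absSum`.
  rcases hs.eq_or_lt with h0 | h0
  · rw [← h0]; simpa using hab
  have hc : 0 < c := by
    by_contra hc
    have : c * 2 ^ E ≤ 0 := mul_nonpos_of_nonpos_of_nonneg (not_lt.1 hc) (by positivity)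
    have : (0 : ℝ) < 2 * 4 ^ k * (1 + 2 * 4 ^ k) := by positivity
    linarith
  have hgap2 := hgap.2
  have h3 : c * x.absSum / (2 * 4 ^ k) / 2 ^ (C * x.n) ≤ c * x.scale / 2 ^ (C * x.n) := by
    refine div_le_div_of_nonneg_right ?_ (by positivity)
    rw [mul_div_assoc]
    exact mul_le_mul_of_nonneg_left x.absSum_div_le hc.le
  -- The precision has two factors: `2^(-E n) ≤ 2^(-C n)` matches the promise gap, and `2^(-E)`
  -- absorbs the constants, by `hcE`.
  have h4 : 1 / 2 ^ (E * (x.n + 1)) * (x.absSum * (1 + 2 * 4 ^ k)) <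
      c * x.absSum / (2 * 4 ^ k) / 2 ^ (C * x.n) := by
    rw [div_div, one_div_mul_eq_div, div_lt_div_iff₀ (by positivity) (by positivity)]
    have h5 : (2 : ℝ) ^ (C * x.n) * 2 ^ E ≤ 2 ^ (E * (x.n + 1)) := by
      rw [← pow_add]
      refine pow_le_pow_right₀ (by norm_num) ?_
      have := Nat.mul_le_mul_right x.n hCE
      linarith
    have h6 := mul_le_mul_of_nonneg_left h5 (mul_pos hc h0).le
    refine lt_of_lt_of_le ?_ h6
    have h7 := mul_lt_mul_of_pos_left hcE (mul_pos h0 (show (0 : ℝ) < 2 ^ (C * x.n) by positivity))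
    linarith
  linarith

/-- Local positivity and energy depend only on the `k`-letter marginals, so sparsifying the
distribution of a ground state yields a ground state again. -/
theorem exists_opOfDist_groundState (x : Instance k) :
    ∃ μ : (Fin x.n → Fin 4) → ℝ, (∀ α, 0 ≤ μ α) ∧ ∑ α, μ α = 1 ∧
      (Function.support μ).ncard ≤ x.n.choose k * 4 ^ k + 1 ∧ x.IsQQGroundState (opOfDist μ) := by
  obtain ⟨X, hX, hmin⟩ := (isLeast_qqGroundEnergy x).1
  obtain ⟨μ, h0, h1, rfl⟩ := hX.exists_eq_opOfDist
  obtain ⟨ν, g0, g1, g2, g3⟩ := exists_sparse_sameMarginals k h0 h1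
  refine ⟨ν, g0, g1, g2, isQQState_opOfDist g0 g1 fun I hI => ?_, ?_⟩
  · rw [g3.marginal_eq hI]; exact hX.local_pos I hI
  · rw [g3.energy_eq, hmin]

/-- Every YES input has a short accepted description. -/
theorem exists_accepts (hx : x.qqGroundEnergy ≤ x.a) (e : ℕ) :
    ∃ (W : DistDesc x.n) (X₀ : QubitOp x.n), x.Accepts (1 / 2 ^ e) W ∧
      W.encode.length ≤ (x.n.choose k * 4 ^ k + 1) * (4 * x.n + 2 * e + 10 * k + 10) + 1 ∧
      (Function.support W.dist).ncard ≤ x.n.choose k * 4 ^ k + 1 ∧ x.IsQQGroundState X₀ ∧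
      ∀ I : Finset (Fin x.n), I.card = k →
        opNorm (marginal I (opOfDist W.dist) - marginal I X₀) ≤ 1 / 2 ^ e := by
  obtain ⟨μ, h0, h1, h2, h3⟩ := x.exists_opOfDist_groundState
  set m := x.n.choose k * 4 ^ k + 1 with hm
  have hmle : m ≤ 2 ^ (x.n + 2 * k + 1) := by
    have a1 : x.n.choose k ≤ 2 ^ x.n := Nat.choose_le_two_pow _ _
    have a2 : 4 ^ k = 2 ^ (2 * k) := by rw [pow_mul]; norm_num
    have a3 : 1 ≤ 2 ^ x.n * 2 ^ (2 * k) := Nat.one_le_iff_ne_zero.2 (by positivity)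
    rw [hm, a2, pow_succ, pow_add]
    have := Nat.mul_le_mul_right (2 ^ (2 * k)) a1
    omega
  -- With `N = 2^(n+5k+3+e)` the rounding error `2m/N`, multiplied by `2·8^k`, is at most `2^(-e)`,
  -- because `m ≤ 2^(n+2k+1)`.
  have hlt : m < 2 ^ (x.n + 5 * k + 3 + e) :=
    hmle.trans_lt (Nat.pow_lt_pow_right (by norm_num) (by omega))
  obtain ⟨w, w1, w2, w3, w4⟩ := exists_nat_weights h0 h1 h2 hlt
  have hW : (DistDesc.ofWeights w).dist = fun α => (w α : ℝ) / (∑ α, w α : ℕ) :=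
    funext fun α => DistDesc.dist_ofWeights w α
  -- The marginals would only need the factor `8^k`. The energy test needs `2^k · (2·4^k) = 2·8^k`,
  -- as its slack is divided by `2·4^k`.
  have hl1 : 2 * 8 ^ k * ∑ α, |(DistDesc.ofWeights w).dist α - μ α| ≤ 1 / 2 ^ e := by
    rw [hW]
    refine (mul_le_mul_of_nonneg_left w4 (by positivity)).trans ?_
    push_cast
    rw [← mul_div_assoc, div_le_div_iff₀ (by positivity) (by positivity)]
    have b1 : (m : ℝ) ≤ 2 ^ (x.n + 2 * k + 1) := by exact_mod_cast hmle
    have b2 : (8 : ℝ) ^ k = 2 ^ (3 * k) := by rw [pow_mul]; norm_num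
    rw [b2]
    calc (2 * 2 ^ (3 * k) * (2 * m) * 2 ^ e : ℝ)
        ≤ 2 * 2 ^ (3 * k) * (2 * 2 ^ (x.n + 2 * k + 1)) * 2 ^ e := by gcongr
      _ = 1 * 2 ^ (x.n + 5 * k + 3 + e) := by ring
  have hl2 : (0 : ℝ) ≤ 8 ^ k * ∑ α, |(DistDesc.ofWeights w).dist α - μ α| :=
    mul_nonneg (by positivity) (Finset.sum_nonneg fun _ _ => abs_nonneg _)
  have hB : ∀ I : Finset (Fin x.n), I.card = k → ∑ i, ∑ j, ‖(marginal I
      (opOfDist (DistDesc.ofWeights w).dist) - marginal I (opOfDist μ)) i j‖ ≤ 1 / 2 ^ e :=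
    fun I hI => (sum_norm_marginal_sub_le hI).trans (by linarith)
  refine ⟨DistDesc.ofWeights w, opOfDist μ, ⟨?_, fun I hI => ?_, ?_⟩, ?_, ?_, h3, fun I hI =>
    (opNorm_le_sum_norm _).trans (hB I hI)⟩
  · rw [DistDesc.total_ofWeights]; exact w3
  · have := posSemidef_add_of_sum_norm_le (h3.1.local_pos I hI)
      ((marginal_isHermitian (opOfDist_isHermitian _) I).sub
        (marginal_isHermitian (opOfDist_isHermitian _) I)) (hB I hI)
    rwa [add_sub_cancel] at this
  · have hs : (0 : ℝ) ≤ x.absSum := by exact_mod_cast x.absSum_nonneg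
    have a1 := (abs_le.1 (x.abs_energy_sub_le (DistDesc.ofWeights w).dist μ)).2
    have a2 : x.energy (opOfDist μ) ≤ x.a := h3.2.trans_le hx
    have a3 : 2 ^ k * x.absSum * ∑ α, |(DistDesc.ofWeights w).dist α - μ α| ≤
        1 / 2 ^ e * (x.absSum / (2 * 4 ^ k)) := by
      refine le_trans (le_of_eq ?_)
        (mul_le_mul_of_nonneg_right hl1 (show (0 : ℝ) ≤ x.absSum / (2 * 4 ^ k) by positivity))
      rw [show (8 : ℝ) = 2 * 4 by norm_num, mul_pow]
      field_simp
    linarith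
  · refine (DistDesc.length_encode_le _ (M := x.n + 5 * k + 3 + e) ?_).trans ?_
    · intro p hp
      obtain ⟨α, -, rfl⟩ := List.mem_map.1 hp
      exact w2 α
    · refine Nat.succ_le_succ ?_
      have hlen : (DistDesc.ofWeights w).length ≤ m := by
        rw [DistDesc.ofWeights, List.length_map, Finset.length_toList]
        refine le_trans ?_ h2
        rw [← Set.ncard_coe_finset]
        refine Set.ncard_le_ncard (fun α hα => w1 α ?_) (Set.toFinite _)
        simpa using hα
      refine Nat.mul_le_mul hlen ?_
      omega
  · refine le_trans (Set.ncard_le_ncard (fun α hα => w1 α ?_) (Set.toFinite _)) h2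
    rintro h
    rw [Function.mem_support, hW] at hα
    simp [h] at hα

end Instance

end QuasiQuantum

namespace StackProg

/-! ### Reading the input -/

open Computability (Γ' encodeNat)
open QuasiQuantum

variable {α β γ σ : Type} [Enc α] [Enc β] [Enc γ] [Enc σ]

/-- The state of the reader, which reads the input from right to left: the current token, the
tokens of the current group, the groups, the tokens of the last group, and the witness. -/
abbrev ReadState : Type :=
  List Bool × List (List Bool) × List (List (List Bool)) × List (List Bool) × List Bool

/-- Reading one symbol. -/
def readStep (s : ReadState) : Sym → ReadState
  | .inl (.bit b) => (b :: s.1, s.2)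
  | .inl .comma => ([], s.1 :: s.2.1, s.2.2)
  | .inl .bra => ([], [], (s.1 :: s.2.1) :: s.2.2.1, s.2.2.2)
  | .inl .ket => ([], [], s.2.2.1, s.1 :: s.2.1, s.2.2.2.2)
  | .inl .blank => s
  | .inr b => (s.1, s.2.1, s.2.2.1, s.2.2.2.1, b :: s.2.2.2.2)

/-- Reading the whole input. -/
def readAll (l : List Sym) : ReadState := l.reverse.foldl readStep ([], [], [], [], [])

theorem polyTime_readAll : PolyTime readAll := by
  refine PolyTime.foldl_of_size_growth (f := fun l : List Sym => l.reverse)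
    (g := fun _ => (([], [], [], [], []) : ReadState)) (h := fun _ s b => readStep s b)
    (by fun_prop) (by fun_prop) (PolyTime.sym_cases (f := fun x : List Sym × ReadState × Sym => x.2.2)
    (g := fun d x => readStep x.2.1 d) (by fun_prop) fun d => ?_) (.const 10) ?_
  · rcases d with (_ | b | _ | _ | _) | b <;> simp only [readStep] <;> fun_prop
  · rintro a ⟨s1, s2, s3, s4, s5⟩ b -
    rcases b with (_ | b | _ | _ | _) | b <;>
      simp only [readStep, size_prod, size_cons, size_nil] <;>
      first
      | omega
      | (have := size_bool b; omega)

/-- A list of tokens, each followed by a comma. -/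
def encToks (ts : List (List Bool)) : List Γ' := ts.flatMap fun t => t.map Γ'.bit ++ [Γ'.comma]

theorem encToks_append (s t : List (List Bool)) : encToks (s ++ t) = encToks s ++ encToks t :=
  List.flatMap_append

/-- The tokens of a rational number. -/
def ratToks (q : ℚ) : List (List Bool) :=
  [decide (q < 0) :: encodeNat q.num.natAbs, encodeNat q.den]

theorem encRat_eq (q : ℚ) : encRat q = encToks (ratToks q) := by
  simp [encRat, encToks, ratToks, encNat]

theorem encUnary_eq (m : ℕ) : encUnary m = encToks [List.replicate m true] := by
  simp [encUnary, encToks]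

/-- The tokens of an entry of a local term. -/
def entryToks {n k : ℕ} (h : LocalTerm n k) (r c : Fin (2 ^ k)) : List (List Bool) :=
  ratToks (h.re (finFunctionFinEquiv.symm r) (finFunctionFinEquiv.symm c)) ++
    ratToks (h.im (finFunctionFinEquiv.symm r) (finFunctionFinEquiv.symm c))

/-- The tokens of a local term. -/
def termToks {n k : ℕ} (h : LocalTerm n k) : List (List Bool) :=
  (List.finRange k).map (fun j => List.replicate (h.sites j) true) ++
  (List.finRange (2 ^ k)).flatMap fun r => (List.finRange (2 ^ k)).flatMap (entryToks h r)

theorem encToks_flatMap {ι : Type} (l : List ι) (f : ι → List (List Bool)) :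
    encToks (l.flatMap f) = l.flatMap fun i => encToks (f i) := by
  simp only [encToks, List.flatMap_assoc]

theorem encTerm_eq {n k : ℕ} (h : LocalTerm n k) : encTerm h = encToks (termToks h) := by
  rw [encTerm, termToks, encToks_append, encToks_flatMap]
  congr 1
  · simp only [encUnary_eq, encToks, List.flatMap_map, List.flatMap_singleton]
  · simp only [encToks_flatMap, entryToks, encToks_append, encRat_eq]

theorem encInstance_eq {k : ℕ} (x : Instance k) : encInstance x =
    encToks [List.replicate x.n true] ++
      (x.terms.flatMap (fun h => Γ'.bra :: encToks (termToks h)) ++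
        (Γ'.ket :: encToks (ratToks x.a ++ ratToks x.b))) := by
  simp [encInstance, encTerm_eq, encUnary_eq, encRat_eq, encToks_append]

/-- Reading a list of symbols from right to left, starting in a given state. -/
def readFrom (l : List Sym) (s : ReadState) : ReadState := l.foldr (fun b s => readStep s b) s

theorem readAll_eq (l : List Sym) : readAll l = readFrom l ([], [], [], [], []) := by
  rw [readAll, List.foldl_reverse, readFrom]

theorem readFrom_append (l m : List Sym) (s : ReadState) :
    readFrom (l ++ m) s = readFrom l (readFrom m s) := List.foldr_append

theorem readFrom_comma (s : ReadState) :
    readFrom [Sum.inl Γ'.comma] s = ([], s.1 :: s.2.1, s.2.2) := rfl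

theorem readFrom_bra (s : ReadState) :
    readFrom [Sum.inl Γ'.bra] s = ([], [], (s.1 :: s.2.1) :: s.2.2.1, s.2.2.2) := rfl

theorem readFrom_ket (s : ReadState) :
    readFrom [Sum.inl Γ'.ket] s = ([], [], s.2.2.1, s.1 :: s.2.1, s.2.2.2.2) := rfl

theorem readFrom_bits (t : List Bool) (s : ReadState) :
    readFrom ((t.map Γ'.bit).map Sum.inl) s = (t ++ s.1, s.2) := by
  induction t with
  | nil => rfl
  | cons b t ih =>
    simp only [List.map_cons, readFrom, List.foldr_cons] at ih ⊢
    rw [ih]; rfl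

/-- The current token and the current group are joined because a comma shifts the border between
them: the token being read when the scan arrives becomes an item behind the new tokens. -/
theorem readFrom_encToks (ts : List (List Bool)) (s : ReadState) :
    (readFrom ((encToks ts).map Sum.inl) s).1 :: (readFrom ((encToks ts).map Sum.inl) s).2.1 =
      ts ++ s.1 :: s.2.1 ∧ (readFrom ((encToks ts).map Sum.inl) s).2.2 = s.2.2 := by
  induction ts with
  | nil => exact ⟨rfl, rfl⟩
  | cons t ts ih =>
    have h : (encToks (t :: ts)).map Sum.inl = ((t.map Γ'.bit).map Sum.inl : List Sym) ++
        (([Sum.inl Γ'.comma] : List Sym) ++ (encToks ts).map Sum.inl) := by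
      simp [encToks]
    rw [h, readFrom_append, readFrom_append, readFrom_bits, readFrom_comma, ih.1]
    exact ⟨by simp, ih.2⟩

theorem readFrom_witness (w : List Bool) :
    readFrom (w.map Sum.inr) ([], [], [], [], []) = ([], [], [], [], w) := by
  induction w with
  | nil => rfl
  | cons b w ih =>
    simp only [List.map_cons, readFrom, List.foldr_cons] at ih ⊢
    rw [ih]; rfl

theorem readFrom_terms {n k : ℕ} (l : List (LocalTerm n k)) (f : List (List Bool)) (w : List Bool) :
    readFrom ((l.flatMap fun h => Γ'.bra :: encToks (termToks h)).map Sum.inl)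
      ([], [], [], f, w) = ([], [], l.map fun h => termToks h ++ [[]], f, w) := by
  induction l with
  | nil => rfl
  | cons h l ih =>
    have e : (((h :: l).flatMap fun h => Γ'.bra :: encToks (termToks h)).map Sum.inl : List Sym) =
        [Sum.inl Γ'.bra] ++ ((encToks (termToks h)).map Sum.inl ++
          (l.flatMap fun h => Γ'.bra :: encToks (termToks h)).map Sum.inl) := by simp
    rw [e, readFrom_append, readFrom_append, ih, readFrom_bra]
    obtain ⟨h1, h2⟩ := readFrom_encToks (termToks h)
      ([], [], l.map fun h => termToks h ++ [[]], f, w)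
    rw [h1, h2]
    rfl

/-- Every token is followed by a comma, so from right to left each group starts with an empty token.
This is the trailing `[[]]`; it is harmless because tokens are accessed by position from the left.
-/
theorem readAll_encPair {k : ℕ} (x : Instance k) (w : List Bool) :
    readAll (encPair encInstance (x, w)) =
      (List.replicate x.n true, [[]], x.terms.map fun h => termToks h ++ [[]],
        ratToks x.a ++ ratToks x.b ++ [[]], w) := by
  have e : encPair encInstance (x, w) =
      (encToks [List.replicate x.n true]).map Sum.inl ++
      ((x.terms.flatMap (fun h => Γ'.bra :: encToks (termToks h))).map Sum.inl ++
        ([Sum.inl Γ'.ket] ++ ((encToks (ratToks x.a ++ ratToks x.b)).map Sum.inl ++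
          w.map Sum.inr))) := by
    simp [encPair, encInstance_eq]
  rw [readAll_eq, e]
  simp only [readFrom_append, readFrom_witness]
  obtain ⟨h1, h2⟩ := readFrom_encToks (ratToks x.a ++ ratToks x.b) ([], [], [], [], w)
  have h3 : readFrom [Sum.inl Γ'.ket] (readFrom ((encToks (ratToks x.a ++ ratToks x.b)).map Sum.inl)
      ([], [], [], [], w)) = ([], [], [], ratToks x.a ++ ratToks x.b ++ [[]], w) := by
    rw [readFrom_ket, h1, h2]
  rw [h3, readFrom_terms]
  obtain ⟨h4, h5⟩ := readFrom_encToks [List.replicate x.n true]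
    ([], [], x.terms.map fun h => termToks h ++ [[]], ratToks x.a ++ ratToks x.b ++ [[]], w)
  obtain ⟨h6, h7⟩ := List.cons.inj h4
  exact Prod.ext h6 (Prod.ext h7 h5)

/-! ### Reading a description of a distribution -/

/-- The phases of the reader of the witness. -/
inductive Phase : Type
  | start | letter | letterSnd | digit | done | fail
  deriving DecidableEq

instance : Fintype Phase :=
  ⟨{.start, .letter, .letterSnd, .digit, .done, .fail}, by rintro ⟨⟩ <;> simp⟩

noncomputable instance : Enc Phase := ⟨finDat⟩

/-- The state of the reader of the witness: the phase, a bit that is put aside, the number of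
letters to come, the letters and the digits of the current item, and the items, all of them in
reverse order. -/
abbrev WitnessState : Type :=
  Phase × Bool × List Bool × List (Bool × Bool) × List Bool × List (List (Bool × Bool) × List Bool)

/-- Reading one bit of the witness, where `N` is the number of letters in unary. -/
def witnessStep (N : List Bool) (s : WitnessState) (b : Bool) : Phase → WitnessState
  | .start => bif b then (.letter, false, N, [], [], s.2.2.2.2.2)
      else (.done, false, [], [], [], s.2.2.2.2.2)
  | .letter => bif s.2.2.1.isEmpty then
      bif b then (.digit, s.2) else
        (.start, false, [], [], [], (s.2.2.2.1, s.2.2.2.2.1) :: s.2.2.2.2.2)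
      else (.letterSnd, b, s.2.2)
  | .letterSnd => (.letter, false, s.2.2.1.tail, (s.2.1, b) :: s.2.2.2.1, s.2.2.2.2)
  | .digit => (.letter, s.2.1, s.2.2.1, s.2.2.2.1, b :: s.2.2.2.2.1, s.2.2.2.2.2)
  | .done => (.fail, s.2)
  | .fail => s

/-- Reading a list of bits of the witness. -/
def readWitness (N w : List Bool) (s : WitnessState) : WitnessState :=
  w.foldl (fun s b => witnessStep N s b s.1) s

/-- The items that the witness describes. -/
def witnessItems (s : WitnessState) : List (List (Bool × Bool) × ℕ) :=
  s.2.2.2.2.2.reverse.map fun p => (p.1.reverse, bitsVal p.2.reverse)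

theorem size_phase (p : Phase) : size p ≤ ∑ p : Phase, size p :=
  Finset.single_le_sum (f := fun p : Phase => size p) (fun _ _ => Nat.zero_le _)
    (Finset.mem_univ p)

theorem PolyTime.readWitness {N w : α → List Bool} (hN : PolyTime N) (hw : PolyTime w) :
    PolyTime fun a => readWitness (N a) (w a) (.start, false, [], [], [], []) := by
  refine PolyTime.foldl_of_size_growth (g := fun _ => ((.start, false, [], [], [], []) :
    WitnessState)) (h := fun a s b => witnessStep (N a) s b s.1) hw (by fun_prop)
    (PolyTime.of_finite_cases (f := fun x : α × WitnessState × Bool => x.2.1.1)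
    (g := fun d x => witnessStep (N x.1) x.2.1 x.2.2 d) finDat_injective (by fun_prop)
    fun d => ?_)
    (q := fun a => size (N a) + (∑ p : Phase, size p) + 20) ((hN.size_bound.add (.const _)).add
    (.const _)) ?_
  · cases d <;> simp only [witnessStep] <;> fun_prop
  · rintro a ⟨p, h, c, l, d, o⟩ b -
    have h1 := size_phase (witnessStep (N a) (p, h, c, l, d, o) b p).1
    revert h1
    generalize ∑ p : Phase, size p = S
    intro h1
    have h2 := size_bool b
    have h3 := size_bool h
    have h3' := one_le_size h
    have h4 := one_le_size c
    have h5 := one_le_size l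
    have h6 := one_le_size d
    have h7 := size_tail_le c
    have h8 := one_le_size o
    have h9 := one_le_size p
    have h10 : size false ≤ 3 := size_bool false
    rcases p <;> simp only [witnessStep] at h1 ⊢
    · cases b <;> simp only [cond_true, cond_false, size_prod, size_nil] at h1 ⊢ <;> omega
    · revert h1
      cases c.isEmpty <;> cases b <;> intro h1 <;>
        simp only [cond_true, cond_false, size_prod, size_nil, size_cons] at h1 ⊢ <;> omega
    all_goals simp only [size_prod, size_cons] at h1 ⊢; omega

theorem PolyTime.witnessItems {s : α → WitnessState} (hs : PolyTime s) :
    PolyTime fun a => witnessItems (s a) :=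
  PolyTime.map (h := fun _ (p : List (Bool × Bool) × List Bool) =>
    (p.1.reverse, StackProg.bitsVal p.2.reverse)) (by fun_prop) (by fun_prop)

theorem readWitness_append (N v w : List Bool) (s : WitnessState) :
    readWitness N (v ++ w) s = readWitness N w (readWitness N v s) := List.foldl_append

theorem readWitness_letters (N : List Bool) (L : List (Bool × Bool)) : ∀ c l d o,
    readWitness N (L.flatMap fun p => [p.1, p.2])
      (.letter, false, List.replicate L.length c, l, d, o) =
    (.letter, false, [], L.reverse ++ l, d, o) := by
  induction L with
  | nil => intros; rfl
  | cons p L ih =>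
    intro c l d o
    have := ih c (p :: l) d o
    simp only [List.flatMap_cons, List.length_cons, List.replicate_succ, readWitness_append]
    rw [List.reverse_cons, List.append_assoc, List.singleton_append, ← this]
    rfl

theorem readWitness_digits (N D : List Bool) : ∀ l d o,
    readWitness N (D.flatMap fun b => [true, b]) (.letter, false, [], l, d, o) =
    (.letter, false, [], l, D.reverse ++ d, o) := by
  induction D with
  | nil => intros; rfl
  | cons b D ih =>
    intro l d o
    have := ih l (b :: d) o
    simp only [List.flatMap_cons, readWitness_append]
    rw [List.reverse_cons, List.append_assoc, List.singleton_append, ← this]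
    rfl

/-- The two bits of a letter. -/
def letterBits (a : Fin 4) : Bool × Bool := (a.val.testBit 0, a.val.testBit 1)

/-- The letter with the given bits. -/
def letterOf (p : Bool × Bool) : Fin 4 := bif p.2 then bif p.1 then 3 else 2 else
  bif p.1 then 1 else 0

theorem letterOf_letterBits (a : Fin 4) : letterOf (letterBits a) = a := by
  fin_cases a <;> rfl

theorem readWitness_item {n : ℕ} (α : Fin n → Fin 4) (D : List Bool) (o) :
    readWitness (List.replicate n true) (true ::
      ((List.finRange n).flatMap (fun i => [(α i).val.testBit 0, (α i).val.testBit 1]) ++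
        D.flatMap (fun d => [true, d]) ++ [false])) (.start, false, [], [], [], o) =
    (.start, false, [], [], [],
      (((List.finRange n).map fun i => letterBits (α i)).reverse, D.reverse) :: o) := by
  have h1 : (List.finRange n).flatMap (fun i => [(α i).val.testBit 0, (α i).val.testBit 1]) =
      ((List.finRange n).map fun i => letterBits (α i)).flatMap fun p => [p.1, p.2] := by
    rw [List.flatMap_map]; rfl
  have h2 := readWitness_letters (List.replicate n true)
    ((List.finRange n).map fun i => letterBits (α i)) true [] [] o
  rw [List.length_map, List.length_finRange, List.append_nil, ← h1] at h2
  rw [← List.singleton_append, readWitness_append]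
  change readWitness _ _ (.letter, false, List.replicate n true, [], [], o) = _
  rw [readWitness_append, readWitness_append, h2, readWitness_digits, List.append_nil]
  rfl

theorem readWitness_encode {n : ℕ} (W : DistDesc n) : ∀ o,
    readWitness (List.replicate n true) W.encode (.start, false, [], [], [], o) =
    (.done, false, [], [], [], (W.map fun e =>
      (((List.finRange n).map fun i => letterBits (e.1 i)).reverse,
        (encodeNat e.2).reverse)).reverse ++ o) := by
  rw [DistDesc.encode]
  induction W with
  | nil => intro o; rfl
  | cons e W ih =>
    intro o
    rw [List.flatMap_cons, List.append_assoc, readWitness_append, readWitness_item, ih]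
    simp

/-- The description with the given items. -/
def toDesc (n : ℕ) (l : List (List (Bool × Bool) × ℕ)) : DistDesc n :=
  l.map fun e => (fun i => letterOf (e.1.getD i (false, false)), e.2)

theorem toDesc_witnessItems {n : ℕ} (W : DistDesc n) :
    toDesc n (witnessItems (readWitness (List.replicate n true) W.encode
      (.start, false, [], [], [], []))) = W := by
  rw [readWitness_encode, witnessItems, toDesc]
  simp only [List.append_nil, List.reverse_reverse, List.map_map]
  conv_rhs => rw [← List.map_id W]
  refine List.map_congr_left fun e _ => ?_
  simp only [Function.comp_apply, List.reverse_reverse, id, encodeNat_eq_bits, bitsVal_bits]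
  refine Prod.ext (funext fun i => ?_) rfl
  simp [List.getD, letterOf_letterBits]

end StackProg

namespace StackProg

open Computability (encodeNat)
open QuasiQuantum

variable {α β γ : Type} [Enc α] [Enc β] [Enc γ]

/-! ### Lists and quantifiers -/

namespace PolyTime

theorem getD {f : α → List β} (hf : PolyTime f) (i : ℕ) (d : β) :
    PolyTime fun a => (f a).getD i d := by
  induction i generalizing f with
  | zero =>
    refine (hf.headD (.const d)).of_dat_eq fun a => ?_
    cases f a <;> rfl
  | succ i ih =>
    refine (ih hf.tail).of_dat_eq fun a => ?_
    cases f a <;> rfl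

theorem getD_length {f : α → List β} {g : α → List γ} (hf : PolyTime f) (hg : PolyTime g) (d : β) :
    PolyTime fun a => (f a).getD (g a).length d := by
  refine ((drop_length hg hf).headD (.const d)).of_dat_eq fun a => ?_
  rw [List.headD_eq_head?_getD, List.head?_drop, List.getD_eq_getElem?_getD]

theorem length_lt {f : α → List β} {g : α → List γ} (hf : PolyTime f) (hg : PolyTime g) :
    PolyTime fun a => decide ((f a).length < (g a).length) := by
  refine (drop_length hf hg).isEmpty.not.of_dat_eq fun a => ?_
  congr 1
  rw [Bool.eq_iff_iff]
  simp

theorem decide_forall {ι : Type*} [Finite ι] {P : ι → α → Prop} [∀ i, DecidablePred (P i)]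
    [DecidablePred fun a => ∀ i, P i a] (h : ∀ i, PolyTime fun a => decide (P i a)) :
    PolyTime fun a => decide (∀ i, P i a) := by
  classical
  have key : ∀ s : Finset ι, PolyTime fun a => decide (∀ i ∈ s, P i a) := by
    intro s
    induction s using Finset.induction_on with
    | empty => exact (PolyTime.const true).of_dat_eq fun a => by simp
    | insert i s hi ih =>
      refine ((h i).and ih).of_dat_eq fun a => ?_
      congr 1
      rw [Bool.eq_iff_iff]
      simp
  have := Fintype.ofFinite ι
  exact (key Finset.univ).of_dat_eq fun a => by simp

theorem natPow {f : α → ℕ} (hf : PolyTime f) (m : ℕ) : PolyTime fun a => f a ^ m := by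
  induction m with
  | zero => exact (PolyTime.const 1).of_dat_eq fun a => by simp
  | succ m ih => simp only [pow_succ]; fun_prop

theorem two_pow_length {f : α → List β} (hf : PolyTime f) : PolyTime fun a => 2 ^ (f a).length := by
  -- The binary digits of `2^m` are `m` zeros followed by a one.
  refine (PolyTime.bitsVal (f := fun a => (f a).map (fun _ => false) ++ [true])
    (append (map (h := fun _ _ => false) hf (.const _)) (.const _))).of_dat_eq fun a => ?_
  congr 1
  induction f a with
  | nil => rfl
  | cons b l ih =>
    rw [List.map_cons, List.cons_append, StackProg.bitsVal, ih, List.length_cons, pow_succ,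
      Nat.bit_false]
    ring

theorem toPNat' {f : α → ℕ} (hf : PolyTime f) : PolyTime fun a => (f a).toPNat' := by
  refine of_pnatVal ((cond (natLe (.const 1) hf) hf (.const 1)).of_dat_eq fun a => ?_)
  congr 1
  rw [Nat.toPNat'_coe, Bool.cond_decide]
  rfl

end PolyTime

/-- Does the test succeed for all lists of `k` items of `l`? -/
def allTuples (l : List β) : ℕ → (List β → Bool) → Bool
  | 0, h => h []
  | k + 1, h => l.all fun b => allTuples l k fun t => h (b :: t)

theorem allTuples_iff {δ : Type} (l : List δ) (k : ℕ) (h : List δ → Bool) :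
    allTuples l k h = true ↔ ∀ t : List δ, t.length = k → (∀ b ∈ t, b ∈ l) → h t = true := by
  induction k generalizing h with
  | zero =>
    refine ⟨fun H t ht _ => ?_, fun H => H [] rfl (by simp)⟩
    rwa [List.length_eq_zero_iff.1 ht]
  | succ k ih =>
    simp only [allTuples, List.all_eq_true, ih]
    refine ⟨fun H t ht hl => ?_, fun H b hb t ht hl => H _ (by simp [ht]) (by simp [hb]; exact hl)⟩
    cases t with
    | nil => simp at ht
    | cons b t => exact H b (hl b (by simp)) t (by simpa using ht) fun c hc => hl c (by simp [hc])

/-- These are `k` nested loops; the time is polynomial since `k` is a constant. -/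
theorem PolyTime.allTuples {f : α → List β} {h : α → List β → Bool} (hf : PolyTime f)
    (hh : PolyTime fun x : α × List β => h x.1 x.2) (k : ℕ) :
    PolyTime fun a => allTuples (f a) k (h a) := by
  induction k generalizing α with
  | zero => exact hh.comp (g := fun a : α => (a, [])) (by fun_prop)
  | succ k ih =>
    refine PolyTime.all (h := fun a b => StackProg.allTuples (f a) k fun t => h a (b :: t)) hf ?_
    exact ih (α := α × β) (f := fun x => f x.1) (h := fun x t => h x.1 (x.2 :: t)) (by fun_prop)
      (hh.comp (g := fun y : (α × β) × List β => (y.1.1, y.1.2 :: y.2)) (by fun_prop))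

/-- Lists of the lengths `0, …, N.length - 1`. -/
def positions (N : List Bool) : List (List Bool) :=
  N.foldl (fun s _ => N.drop (s.length + 1) :: s) []

theorem mem_positions {N t : List Bool} :
    t ∈ positions N ↔ ∃ j < N.length, t = N.drop (j + 1) := by
  have key : ∀ (l : List Bool) (s : List (List Bool)),
      t ∈ l.foldl (fun s _ => N.drop (s.length + 1) :: s) s ↔
        t ∈ s ∨ ∃ j, s.length ≤ j ∧ j < s.length + l.length ∧ t = N.drop (j + 1) := by
    intro l
    induction l with
    | nil => intro s; simp; intros; omega
    | cons b l ih =>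
      intro s
      rw [List.foldl_cons, ih, List.mem_cons, List.length_cons, List.length_cons]
      constructor
      · rintro ((rfl | h) | ⟨j, h1, h2, h3⟩)
        · exact Or.inr ⟨_, le_rfl, by omega, rfl⟩
        · exact Or.inl h
        · exact Or.inr ⟨j, by omega, by omega, h3⟩
      · rintro (h | ⟨j, h1, h2, h3⟩)
        · exact Or.inl (Or.inr h)
        · rcases h1.eq_or_lt with rfl | h1
          · exact Or.inl (Or.inl h3)
          · exact Or.inr ⟨j, by omega, by omega, h3⟩
  rw [positions, key]
  simp

theorem length_lt_of_mem_positions {N t : List Bool} (h : t ∈ positions N) :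
    t.length < N.length := by
  obtain ⟨j, hj, rfl⟩ := mem_positions.1 h
  rw [List.length_drop]; omega

theorem exists_mem_positions {N : List Bool} {i : ℕ} (h : i < N.length) :
    ∃ t ∈ positions N, t.length = i :=
  ⟨_, mem_positions.2 ⟨N.length - 1 - i, by omega, rfl⟩, by rw [List.length_drop]; omega⟩

theorem size_drop_le (l : List β) (m : ℕ) : size (l.drop m) ≤ size l := by
  induction m generalizing l with
  | zero => simp
  | succ m ih => rw [← List.drop_tail]; exact (ih _).trans (size_tail_le l)

theorem PolyTime.positions {f : α → List Bool} (hf : PolyTime f) :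
    PolyTime fun a => positions (f a) := by
  refine foldl_of_size_growth (g := fun _ => [])
    (h := fun a (s : List (List Bool)) _ => (f a).drop (s.length + 1) :: s) hf (by fun_prop)
    (PolyTime.cons (PolyTime.drop_length (f := fun x : α × List (List Bool) × Bool => [] :: x.2.1)
      (g := fun x => f x.1) (by fun_prop) (by fun_prop)) (by fun_prop))
    (q := fun a => size (f a) + 1) (hf.size_bound.add (.const 1)) fun a s b _ => ?_
  have := size_drop_le (f a) (s.length + 1)
  rw [size_cons]
  omega

/-! ### Numbers -/

theorem RealPT.abs {f : α → ℝ} (hf : RealPT f) : RealPT fun a => |f a| :=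
  (RealPT.cond hf.nonneg hf hf.neg).congr fun a => by
    by_cases h : 0 ≤ f a
    · simp [h, abs_of_nonneg h]
    · simp [h, abs_of_neg (not_le.1 h)]

/-- The rational number with the given tokens. -/
noncomputable def tokVal (t d : List Bool) : ℝ :=
  (bif t.headD false then -(bitsVal t.tail : ℝ) else bitsVal t.tail) *
    (((bitsVal d).toPNat' : ℕ) : ℝ)⁻¹

theorem RealPT.tokVal {t d : α → List Bool} (ht : PolyTime t) (hd : PolyTime d) :
    RealPT fun a => tokVal (t a) (d a) :=
  (RealPT.cond (by fun_prop) (RealPT.natCast (by fun_prop)).neg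
    (RealPT.natCast (by fun_prop))).mul (RealPT.pnatInv (PolyTime.toPNat' (by fun_prop)))

theorem tokVal_rat (q : ℚ) :
    tokVal (decide (q < 0) :: encodeNat q.num.natAbs) (encodeNat q.den) = q := by
  have hq : (q : ℝ) = (q.num : ℝ) * (q.den : ℝ)⁻¹ := by
    rw [← div_eq_mul_inv]; exact_mod_cast (Rat.num_div_den q).symm
  rw [hq, tokVal, encodeNat_eq_bits, encodeNat_eq_bits, List.headD_cons, List.tail_cons,
    bitsVal_bits, bitsVal_bits, Nat.toPNat'_coe, if_pos q.den_pos]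
  congr 1
  by_cases h : q < 0
  · have h1 : ((q.num.natAbs : ℤ) : ℝ) = -q.num := by
      rw [Int.ofNat_natAbs_of_nonpos (Rat.num_neg.2 h).le]; push_cast; rfl
    rw [decide_eq_true h, cond_true, ← Int.cast_natCast, h1, neg_neg]
  · have h1 : ((q.num.natAbs : ℤ) : ℝ) = q.num := by
      rw [Int.natAbs_of_nonneg (Rat.num_nonneg.2 (not_lt.1 h))]
    rw [decide_eq_false h, cond_false, ← Int.cast_natCast, h1]

theorem RealPT.two_pow_inv {f : α → List β} (hf : PolyTime f) (E : ℕ) :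
    RealPT fun a => 1 / (2 : ℝ) ^ (E * ((f a).length + 1)) := by
  refine (RealPT.pnatInv (PolyTime.toPNat' ((PolyTime.natMul (PolyTime.two_pow_length hf)
    (.const 2)).natPow E))).congr fun a => ?_
  rw [Nat.toPNat'_coe, if_pos (by positivity), one_div, ← pow_succ, ← pow_mul, mul_comm E]
  push_cast
  rfl

theorem ComplexPT.sicD_const (β : Fin 4) (i j : Fin 2) : ComplexPT fun _ : α => sicD β i j := by
  have h0 : RealPT fun _ : α => (-√2 / 2 : ℝ) := RealPT.sqrt_two.neg.div_nat 2
  have h1 : RealPT fun _ : α => (√2 * √3 / 2 : ℝ) := (RealPT.sqrt_two.mul .sqrt_three).div_nat 2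
  have h2 : ComplexPT fun _ : α => (2 : ℂ) := (ComplexPT.one.add .one).congr fun _ => one_add_one_eq_two
  have h3 : ComplexPT fun _ : α => sicEntry := ⟨h0, h1⟩
  have h4 : ComplexPT fun _ : α => (starRingEnd ℂ) sicEntry := ⟨h0, h1.neg⟩
  have h5 : ComplexPT fun _ : α => (√2 : ℂ) := .ofReal .sqrt_two
  simp only [sicD_eq]
  fin_cases β <;> fin_cases i <;> fin_cases j <;> simp <;>
    first | assumption | exact ComplexPT.one | exact ComplexPT.zero | exact ComplexPT.one.neg

theorem ComplexPT.sicD {f : α → Bool × Bool} (hf : PolyTime f) (i j : Fin 2) :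
    ComplexPT fun a => sicD (letterOf (f a)) i j :=
  ComplexPT.bool_cases (c := fun a => (f a).1)
    (f := fun b a => QuasiQuantum.sicD (letterOf (b, (f a).2)) i j) hf.fst fun b =>
      ComplexPT.bool_cases (c := fun a => (f a).2)
        (f := fun c _ => QuasiQuantum.sicD (letterOf (b, c)) i j) hf.snd fun _ => .sicD_const _ i j

end StackProg

namespace StackProg

open Computability (encodeNat)
open QuasiQuantum
open scoped ComplexOrder Matrix

variable {α β γ : Type} [Enc α] [Enc β] [Enc γ]

/-! ### The tests of the verifier -/

/-- An item of a description of a distribution: the letters of a string, and its weight. -/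
abbrev Item : Type := List (Bool × Bool) × ℕ

/-- The data that the verifier has read: the number of qubits in unary, the tokens of the terms,
the tokens of the thresholds, and the items of the witness. -/
abbrev Data : Type := List Bool × List (List (List Bool)) × List (List Bool) × List Item

/-- The entries of the product of the dual basis elements of the letters of `L` at the positions
given by the lengths of the first `k` lists in `t`. -/
noncomputable def entryProd {k : ℕ} (L : List (Bool × Bool)) (t : List (List Bool))
    (x y : Fin k → Fin 2) : ℂ :=
  ∏ j : Fin k, sicD (letterOf (L.getD (t.getD j []).length (false, false))) (x j) (y j)

/-- The total weight. -/
noncomputable def weightSum (l : List Item) : ℝ := (l.map fun e => (e.2 : ℝ)).sum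

/-- The precision of the tests. -/
noncomputable def precision (E : ℕ) (N : List Bool) : ℝ := 1 / 2 ^ (E * (N.length + 1))

/-- The matrix that has to be positive semidefinite for the qubits given by `t`. -/
noncomputable def testMatrix (k E : ℕ) (p : Data) (t : List (List Bool)) :
    Matrix (Fin k → Fin 2) (Fin k → Fin 2) ℂ :=
  -- The marginal plus `ε` times the identity, all multiplied by the total weight, so that
  -- probabilities need not be normalized.
  Matrix.of fun x y => (p.2.2.2.map fun e => (e.2 : ℂ) * entryProd e.1 t x y).sum +
    if x = y then ((weightSum p.2.2.2 * precision E p.1 : ℝ) : ℂ) else 0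

/-- The position of an entry in the list of the tokens of a local term. -/
def entryIndex {k : ℕ} (x y : Fin k → Fin 2) : ℕ :=
  -- The `k` tokens of the sites come first. Each entry then takes four tokens: numerator and
  -- denominator of its real part and of its imaginary part.
  k + 4 * (2 ^ k * (finFunctionFinEquiv x : ℕ) + (finFunctionFinEquiv y : ℕ))

/-- The real part of an entry of a local term. -/
noncomputable def entryRe {k : ℕ} (g : List (List Bool)) (x y : Fin k → Fin 2) : ℝ :=
  tokVal (g.getD (entryIndex x y) []) (g.getD (entryIndex x y + 1) [])

/-- The imaginary part of an entry of a local term. -/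
noncomputable def entryIm {k : ℕ} (g : List (List Bool)) (x y : Fin k → Fin 2) : ℝ :=
  tokVal (g.getD (entryIndex x y + 2) []) (g.getD (entryIndex x y + 3) [])

/-- The energy of a string. -/
noncomputable def termEnergy (k : ℕ) (g : List (List Bool)) (L : List (Bool × Bool)) : ℝ :=
  (∑ x : Fin k → Fin 2, ∑ y : Fin k → Fin 2,
    ((entryRe g x y : ℂ) + (entryIm g x y : ℂ) * Complex.I) * entryProd L g y x).re

/-- The sum of the absolute values of the real and imaginary parts of the entries. -/
noncomputable def termAbsSum (k : ℕ) (g : List (List Bool)) : ℝ :=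
  ∑ x : Fin k → Fin 2, ∑ y : Fin k → Fin 2, (|entryRe g x y| + |entryIm g x y|)

/-- The energy, times the total weight. -/
noncomputable def testEnergy (k : ℕ) (p : Data) : ℝ :=
  (p.2.2.2.map fun e => (e.2 : ℝ) * (p.2.1.map fun g => termEnergy k g e.1).sum).sum

/-- The bound on the energy. -/
noncomputable def energyBound (k E : ℕ) (p : Data) : ℝ :=
  tokVal (p.2.2.1.getD 0 []) (p.2.2.1.getD 1 []) +
    precision E p.1 * ((p.2.1.map (termAbsSum k)).sum / (2 * 4 ^ k))

open Classical in
/-- All the tests. -/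
noncomputable def checkData (k E : ℕ) (p : Data) : Bool :=
  decide (1 ≤ weightSum p.2.2.2) &&
  -- Tuples that are not strictly increasing pass trivially; each `k`-set of qubits is tested
  -- through its increasing enumeration.
  (allTuples (positions p.1) k (fun t =>
    !decide (∀ i : Fin k × Fin k, i.1 < i.2 → (t.getD i.1 []).length < (t.getD i.2 []).length) ||
      decide (testMatrix k E p t).PosSemidef) &&
  decide (testEnergy k p ≤ energyBound k E p * weightSum p.2.2.2))

/-- Needed for arbitrary data, also those that come from no input, since `PolyTime.posSemidef`
decides families of Hermitian matrices only. -/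
theorem isHermitian_testMatrix (k E : ℕ) (p : Data) (t : List (List Bool)) :
    (testMatrix k E p t).IsHermitian := by
  ext x y
  simp only [Matrix.conjTranspose_apply, testMatrix, Matrix.of_apply, star_add]
  congr 1
  · have hs : ∀ l : List ℂ, star l.sum = (l.map star).sum := fun l =>
      map_list_sum (starRingEnd ℂ) l
    rw [hs, List.map_map]
    congr 1
    refine List.map_congr_left fun e _ => ?_
    simp only [Function.comp_apply, star_mul', star_natCast, entryProd, star_prod,
      sicD_isHermitian]
  · by_cases h : x = y
    · subst h; simp
    · simp [h, Ne.symm h]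

theorem ComplexPT.entryProd {k : ℕ} {L : α → List (Bool × Bool)} {t : α → List (List Bool)}
    (hL : PolyTime L) (ht : PolyTime t) (x y : Fin k → Fin 2) :
    ComplexPT fun a => entryProd (L a) (t a) x y :=
  ComplexPT.finset_prod _ fun j => ComplexPT.sicD (PolyTime.getD_length hL (ht.getD j []) _) _ _

theorem RealPT.weightSum {l : α → List Item} (hl : PolyTime l) : RealPT fun a => weightSum (l a) :=
  RealPT.list_sum (f := fun _ (e : Item) => (e.2 : ℝ)) hl (RealPT.natCast (by fun_prop))

theorem RealPT.precision {N : α → List Bool} (hN : PolyTime N) (E : ℕ) :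
    RealPT fun a => precision E (N a) := RealPT.two_pow_inv hN E

theorem ComplexPT.testMatrix (k E : ℕ) {p : α → Data} {t : α → List (List Bool)}
    (hp : PolyTime p) (ht : PolyTime t) (x y : Fin k → Fin 2) :
    ComplexPT fun a => testMatrix k E (p a) (t a) x y := by
  simp only [StackProg.testMatrix, Matrix.of_apply]
  refine ComplexPT.add (ComplexPT.list_sum (f := fun a (e : Item) =>
    (e.2 : ℂ) * StackProg.entryProd e.1 (t a) x y) (by fun_prop) (ComplexPT.mul ?_ ?_)) ?_
  · exact (ComplexPT.ofReal (RealPT.natCast (e := fun z : α × Item => z.2.2) (by fun_prop))).congr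
      fun z => Complex.ofReal_natCast _
  · exact ComplexPT.entryProd (L := fun z : α × Item => z.2.1) (t := fun z => t z.1)
      (by fun_prop) (by fun_prop) x y
  · by_cases h : x = y
    · simp only [h, if_true]
      exact .ofReal (.mul (.weightSum (by fun_prop)) (.precision (by fun_prop) E))
    · simp only [h, if_false]
      exact .zero

theorem RealPT.entryRe {k : ℕ} {g : α → List (List Bool)} (hg : PolyTime g) (x y : Fin k → Fin 2) :
    RealPT fun a => entryRe (g a) x y := .tokVal (hg.getD _ _) (hg.getD _ _)

theorem RealPT.entryIm {k : ℕ} {g : α → List (List Bool)} (hg : PolyTime g) (x y : Fin k → Fin 2) :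
    RealPT fun a => entryIm (g a) x y := .tokVal (hg.getD _ _) (hg.getD _ _)

theorem RealPT.termEnergy (k : ℕ) {g : α → List (List Bool)} {L : α → List (Bool × Bool)}
    (hg : PolyTime g) (hL : PolyTime L) : RealPT fun a => termEnergy k (g a) (L a) := by
  have hI : ComplexPT fun _ : α => Complex.I := ⟨.zero, .one⟩
  exact (ComplexPT.finset_sum _ fun x => ComplexPT.finset_sum _ fun y =>
    ((ComplexPT.ofReal (.entryRe hg x y)).add ((ComplexPT.ofReal (.entryIm hg x y)).mul hI)).mul
      (ComplexPT.entryProd hL hg y x)).1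

theorem RealPT.termAbsSum (k : ℕ) {g : α → List (List Bool)} (hg : PolyTime g) :
    RealPT fun a => termAbsSum k (g a) :=
  .finset_sum _ fun x => .finset_sum _ fun y => .add (.abs (.entryRe hg x y)) (.abs (.entryIm hg x y))

theorem RealPT.testEnergy (k : ℕ) : RealPT (testEnergy k) := by
  refine RealPT.list_sum (e := fun p : Data => p.2.2.2) (f := fun p (e : Item) =>
    (e.2 : ℝ) * (p.2.1.map fun g => StackProg.termEnergy k g e.1).sum) (by fun_prop)
    (RealPT.mul (.natCast (by fun_prop)) ?_)
  exact RealPT.list_sum (e := fun z : Data × Item => z.1.2.1)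
    (f := fun z g => StackProg.termEnergy k g z.2.1) (by fun_prop)
    (.termEnergy k (by fun_prop) (by fun_prop))

theorem RealPT.energyBound (k E : ℕ) : RealPT (energyBound k E) := by
  refine RealPT.add (.tokVal (PolyTime.getD (by fun_prop) _ _) (PolyTime.getD (by fun_prop) _ _))
    (RealPT.mul (.precision (by fun_prop) E) ?_)
  refine ((RealPT.list_sum (e := fun p : Data => p.2.1) (f := fun _ g => StackProg.termAbsSum k g)
    (by fun_prop) (.termAbsSum k (by fun_prop))).div_nat (2 * 4 ^ k)).congr fun p => ?_
  push_cast
  rfl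

open Classical in
theorem polyTime_checkData (k E : ℕ) : PolyTime (checkData k E) := by
  refine PolyTime.and (RealPT.le .one (.weightSum (by fun_prop))) (PolyTime.and ?_
    (RealPT.le (.testEnergy k) ((RealPT.energyBound k E).mul (.weightSum (by fun_prop)))))
  refine PolyTime.allTuples (f := fun p : Data => positions p.1) (h := fun p t =>
    !decide (∀ i : Fin k × Fin k, i.1 < i.2 → (t.getD i.1 []).length < (t.getD i.2 []).length) ||
      decide (testMatrix k E p t).PosSemidef) (.positions (by fun_prop)) (PolyTime.or
        (PolyTime.not (PolyTime.decide_forall fun i => ?_)) ?_) k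
  · by_cases h : i.1 < i.2
    · simp only [h, true_imp_iff]
      exact PolyTime.length_lt (PolyTime.getD (by fun_prop) _ _) (PolyTime.getD (by fun_prop) _ _)
    · simp only [h, false_imp_iff, decide_true]
      exact .const true
  · exact PolyTime.posSemidef (M := fun z : Data × List (List Bool) => testMatrix k E z.1 z.2)
      (fun x y => ComplexPT.testMatrix k E (by fun_prop) (by fun_prop) x y)
      fun z => isHermitian_testMatrix ..

/-- The verifier. -/
noncomputable def verify (k E : ℕ) (l : List Sym) : Bool :=
  (match (readWitness (readAll l).1 (readAll l).2.2.2.2 (.start, false, [], [], [], [])).1 with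
    | .done => true
    | _ => false) &&
  checkData k E ((readAll l).1, (readAll l).2.2.1, (readAll l).2.2.2.1,
    witnessItems (readWitness (readAll l).1 (readAll l).2.2.2.2 (.start, false, [], [], [], [])))

theorem polyTime_verify (k E : ℕ) : PolyTime (verify k E) := by
  have h0 := polyTime_readAll
  have h1 := PolyTime.readWitness (N := fun l => (readAll l).1)
    (w := fun l => (readAll l).2.2.2.2) (by fun_prop) (by fun_prop)
  refine PolyTime.and (PolyTime.of_finite_cases (g := fun (d : Phase) (_ : List Sym) => match d with
    | .done => true
    | _ => false) finDat_injective h1.fst fun d => ?_) ((polyTime_checkData k E).comp ?_)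
  · cases d <;> exact .const _
  · have h2 := PolyTime.witnessItems h1
    fun_prop

end StackProg

namespace StackProg

open Computability (encodeNat)
open QuasiQuantum
open scoped ComplexOrder Matrix

/-! ### Correctness of the tests -/

theorem drop_flatMap_of_length {δ ε : Type*} {f : δ → List ε} {m : ℕ} (hf : ∀ a, (f a).length = m)
    (i : ℕ) (l : List δ) : (l.flatMap f).drop (m * i) = (l.drop i).flatMap f := by
  induction i generalizing l with
  | zero => simp
  | succ i ih =>
    cases l with
    | nil => simp
    | cons a l =>
      rw [List.flatMap_cons, List.drop_succ_cons, ← ih l, List.drop_append, hf,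
        List.drop_eq_nil_of_le (by rw [hf, Nat.mul_succ]; omega), List.nil_append]
      congr 1
      rw [Nat.mul_succ]; omega

theorem getD_flatMap_finRange {ε : Type*} {m M : ℕ} {f : Fin M → List ε}
    (hf : ∀ a, (f a).length = m) (i : Fin M) {j : ℕ} (hj : j < m) (d : ε) :
    ((List.finRange M).flatMap f).getD (m * i + j) d = (f i).getD j d := by
  have h := drop_flatMap_of_length hf i (List.finRange M)
  rw [List.drop_eq_getElem_cons (i := i) (l := List.finRange M) (by simp), List.getElem_finRange,
    List.flatMap_cons] at h
  rw [List.getD_eq_getElem?_getD, ← List.getElem?_drop, h,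
    List.getElem?_append_left (by rw [hf]; exact hj), List.getD_eq_getElem?_getD]
  rfl

section terms
variable {n k : ℕ} (h : LocalTerm n k)

theorem length_entryToks (r c : Fin (2 ^ k)) : (entryToks h r c).length = 4 := rfl

theorem length_rowToks (r : Fin (2 ^ k)) :
    ((List.finRange (2 ^ k)).flatMap (entryToks h r)).length = 4 * 2 ^ k := by
  simp [List.length_flatMap, length_entryToks, mul_comm]

theorem getD_termToks_entry (x y : Fin k → Fin 2) {i : ℕ} (hi : i < 4) :
    (termToks h ++ [[]]).getD (entryIndex x y + i) [] =
      (entryToks h (finFunctionFinEquiv x) (finFunctionFinEquiv y)).getD i [] := by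
  rw [← getD_flatMap_finRange (length_entryToks h (finFunctionFinEquiv x)) _ hi,
    ← getD_flatMap_finRange (length_rowToks h) (finFunctionFinEquiv x) (j := 4 * _ + i) (by omega),
    termToks, List.append_assoc, entryIndex, List.getD_append_right _ _ _ _ (by simp; omega),
    List.getD_append]
  · congr 1
    simp only [List.length_map, List.length_finRange]
    rw [mul_add, mul_assoc]; omega
  · simp only [List.length_map, List.length_finRange, List.length_flatMap, length_entryToks,
      List.map_const', List.sum_replicate, smul_eq_mul]
    have h1 := (finFunctionFinEquiv x).2
    have h2 := (finFunctionFinEquiv y).2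
    have h3 : 2 ^ k * ((finFunctionFinEquiv x : ℕ) + 1) ≤ 2 ^ k * 2 ^ k :=
      Nat.mul_le_mul_left _ h1
    rw [mul_add] at h3
    rw [← mul_assoc]
    omega

theorem entryRe_termToks (x y : Fin k → Fin 2) :
    entryRe (termToks h ++ [[]]) x y = h.re x y := by
  have h0 := getD_termToks_entry h x y (i := 0) (by norm_num)
  rw [add_zero] at h0
  rw [entryRe, h0, getD_termToks_entry h x y (by norm_num)]
  simp [entryToks, ratToks, tokVal_rat]

theorem entryIm_termToks (x y : Fin k → Fin 2) :
    entryIm (termToks h ++ [[]]) x y = h.im x y := by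
  rw [entryIm, getD_termToks_entry h x y (by norm_num), getD_termToks_entry h x y (by norm_num)]
  simp [entryToks, ratToks, tokVal_rat]

theorem getD_termToks_site (j : Fin k) :
    ((termToks h ++ [[]]).getD j []).length = (h.sites j : ℕ) := by
  rw [termToks, List.append_assoc, List.getD_append _ _ _ _ (by simp)]
  simp [List.getD]

theorem termAbsSum_termToks : termAbsSum k (termToks h ++ [[]]) = h.absSum := by
  simp only [termAbsSum, entryRe_termToks, entryIm_termToks, LocalTerm.absSum]
  push_cast
  rfl

/-- The string with the given letters. -/
def stringOf (n : ℕ) (L : List (Bool × Bool)) : Fin n → Fin 4 :=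
  fun i => letterOf (L.getD i (false, false))

theorem termEnergy_termToks (L : List (Bool × Bool)) :
    termEnergy k (termToks h ++ [[]]) L = (h.expect (stringOf n L)).re := by
  simp only [termEnergy, entryRe_termToks, entryIm_termToks, entryProd, getD_termToks_site]
  rfl

end terms

theorem toDesc_eq (n : ℕ) (l : List Item) : toDesc n l = l.map fun e => (stringOf n e.1, e.2) := rfl

theorem weightSum_eq (n : ℕ) (l : List Item) : weightSum l = (toDesc n l).total := by
  rw [weightSum, DistDesc.total, toDesc_eq, List.map_map, Nat.cast_list_sum, List.map_map]
  rfl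

theorem sum_dist_toDesc {n : ℕ} {M : Type*} [AddCommGroup M] [Module ℝ M] (l : List Item)
    (h : 0 < (toDesc n l).total) (f : (Fin n → Fin 4) → M) :
    (l.map fun e => (e.2 : ℝ) • f (stringOf n e.1)).sum =
      (weightSum l) • ∑ α, (toDesc n l).dist α • f α := by
  have h0 : ((toDesc n l).total : ℝ) ≠ 0 := by exact_mod_cast h.ne'
  rw [DistDesc.sum_dist_smul, weightSum_eq n, smul_smul, mul_inv_cancel₀ h0, one_smul, toDesc_eq,
    List.map_map]
  rfl

section instance_data
variable {k : ℕ} (x : Instance k) (l : List Item)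

/-- The data for an input and the items of a witness. -/
def dataOf : Data :=
  (List.replicate x.n true, x.terms.map fun h => termToks h ++ [[]],
    ratToks x.a ++ ratToks x.b ++ [[]], l)

theorem energyBound_dataOf (E : ℕ) : energyBound k E (dataOf x l) =
    x.a + 1 / 2 ^ (E * (x.n + 1)) * (x.absSum / (2 * 4 ^ k)) := by
  have h1 : tokVal ((dataOf x l).2.2.1.getD 0 []) ((dataOf x l).2.2.1.getD 1 []) = x.a :=
    tokVal_rat x.a
  have h2 : (((dataOf x l).2.1.map (termAbsSum k)).sum) = x.absSum := by
    simp only [dataOf, List.map_map, Instance.absSum]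
    induction x.terms with
    | nil => simp
    | cons h t ih =>
      simp only [List.map_cons, List.sum_cons, Function.comp_apply, termAbsSum_termToks, ih,
        Rat.cast_add]
  rw [energyBound, h1, h2]
  simp [precision, dataOf]

theorem testEnergy_dataOf (h : 0 < (toDesc x.n l).total) :
    testEnergy k (dataOf x l) = weightSum l * x.energy (opOfDist (toDesc x.n l).dist) := by
  have h1 := sum_dist_toDesc l h x.energyAt
  simp only [smul_eq_mul] at h1
  rw [x.energy_opOfDist, ← h1, testEnergy]
  congr 1
  refine List.map_congr_left fun e _ => ?_
  simp only [dataOf, List.map_map, Instance.energyAt]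
  congr 2
  exact List.map_congr_left fun t _ => termEnergy_termToks t e.1

variable {l} in
-- The test matrix is the perturbed marginal, scaled by the positive total weight and reindexed
-- along the enumeration of its qubits by `s`. Neither operation affects positivity.
theorem testMatrix_posSemidef_iff (E : ℕ) (h : 0 < (toDesc x.n l).total) (s : Fin k ↪ Fin x.n)
    {t : List (List Bool)} (ht : ∀ j : Fin k, (t.getD j []).length = s j) :
    (testMatrix k E (dataOf x l) t).PosSemidef ↔
      (marginal (Finset.univ.map s) (opOfDist (toDesc x.n l).dist) +
        ((1 / 2 ^ (E * (x.n + 1)) : ℝ) : ℂ) • 1).PosSemidef := by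
  set I := Finset.univ.map s with hI
  let e : Fin k ≃ I := Equiv.ofBijective (fun j => ⟨s j, Finset.mem_map_of_mem _ (Finset.mem_univ j)⟩)
    ⟨fun i j hij => s.injective (congrArg Subtype.val hij), fun ⟨i, hi⟩ => by
      obtain ⟨j, -, rfl⟩ := Finset.mem_map.1 hi
      exact ⟨j, rfl⟩⟩
  have hw : 0 < weightSum l := by
    rw [weightSum_eq x.n]; exact_mod_cast h
  have key : testMatrix k E (dataOf x l) t = weightSum l •
      (marginal I (opOfDist (toDesc x.n l).dist) +
        ((1 / 2 ^ (E * (x.n + 1)) : ℝ) : ℂ) • 1).submatrix (e.arrowCongr (Equiv.refl (Fin 2)))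
          (e.arrowCongr (Equiv.refl (Fin 2))) := by
    ext u v
    have hp : ∀ α : Fin x.n → Fin 4, ∏ i : I, sicD (α i)
        ((e.arrowCongr (Equiv.refl (Fin 2))) u i) ((e.arrowCongr (Equiv.refl (Fin 2))) v i) =
        ∏ j, sicD (α (s j)) (u j) (v j) := by
      intro α
      rw [← e.prod_comp]
      refine Finset.prod_congr rfl fun j _ => ?_
      change sicD (α (s j)) (u (e.symm (e j))) (v (e.symm (e j))) = _
      rw [e.symm_apply_apply]
    have hsum := sum_dist_toDesc l h fun α => ∏ j, sicD (α (s j)) (u j) (v j)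
    simp only [Complex.real_smul, Complex.ofReal_natCast] at hsum
    simp only [testMatrix, Matrix.of_apply, Matrix.smul_apply, Matrix.submatrix_apply,
      Matrix.add_apply, marginal_opOfDist, hp, Matrix.one_apply, smul_add, Complex.real_smul,
      ← hsum, EmbeddingLike.apply_eq_iff_eq]
    congr 1
    · simp only [entryProd, ht]
      rfl
    · simp [precision, dataOf]
  rw [key]
  rw [← Matrix.posSemidef_submatrix_equiv (e.arrowCongr (Equiv.refl (Fin 2)))]
  have hc : ∀ r : ℝ, 0 ≤ r → ∀ A : Matrix (Fin k → Fin 2) (Fin k → Fin 2) ℂ, A.PosSemidef →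
      (r • A).PosSemidef := fun r hr A hA => hA.smul hr
  refine ⟨fun H => ?_, hc _ hw.le _⟩
  have := hc (weightSum l)⁻¹ (inv_nonneg.2 hw.le) _ H
  rwa [smul_smul, inv_mul_cancel₀ hw.ne', one_smul] at this

open Classical in
theorem checkData_iff (E : ℕ) : checkData k E (dataOf x l) = true ↔
    x.Accepts (1 / 2 ^ (E * (x.n + 1))) (toDesc x.n l) := by
  have h1 : 1 ≤ weightSum l ↔ 0 < (toDesc x.n l).total := by
    rw [weightSum_eq x.n]; exact_mod_cast Iff.rfl
  have hN : (dataOf x l).1.length = x.n := List.length_replicate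
  have hI : ∀ s : Fin k ↪ Fin x.n, (Finset.univ.map s).card = k := by intro s; simp
  by_cases h0 : 0 < (toDesc x.n l).total
  swap
  -- Without positive total weight both sides fail. In the remaining case it may be cancelled from
  -- the tests.
  · refine iff_of_false (fun H => ?_) fun H => h0 H.total_pos
    rw [checkData, Bool.and_eq_true, decide_eq_true_iff] at H
    exact h0 (h1.1 H.1)
  have hw : 0 < weightSum l := lt_of_lt_of_le one_pos (h1.2 h0)
  have hE : testEnergy k (dataOf x l) ≤ energyBound k E (dataOf x l) * weightSum l ↔
      x.energy (opOfDist (toDesc x.n l).dist) ≤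
        x.a + 1 / 2 ^ (E * (x.n + 1)) * (x.absSum / (2 * 4 ^ k)) := by
    rw [testEnergy_dataOf x l h0, energyBound_dataOf, mul_comm, mul_le_mul_iff_left₀ hw]
  have hd : (dataOf x l).2.2.2 = l := rfl
  rw [checkData, Bool.and_eq_true, Bool.and_eq_true, allTuples_iff, decide_eq_true_iff,
    decide_eq_true_iff, hd, hE]
  constructor
  · rintro ⟨-, H2, H3⟩
    refine ⟨h0, fun I hIk => ?_, H3⟩
    -- The increasing enumeration of `I` gives a tuple that the verifier does not skip.
    let s : Fin k ↪o Fin x.n := I.orderEmbOfFin hIk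
    have hs : Finset.univ.map s.toEmbedding = I := by
      rw [← Finset.coe_inj]; simp [s]
    choose tok htok using fun i : Fin x.n =>
      exists_mem_positions (N := (dataOf x l).1) (i := i) (by rw [hN]; exact i.2)
    have ht : ∀ j : Fin k, ((List.ofFn fun j => tok (s j)).getD j []).length = s j := by
      intro j
      simp [List.getD, (htok _).2]
    have := H2 (List.ofFn fun j => tok (s j)) (by simp) (by
      intro b hb
      obtain ⟨j, rfl⟩ := (List.mem_ofFn' _ _).1 hb
      exact (htok _).1)
    rw [Bool.or_eq_true, decide_eq_true_iff, Bool.not_eq_true', decide_eq_false_iff_not] at this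
    rcases this with this | this
    · exact absurd (fun i hi => by rw [ht, ht]; exact s.strictMono hi) this
    · rw [← hs]
      exact (testMatrix_posSemidef_iff x E h0 s.toEmbedding ht).1 this
  · intro H
    refine ⟨h1.2 h0, fun t ht hmem => ?_, H.energy_le⟩
    rw [Bool.or_eq_true, decide_eq_true_iff, Bool.not_eq_true', decide_eq_false_iff_not]
    by_cases hmono : ∀ i : Fin k × Fin k, i.1 < i.2 →
        (t.getD i.1 []).length < (t.getD i.2 []).length
    · right
      have hlt : ∀ j : Fin k, (t.getD j []).length < x.n := by
        intro j
        have hj : (j : ℕ) < t.length := by rw [ht]; exact j.2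
        rw [List.getD_eq_getElem _ _ hj, ← hN]
        exact length_lt_of_mem_positions (hmem _ (List.getElem_mem hj))
      have hs : StrictMono fun j : Fin k => (⟨(t.getD j []).length, hlt j⟩ : Fin x.n) :=
        fun i j hij => hmono (i, j) hij
      exact (testMatrix_posSemidef_iff x E h0 ⟨_, hs.injective⟩ fun j => rfl).2
        (H.locallyPositive _ (hI _))
    · exact Or.inl hmono

end instance_data

/-- Valid for every bit string: whatever the reader has extracted is some description, and
acceptance forces it to pass the tests. This is why soundness covers witnesses that are not of the
form `W.encode`. -/
theorem verify_encPair_iff {k : ℕ} (E : ℕ) (x : Instance k) (w : List Bool) :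
    verify k E (encPair encInstance (x, w)) = true ↔
      (readWitness (List.replicate x.n true) w (.start, false, [], [], [], [])).1 = .done ∧
      x.Accepts (1 / 2 ^ (E * (x.n + 1))) (toDesc x.n (witnessItems
        (readWitness (List.replicate x.n true) w (.start, false, [], [], [], [])))) := by
  rw [verify, readAll_encPair, Bool.and_eq_true, ← checkData_iff]
  refine and_congr ?_ Iff.rfl
  cases (readWitness (List.replicate x.n true) w (.start, false, [], [], [], [])).1 <;> simp

theorem verify_encode_iff {k : ℕ} (E : ℕ) (x : Instance k) (W : DistDesc x.n) :
    verify k E (encPair encInstance (x, W.encode)) = true ↔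
      x.Accepts (1 / 2 ^ (E * (x.n + 1))) W := by
  rw [verify_encPair_iff, toDesc_witnessItems, readWitness_encode]
  simp

end StackProg


/-! ### The verifier and the main theorem -/

namespace QuasiQuantum

open StackProg

/-- The verifier with precision `2 ^ (-E (n + 1))`. -/
noncomputable def verifier (k E : ℕ) (xw : Instance k × List Bool) : Bool :=
  verify k E (encPair encInstance xw)

/-- A bound on the length of the witnesses. -/
noncomputable def witnessBound (k E : ℕ) : Polynomial ℕ :=
  (.X ^ k * 4 ^ k + 1) * (4 * .X + 2 * (.C E * (.X + 1)) + 10 * .C k + 10) + 1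

theorem le_length_encInstance {k : ℕ} (x : Instance k) : x.n ≤ (encInstance x).length := by
  simp only [encInstance, encUnary, List.length_append, List.length_replicate]
  omega

/-- Because `n` is given in unary it is at most the input length, and `binom(n,k) ≤ n^k` with `k`
constant. -/
theorem le_eval_witnessBound {k : ℕ} (E : ℕ) (x : Instance k) :
    (x.n.choose k * 4 ^ k + 1) * (4 * x.n + 2 * (E * (x.n + 1)) + 10 * k + 10) + 1 ≤
      (witnessBound k E).eval (encInstance x).length := by
  have h1 := le_length_encInstance x
  have h2 : x.n.choose k ≤ (encInstance x).length ^ k :=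
    (Nat.choose_le_pow x.n k).trans (Nat.pow_le_pow_left h1 k)
  simp only [witnessBound, Polynomial.eval_add, Polynomial.eval_mul, Polynomial.eval_pow,
    Polynomial.eval_X, Polynomial.eval_C, Polynomial.eval_one, Polynomial.eval_ofNat]
  gcongr

theorem scale_nonneg {k : ℕ} (x : Instance k) : 0 ≤ x.scale := by
  refine List.sum_nonneg fun r hr => ?_
  obtain ⟨h, -, rfl⟩ := List.mem_map.1 hr
  exact norm_nonneg _

theorem isNPVerifier_verifier {k C E : ℕ} {c : ℝ} (hCE : C ≤ E) (hkE : k ≤ E)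
    (hcE : 2 * 4 ^ k * (1 + 2 * 4 ^ k) < c * 2 ^ E) :
    IsNPVerifier encInstance (qqLH k c C) (verifier k E) (witnessBound k E) where
  polyTime := tm2ComputableInPolyTime_of_PT _ _ _ (polyTime_verify k E) fun _ => rfl
  complete x hx := by
    obtain ⟨W, -, h1, h2, -⟩ := Instance.exists_accepts hx.2 (E * (x.n + 1))
    exact ⟨W.encode, h2.trans (le_eval_witnessBound E x), (verify_encode_iff E x W).2 h1⟩
  sound x hx w := by
    by_contra h
    have h1 := (verify_encPair_iff E x w).1 (by simpa [verifier] using h)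
    exact absurd (h1.2.lt hx.1 hCE hkE hcE) (not_lt.2 hx.2)

end QuasiQuantum

theorem mainTheorem2 (k : ℕ) (hk : 1 ≤ k) (c : ℝ) (hc : 0 < c) (C : ℕ) :
    QuasiQuantum.InNP QuasiQuantum.encInstance (QuasiQuantum.qqLH k c C) ∧
    ∀ D : ℕ, ∃ (V : QuasiQuantum.Instance k × List Bool → Bool) (p : Polynomial ℕ),
      QuasiQuantum.IsNPVerifier QuasiQuantum.encInstance (QuasiQuantum.qqLH k c C) V p ∧
      (∀ x ∈ (QuasiQuantum.qqLH k c C).yes,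
        ∃ (W : QuasiQuantum.DistDesc x.n) (X₀ : QuasiQuantum.QubitOp x.n),
          0 < W.total ∧
          W.encode.length ≤ p.eval (QuasiQuantum.encInstance x).length ∧
          V (x, W.encode) = true ∧
          (Function.support W.dist).ncard ≤ x.n.choose k * 4 ^ k + 1 ∧
          x.IsQQGroundState X₀ ∧
          ∀ I : Finset (Fin x.n), I.card = k →
            QuasiQuantum.opNorm (QuasiQuantum.marginal I (QuasiQuantum.opOfDist W.dist) -
              QuasiQuantum.marginal I X₀) ≤ 1 / 2 ^ (D * x.n)) ∧
      (∀ (x : QuasiQuantum.Instance k) (W : QuasiQuantum.DistDesc x.n),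
        V (x, W.encode) = true →
          0 < W.total ∧
          QuasiQuantum.LocallyPositiveUpTo k (1 / 2 ^ (D * x.n))
            (QuasiQuantum.opOfDist W.dist) ∧
          x.energy (QuasiQuantum.opOfDist W.dist) ≤ x.a + x.scale / 2 ^ (D * x.n)) ∧
      (∀ (x : QuasiQuantum.Instance k) (W : QuasiQuantum.DistDesc x.n),
        0 < W.total →
        QuasiQuantum.LocallyPositiveUpTo k 0 (QuasiQuantum.opOfDist W.dist) →
        x.energy (QuasiQuantum.opOfDist W.dist) ≤ x.a →
          V (x, W.encode) = true) := by
  -- The precision exponent is `E = E₀ + C + k + D`: `E₀` beats the constants against `c`, `C`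
  -- matches the promise gap, `k` ensures `2^k ε ≤ 1` for the mixture, and `D` is the precision
  -- asked for.
  obtain ⟨E₀, hE₀⟩ := pow_unbounded_of_one_lt (2 * 4 ^ k * (1 + 2 * 4 ^ k) / c) one_lt_two
  rw [div_lt_iff₀' hc] at hE₀
  have hE : ∀ D, 2 * 4 ^ k * (1 + 2 * 4 ^ k) < c * 2 ^ (E₀ + C + k + D) := fun D =>
    hE₀.trans_le (mul_le_mul_of_nonneg_left
      (pow_le_pow_right₀ one_le_two (by omega)) hc.le)
  have hε : ∀ D n : ℕ, (1 : ℝ) / 2 ^ ((E₀ + C + k + D) * (n + 1)) ≤ 1 / 2 ^ (D * n) := fun D n =>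
    one_div_le_one_div_of_le (by positivity) (pow_le_pow_right₀ one_le_two
      (Nat.mul_le_mul (by omega) (by omega)))
  have hV := fun D => QuasiQuantum.isNPVerifier_verifier (C := C) (E := E₀ + C + k + D) (by omega)
    (by omega) (hE D)
  refine ⟨⟨_, _, hV 0⟩, fun D => ⟨_, _, hV D, fun x hx => ?_, fun x W h => ?_, fun x W h0 h1 h2 =>
    (StackProg.verify_encode_iff _ x W).2 ?_⟩⟩
  · obtain ⟨W, X₀, h1, h2, h3, h4, h5⟩ :=
      QuasiQuantum.Instance.exists_accepts hx.2 ((E₀ + C + k + D) * (x.n + 1))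
    exact ⟨W, X₀, h1.total_pos, h2.trans (QuasiQuantum.le_eval_witnessBound _ x),
      (StackProg.verify_encode_iff _ x W).2 h1, h3, h4, fun I hI => (h5 I hI).trans (hε D x.n)⟩
  · have h1 := (StackProg.verify_encode_iff _ x W).1 h
    refine ⟨h1.total_pos, h1.locallyPositive.mono (hε D x.n),
      (h1.energy_le_scale (by positivity)).trans ?_⟩
    have h2 := mul_le_mul_of_nonneg_right (hε D x.n) (QuasiQuantum.scale_nonneg x)
    simp only [one_div_mul_eq_div] at h2 ⊢
    linarith
  · exact QuasiQuantum.Instance.accepts_of_locallyPositive (by positivity) h0 h1 h2
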